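/- **Setting.** For each sample size $n$ let $p=p_n$, $m=m_n$ be positive integers with $p,m\to\infty$ as $n\to\infty$, and let $K$ be fixed and known. Consider $Y=\Theta^TX+B^TZ+E\in\mathbb R^m$, where $X\in\mathbb R^p$ is observed, $Z\in\mathbb R^K$ is hidden, $E(X)=0$, $E(Z)=0$, $Z$ has finite second moments, and the noise $E\in\mathbb R^m$ is independent of $(X,Z)$. We observe $(\mathbf Y,\mathbf X)\in\mathbb R^{n\times m}\times\mathbb R^{n\times p}$, whose rows are $n$ i.i.d. copies of $(Y,X)$. All parameters and laws may depend on $n$. Let $A=(E[XX^T])^{-1}E[XZ^T]$, with first row $A_{1\cdot}$, $W=Z-A^TX$, $F=\Theta+AB$, and $\Sigma,\Sigma_W,\Sigma_E$ the covariance matrices of $X,W,E$; $B_j$, $\Theta_j$ are $j$-th columns, $\sigma_{E_1}^2=[\Sigma_E]_{11}$, and $s_\Omega$ is the number of nonzero entries of the first column of $\Sigma^{-1}$. $\|\cdot\|_0$ counts nonzero entries, $\lambda_{\min},\lambda_{\max}$ are extreme eigenvalues, and $a\vee b=\max(a,b)$. Assume $\Theta$ has at most $s_n$ nonzero rows ($1\le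 s_n\le p$), each row of $\ell_1$-norm at most $M_n>0$. A centered random vector $V$ is called $\gamma$ sub-Gaussian if $E\,e^{\langle u,V\rangle}\le e^{\gamma^2\|u\|_2^2/2}$ for all $u$. **Estimator.** For $\lambda\ge0$ let $P_\lambda=\mathbf X(\mathbf X^T\mathbf X+n\lambda I_p)^{-1}\mathbf X^T$ and $Q_\lambda=I_n-P_\lambda$; put $\widehat\Sigma=n^{-1}\mathbf X^T\mathbf X$ and $\sigma_j^2=\gamma_w^2B_j^T\Sigma_WB_j+\gamma_e^2[\Sigma_E]_{jj}$, with $\gamma_w,\gamma_e$ from (1). The ridge parameters $\lambda_2^{(j)}\ge0$ may be measurable functions of $\mathbf X$, and with probability tending to one all the $P_{\lambda_2^{(j)}}$, $1\le j\le m$, exist. Let $$\lambda_1^{(j)}=4\sigma_j\sqrt{6\max_{1\le i\le p}\bigl[n^{-1}\mathbf X^TQ_{\lambda_2^{(j)}}^2\mathbf X\bigr]_{ii}}\sqrt{\frac{\log(p\vee m)}{n}}.$$ For $1\le j\le m$ let $(\widehat\theta^{(j)},\widehat\delta^{(j)})$ be any minimizer over $\theta,\delta\in\mathbb R^p$ of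 $n^{-1}\|\mathbf Y_j-\mathbf X(\theta+\delta)\|_2^2+\lambda_1^{(j)}\|\theta\|_1+\lambda_2^{(j)}\|\delta\|_2^2$, let $\widehat F_j=\widehat\theta^{(j)}+\widehat\delta^{(j)}$ and $\widehat\epsilon=\mathbf Y-\mathbf X\widehat F$. From any singular value decomposition $(nm)^{-1/2}\widehat\epsilon=\sum_k d_ku_kv_k^T$, $d_1\ge d_2\ge\dots\ge 0$, put $\widehat B^T=\sqrt m\,(d_1v_1,\dots,d_Kv_K)$, $\widehat W=\sqrt n\,(u_1,\dots,u_K)$ (defined when $K\le\min(n,m)$, hence for all large $n$), and $$\widehat\sigma_{E_1}^2=\frac1n\bigl\|\widehat\epsilon_1-\widehat W\widehat B_1\bigr\|_2^2 .$$ **Assumptions**, with positive constants $\gamma_w$, $\gamma_e$, $c_W\le C_W$, $c_B\le C_B$, $C_E$, $c_\epsilon$, $c<C$ that do not depend on $n$. 1. $\Sigma_W$ and $\Sigma_E$ are invertible, $\Sigma_W^{-1/2}W$ is $\gamma_w$ sub-Gaussian, $\Sigma_E^{-1/2}E$ is $\gamma_e$ sub-Gaussian, and $W$ is independent of $X$.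 2. $c_W\le\lambda_{\min}(\Sigma_W)\le\lambda_{\max}(\Sigma_W)\le C_W$; $\max_j\|B_j\|_2^2\le C_B$; $\lambda_{\min}(BB^T)\ge c_Bm$; $\lambda_{\max}(\Sigma_E)\le C_E$; $\min_j(B_j^T\Sigma_WB_j+[\Sigma_E]_{jj})\ge c_\epsilon$. 3. $X\sim N_p(0,\Sigma)$ with $\max_j\Sigma_{jj}\le C$ and $c\le\lambda_{\min}(\Sigma)\le\max_{|S|\le s_n}\lambda_{\max}(\Sigma_{SS})\le C$. 4. There is a deterministic sequence $r_n>0$, $r_n\to0$, such that with probability tending to one $\max_{1\le j\le m}[\mathrm{Rem}_{1,j}+\mathrm{Rem}_{2,j}+\mathrm{Rem}_{3,j}]\le r_n$. Here, with $\delta_j=AB_j$ and $\lambda_2=\lambda_2^{(j)}$, $$\mathrm{Rem}_{1,j}=\bigl(\mathrm{tr}(P_{\lambda_2}^2)+\|P_{\lambda_2}^2\|_{\rm op}\log m\bigr)\tfrac{\sigma_j^2}{n},\qquad \mathrm{Rem}_{2,j}=\lambda_2\,\delta_j^T\widehat\Sigma(\widehat\Sigma+\lambda_2I_p)^{-1}\delta_j,$$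 $$\mathrm{Rem}_{3,j}=\frac{\lambda_2(\Lambda_1+\lambda_2)}{(\Lambda_q+\lambda_2)^2}\Bigl(\max_{1\le i\le p}\widehat\Sigma_{ii}\Bigr)\frac{\|\Theta_j\|_0\log(p\vee m)}{\kappa^2(s_n,4)}\,\frac{\sigma_j^2}{n},$$ where $\Lambda_1$ and $\Lambda_q$ are the largest and the smallest nonzero eigenvalue of $\widehat\Sigma$, and $\kappa(s,\alpha)$ is the minimum of $\|\mathbf Xv\|_2/(\sqrt n\|v_S\|_2)$ over $S\subseteq\{1,\dots,p\}$ with $|S|\le s$ and over $v\in\mathbb R^p\setminus\{0\}$ with $\|v_{S^c}\|_1\le\alpha\|v_S\|_1$. ($\mathrm{Rem}_{3,j}=\infty$ if $\kappa(s_n,4)=0$ and the numerator is positive; $\mathrm{Rem}_{3,j}=0$ if the numerator is $0$.) 5. $E_1\sim N(0,\sigma_{E_1}^2)$, $\|\mathrm{Cov}(Z)\|_{\rm op}=O(1)$, $(s_n\vee s_\Omega)\log(p)\log(m)=o(n)$, $s_n\log p=o(\sqrt n)$, $M_n\sqrt n=o(m)$ and $$\|A_{1\cdot}\|_2\sqrt{\log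 m}+\Bigl(\|A_{1\cdot}\|_2\sqrt n+\sqrt{(s_n\vee s_\Omega)\log p}\Bigr)r_n=o(1).$$ **Conclusion.** $\widehat\sigma_{E_1}^2$ is consistent: $|\widehat\sigma_{E_1}^2-\sigma_{E_1}^2|=o_{\mathbb P}(1)$ as $n\to\infty$, that is, $\mathbb P(|\widehat\sigma_{E_1}^2-\sigma_{E_1}^2|\ge\eta)\to0$ for every $\eta>0$. -/

import Mathlib

open MeasureTheory ProbabilityTheory Filter Topology Asymptotics

noncomputable section

namespace HiddenVar

/-- Euclidean norm of a coordinate vector. -/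
def l2norm {d : ℕ} (v : Fin d → ℝ) : ℝ := Real.sqrt (∑ i, v i ^ 2)

/-- `ℓ₁` norm of a coordinate vector. -/
def l1norm {d : ℕ} (v : Fin d → ℝ) : ℝ := ∑ i, |v i|

/-- `ℓ₀` "norm": the number of nonzero coordinates. -/
def l0norm {d : ℕ} (v : Fin d → ℝ) : ℕ := Set.ncard {i | v i ≠ 0}

/-- Operator norm (with respect to Euclidean norms) of a square matrix; for a positive
semidefinite matrix this is its largest eigenvalue. -/
def opNorm {ι : Type*} [Fintype ι] [DecidableEq ι] (M : Matrix ι ι ℝ) : ℝ :=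
  ‖Matrix.toEuclideanCLM (𝕜 := ℝ) M‖

/-- All eigenvalues of the symmetric matrix `M` are at least `c`
(that is, `M - c I` is positive semidefinite). -/
def EigenvaluesGE {ι : Type*} [DecidableEq ι] (M : Matrix ι ι ℝ) (c : ℝ) : Prop :=
  (M - c • (1 : Matrix ι ι ℝ)).PosSemidef

/-- Smallest nonzero eigenvalue of a positive semidefinite matrix. -/
def minPosEigenvalue {d : ℕ} (M : Matrix (Fin d) (Fin d) ℝ) : ℝ :=
  sInf {x : ℝ | 0 < x ∧ ∃ v : Fin d → ℝ, v ≠ 0 ∧ M.mulVec v = x • v}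

/-- Covariance matrix of a law on `ℝ^d`. -/
def covMatrix {d : ℕ} (ν : Measure (Fin d → ℝ)) : Matrix (Fin d) (Fin d) ℝ :=
  Matrix.of fun i j => cov[fun x => x i, fun x => x j; ν]

/-- A law on `ℝ^d` is centered and `γ` sub-Gaussian:
`E exp⟨u, x⟩ ≤ exp(‖u‖² γ² / 2)` for all `u`. -/
structure IsSubGaussianLaw {d : ℕ} (γ : ℝ) (ν : Measure (Fin d → ℝ)) : Prop where
  integrable_coord : ∀ i, Integrable (fun x => x i) ν
  centered : ∀ i, ∫ x, x i ∂ν = 0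
  integrable_exp : ∀ u : Fin d → ℝ, Integrable (fun x => Real.exp (u ⬝ᵥ x)) ν
  mgf_le : ∀ u : Fin d → ℝ,
    ∫ x, Real.exp (u ⬝ᵥ x) ∂ν ≤ Real.exp (l2norm u ^ 2 * γ ^ 2 / 2)

/-- With `S` the covariance matrix of `ν`, assumed invertible, the law of `S^{-1/2} x` under `ν`
is `γ` sub-Gaussian.  Here `R` is the (unique) positive definite square root of `S`. -/
def IsWhitenedSubGaussian {d : ℕ} (γ : ℝ) (ν : Measure (Fin d → ℝ)) : Prop :=
  ∃ R : Matrix (Fin d) (Fin d) ℝ, R.PosDef ∧ R * R = covMatrix ν ∧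
    IsSubGaussianLaw γ (ν.map fun x => R⁻¹.mulVec x)

/-! ### The population model `Y = Θᵀ X + Bᵀ Z + E` -/

/-- Parameters of the model: `p` features, `m` responses, `K` hidden variables, the coefficient
matrices, the joint law of `(X, Z)` and the law of the noise `E`. -/
structure Model (p m K : ℕ) where
  Θ : Matrix (Fin p) (Fin m) ℝ
  B : Matrix (Fin K) (Fin m) ℝ
  lawXZ : Measure ((Fin p → ℝ) × (Fin K → ℝ))
  lawE : Measure (Fin m → ℝ)

namespace Model

variable {p m K : ℕ} (P : Model p m K)

/-- Law of the features `X`. -/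
def lawX : Measure (Fin p → ℝ) := P.lawXZ.map Prod.fst

/-- Law of the hidden variables `Z`. -/
def lawZ : Measure (Fin K → ℝ) := P.lawXZ.map Prod.snd

/-- Law of a full draw `((X, Z), E)`: the noise `E` is independent of `(X, Z)`. -/
def law : Measure (((Fin p → ℝ) × (Fin K → ℝ)) × (Fin m → ℝ)) := P.lawXZ.prod P.lawE

/-- `Σ = Cov(X)`. -/
def Sig : Matrix (Fin p) (Fin p) ℝ := covMatrix P.lawX

/-- `Ω = Σ⁻¹`. -/
def Omega : Matrix (Fin p) (Fin p) ℝ := P.Sig⁻¹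

/-- `A = (E[X Xᵀ])⁻¹ E[X Zᵀ]`. -/
def A : Matrix (Fin p) (Fin K) ℝ :=
  (Matrix.of fun i j => ∫ w, w.1 i * w.1 j ∂P.lawXZ)⁻¹ *
    (Matrix.of fun i k => ∫ w, w.1 i * w.2 k ∂P.lawXZ)

/-- `W = Z - Aᵀ X`. -/
def W (w : (Fin p → ℝ) × (Fin K → ℝ)) : Fin K → ℝ := w.2 - P.A.transpose.mulVec w.1

/-- Law of `W`. -/
def lawW : Measure (Fin K → ℝ) := P.lawXZ.map P.W

/-- `Σ_W = Cov(W)`. -/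
def SigW : Matrix (Fin K) (Fin K) ℝ := covMatrix P.lawW

/-- `Σ_E = Cov(E)`. -/
def SigE : Matrix (Fin m) (Fin m) ℝ := covMatrix P.lawE

/-- `δ_j = A B_j`. -/
def delta (j : Fin m) : Fin p → ℝ := fun i => (P.A * P.B) i j

/-- `B_jᵀ Σ_W B_j`. -/
def hiddenVar (j : Fin m) : ℝ := (fun k => P.B k j) ⬝ᵥ P.SigW.mulVec (fun k => P.B k j)

/-- `σ_j = (γ_w² B_jᵀ Σ_W B_j + γ_e² [Σ_E]_jj)^{1/2}`. -/
def sigma (γw γe : ℝ) (j : Fin m) : ℝ :=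
  Real.sqrt (γw ^ 2 * P.hiddenVar j + γe ^ 2 * P.SigE j j)

/-- Standing conventions: probability laws, `E X = 0`, `E Z = 0`, finite second moments. -/
structure IsStandard : Prop where
  probXZ : IsProbabilityMeasure P.lawXZ
  probE : IsProbabilityMeasure P.lawE
  memX : ∀ i, MemLp (fun w => w.1 i) 2 P.lawXZ
  memZ : ∀ k, MemLp (fun w => w.2 k) 2 P.lawXZ
  meanX : ∀ i, ∫ w, w.1 i ∂P.lawXZ = 0
  meanZ : ∀ k, ∫ w, w.2 k ∂P.lawXZ = 0

/-- `Θ ∈ M(s, M)`: at most `s` nonzero rows, each row of `ℓ₁` norm at most `M`. -/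
def InClass (s : ℕ) (M : ℝ) : Prop :=
  Set.ncard {i | P.Θ i ≠ 0} ≤ s ∧ ∀ i, l1norm (P.Θ i) ≤ M

/-- Sub-Gaussian errors: `Σ_W^{-1/2} W` is `γ_w` and `Σ_E^{-1/2} E` is `γ_e` sub-Gaussian. -/
structure SubGaussianErrors (γw γe : ℝ) : Prop where
  subW : IsWhitenedSubGaussian γw P.lawW
  subE : IsWhitenedSubGaussian γe P.lawE

/-- Regularity of `B`, `Σ_W` and `Σ_E`. -/
structure FactorRegularity (cW CW cB CB CE cε : ℝ) : Prop where
  sigW_ge : EigenvaluesGE P.SigW cW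
  sigW_le : opNorm P.SigW ≤ CW
  B_col_le : ∀ j, l2norm (fun k => P.B k j) ^ 2 ≤ CB
  B_pervasive : EigenvaluesGE (P.B * P.B.transpose) (cB * m)
  sigE_le : opNorm P.SigE ≤ CE
  var_ge : ∀ j, cε ≤ P.hiddenVar j + P.SigE j j

/-- Gaussian design whose covariance has bounded diagonal, smallest eigenvalue bounded below
and `s`-sparse largest eigenvalue bounded above. -/
structure DesignRegularity (s : ℕ) (c C : ℝ) : Prop where
  gaussian : IsGaussian P.lawX
  diag_le : ∀ j, P.Sig j j ≤ C
  eig_ge : EigenvaluesGE P.Sig c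
  sparse_eig_le : ∀ S : Finset (Fin p), S.card ≤ s →
    opNorm (P.Sig.submatrix (fun i : S => (i : Fin p)) (fun i : S => (i : Fin p))) ≤ C

end Model

/-! ### Data matrices -/

section Data

variable {n p m K : ℕ}

/-- A realized sample: row `i` is `((X_i, Z_i), E_i)`. -/
abbrev Sample (n p m K : ℕ) := Fin n → ((Fin p → ℝ) × (Fin K → ℝ)) × (Fin m → ℝ)

/-- The `n × p` design matrix. -/
def designMat (D : Sample n p m K) : Matrix (Fin n) (Fin p) ℝ := Matrix.of fun i => (D i).1.1

/-- The `n × K` matrix of hidden variables. -/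
def hiddenMat (D : Sample n p m K) : Matrix (Fin n) (Fin K) ℝ := Matrix.of fun i => (D i).1.2

/-- The `n × m` noise matrix. -/
def noiseMat (D : Sample n p m K) : Matrix (Fin n) (Fin m) ℝ := Matrix.of fun i => (D i).2

/-- The `n × m` response matrix. -/
def responseMat (P : Model p m K) (D : Sample n p m K) : Matrix (Fin n) (Fin m) ℝ :=
  designMat D * P.Θ + hiddenMat D * P.B + noiseMat D

/-! ### Quantities depending on the design matrix -/

/-- `Σ̂ = n⁻¹ Xᵀ X`. -/
def gram (X : Matrix (Fin n) (Fin p) ℝ) : Matrix (Fin p) (Fin p) ℝ :=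
  (n : ℝ)⁻¹ • (X.transpose * X)

/-- `Xᵀ X + n λ I`. -/
def ridgeMat (X : Matrix (Fin n) (Fin p) ℝ) (lam : ℝ) : Matrix (Fin p) (Fin p) ℝ :=
  X.transpose * X + ((n : ℝ) * lam) • (1 : Matrix (Fin p) (Fin p) ℝ)

/-- `P_λ = X (Xᵀ X + n λ I)⁻¹ Xᵀ`, meaningful when `ridgeMat X lam` is invertible. -/
def Pmat (X : Matrix (Fin n) (Fin p) ℝ) (lam : ℝ) : Matrix (Fin n) (Fin n) ℝ :=
  X * (ridgeMat X lam)⁻¹ * X.transpose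

/-- `Q_λ = I - P_λ`. -/
def Qmat (X : Matrix (Fin n) (Fin p) ℝ) (lam : ℝ) : Matrix (Fin n) (Fin n) ℝ := 1 - Pmat X lam

/-- `M = n⁻¹ Xᵀ Q_λ² X`. -/
def Mmat (X : Matrix (Fin n) (Fin p) ℝ) (lam : ℝ) : Matrix (Fin p) (Fin p) ℝ :=
  (n : ℝ)⁻¹ • (X.transpose * (Qmat X lam * Qmat X lam) * X)

/-- Restricted eigenvalue `κ(s, α)`: the minimum of `‖X v‖₂ / (√n ‖v_S‖₂)` over `|S| ≤ s` and
`v ≠ 0` with `α ‖v_S‖₁ ≥ ‖v_{Sᶜ}‖₁`. -/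
def kappa (X : Matrix (Fin n) (Fin p) ℝ) (s : ℕ) (α : ℝ) : ℝ :=
  sInf {r : ℝ | ∃ (S : Finset (Fin p)) (v : Fin p → ℝ), S.card ≤ s ∧ v ≠ 0 ∧
    ∑ i ∈ Sᶜ, |v i| ≤ α * ∑ i ∈ S, |v i| ∧
    r = l2norm (X.mulVec v) / (Real.sqrt n * Real.sqrt (∑ i ∈ S, v i ^ 2))}

/-- The lasso tuning parameter
`λ₁ = 4 σ (6 max_i M_ii)^{1/2} (log(p ∨ m) / n)^{1/2}` of the `j`-th regression, as a function of
the design and of the ridge parameter `lam`. -/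
def lambdaOne (P : Model p m K) (γw γe : ℝ) (X : Matrix (Fin n) (Fin p) ℝ) (lam : ℝ)
    (j : Fin m) : ℝ :=
  4 * P.sigma γw γe j * Real.sqrt (6 * ⨆ i, Mmat X lam i i) *
    Real.sqrt (Real.log (max p m : ℕ) / n)

/-- `Rem₁ = (tr(P²) + ‖P²‖_op log m) σ_j² / n`. -/
def rem1 (P : Model p m K) (γw γe : ℝ) (X : Matrix (Fin n) (Fin p) ℝ) (lam : ℝ)
    (j : Fin m) : ℝ :=
  ((Pmat X lam * Pmat X lam).trace + opNorm (Pmat X lam * Pmat X lam) * Real.log m) *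
    (P.sigma γw γe j ^ 2 / n)

/-- `Rem₂(δ_j) = λ₂ δ_jᵀ Σ̂ (Σ̂ + λ₂ I)⁻¹ δ_j`. -/
def rem2 (P : Model p m K) (X : Matrix (Fin n) (Fin p) ℝ) (lam : ℝ) (j : Fin m) : ℝ :=
  lam * (P.delta j ⬝ᵥ
    (gram X * (gram X + lam • (1 : Matrix (Fin p) (Fin p) ℝ))⁻¹).mulVec (P.delta j))

/-- `Rem₃(θ_j) = λ₂(Λ₁ + λ₂)/(Λ_q + λ₂)² · max_i Σ̂_ii · ‖Θ_j‖₀ log(p ∨ m) / κ²(s, 4) · σ_j² / n`,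
where `Λ₁` and `Λ_q` are the largest and the smallest nonzero eigenvalue of `Σ̂`.  It is valued in
`[0, ∞]`, and equals `∞` when `κ(s, 4) = 0` and the numerator is positive. -/
def rem3 (P : Model p m K) (γw γe : ℝ) (s : ℕ) (X : Matrix (Fin n) (Fin p) ℝ) (lam : ℝ)
    (j : Fin m) : ENNReal :=
  ENNReal.ofReal
    (lam * (opNorm (gram X) + lam) / (minPosEigenvalue (gram X) + lam) ^ 2 *
      (⨆ i, gram X i i) * (l0norm (fun i => P.Θ i j) * Real.log (max p m : ℕ)) *
      (P.sigma γw γe j ^ 2 / n)) / ENNReal.ofReal (kappa X s 4 ^ 2)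

/-- `Rem₁ + Rem₂(δ_j) + Rem₃(θ_j)`. -/
def remTotal (P : Model p m K) (γw γe : ℝ) (s : ℕ) (X : Matrix (Fin n) (Fin p) ℝ) (lam : ℝ)
    (j : Fin m) : ENNReal :=
  ENNReal.ofReal (rem1 P γw γe X lam j) + ENNReal.ofReal (rem2 P X lam j) +
    rem3 P γw γe s X lam j

/-! ### Estimators -/

/-- Objective `n⁻¹ ‖y - X(θ + δ)‖₂² + λ₁ ‖θ‖₁ + λ₂ ‖δ‖₂²`. -/
def lavaObjective (X : Matrix (Fin n) (Fin p) ℝ) (y : Fin n → ℝ) (l1 l2 : ℝ)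
    (θ δ : Fin p → ℝ) : ℝ :=
  (n : ℝ)⁻¹ * l2norm (y - X.mulVec (θ + δ)) ^ 2 + l1 * l1norm θ + l2 * l2norm δ ^ 2

/-- `(θ, δ)` is a minimizer of the objective. -/
def IsLavaSolution (X : Matrix (Fin n) (Fin p) ℝ) (y : Fin n → ℝ) (l1 l2 : ℝ)
    (θ δ : Fin p → ℝ) : Prop :=
  ∀ θ' δ' : Fin p → ℝ, lavaObjective X y l1 l2 θ δ ≤ lavaObjective X y l1 l2 θ' δ'

/-- `Fhat` is a column-wise lava estimate of `F`: `F̂_j = θ̂^{(j)} + δ̂^{(j)}`. -/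
def IsLavaEstimate (X : Matrix (Fin n) (Fin p) ℝ) (Y : Matrix (Fin n) (Fin m) ℝ)
    (l1 l2 : Fin m → ℝ) (Fhat : Matrix (Fin p) (Fin m) ℝ) : Prop :=
  ∀ j, ∃ θ δ : Fin p → ℝ, IsLavaSolution X (fun i => Y i j) (l1 j) (l2 j) θ δ ∧
    (fun i => Fhat i j) = θ + δ

/-- `M = U diag(d) Vᵀ` is a (thin) singular value decomposition with
`d_0 ≥ d_1 ≥ ⋯ ≥ 0` and `min(n, m)` singular values. -/
structure IsSVD (M : Matrix (Fin n) (Fin m) ℝ) (U : Matrix (Fin n) (Fin (min n m)) ℝ)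
    (d : Fin (min n m) → ℝ) (V : Matrix (Fin m) (Fin (min n m)) ℝ) : Prop where
  left_orthonormal : U.transpose * U = 1
  right_orthonormal : V.transpose * V = 1
  nonneg : ∀ k, 0 ≤ d k
  antitone : Antitone d
  eq : M = U * Matrix.diagonal d * V.transpose

/-- `B̂ᵀ = √m V_K D_K` and `Ŵ = √n U_K`, from a singular value decomposition of
`(nm)^{-1/2} ε̂`. -/
def IsFactorEstimate (εhat : Matrix (Fin n) (Fin m) ℝ) (Bhat : Matrix (Fin K) (Fin m) ℝ)
    (What : Matrix (Fin n) (Fin K) ℝ) : Prop :=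
  ∃ (U : Matrix (Fin n) (Fin (min n m)) ℝ) (d : Fin (min n m) → ℝ)
    (V : Matrix (Fin m) (Fin (min n m)) ℝ) (h : K ≤ min n m),
    IsSVD ((Real.sqrt ((n : ℝ) * m))⁻¹ • εhat) U d V ∧
    (∀ k j, Bhat k j = Real.sqrt m * (V j (Fin.castLE h k) * d (Fin.castLE h k))) ∧
    (∀ i k, What i k = Real.sqrt n * U i (Fin.castLE h k))

/-- The residual matrix `ε̂ = Y - X F̂`. -/
def residual (X : Matrix (Fin n) (Fin p) ℝ) (Y : Matrix (Fin n) (Fin m) ℝ)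
    (Fhat : Matrix (Fin p) (Fin m) ℝ) : Matrix (Fin n) (Fin m) ℝ := Y - X * Fhat

/-- `σ̂²_{E_1} = n⁻¹ ‖ε̂_1 - Ŵ B̂_1‖₂²` (the first response has index `0`). -/
def sigmaHatSq [NeZero m] (εhat : Matrix (Fin n) (Fin m) ℝ) (Bhat : Matrix (Fin K) (Fin m) ℝ)
    (What : Matrix (Fin n) (Fin K) ℝ) : ℝ :=
  (n : ℝ)⁻¹ * l2norm (fun i => εhat i 0 - (What * Bhat) i 0) ^ 2

end Data

end HiddenVar

end

namespace HiddenVar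

open Matrix

/-! ### Euclidean preliminaries -/

/-! Since `Z = W + Aᵀ X`, the response is `X F + (W B + E)` with `F = Θ + A B`. The residual matrix
is therefore `W B + (E + R)` with `R = X (F - F̂)`: a rank-`K` signal plus a perturbation. The proof
needs the operator norm of `E + R` to be `o(√(nm))` and the first column of `R` to be `o(√n)`.

For `E`, `‖E‖⁴ ≤ ‖E Eᵀ‖_F²`, and the expectation of the right side is `O(n m² + n² m)`
(`mulVec_dot_self_le_gram`, `measure_noise_gram_ge_le`). For `R`, minimising out the ridge part of
lava leaves a lasso weighted by `Q_λ`. The error of a column is then at most a multiple of its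
projected noise `‖P_λ e‖²` plus the remainder bound (`lava_prediction_error`). The projected noise
matters only on average over the columns and for the first column, so Markov's inequality and the
trace of `P_λ²` suffice (`measure_proj_noise_ge_le`). Because `(W, E)` is independent of `X`, every
noise bound can be proved with the design held fixed.

Let `U` hold the `K` leading left singular vectors of `ε̂`, so that `Ŵ B̂ = U Uᵀ ε̂`. Singular
values beyond the `K`-th do not exceed the size of the perturbation (`IsSVD.singularValue_sq_le`),
and `B` is pervasive, so `U` almost contains the column space of `W` (`residual_loading_le`). Hence
`ε̂_1 - Ŵ B̂_1` is `(I - U Uᵀ) E_1` up to a small vector. What the projection removes, `‖Uᵀ E_1‖²`,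
is `o(n)` because `Wᵀ E_1 = o(n)` (`proj_noise_le`), and `‖E_1‖² / n` obeys a law of large numbers.
`sigmaHatSq_sub_le` states this deterministically with one tolerance `τ`; the theorem follows by
showing that its hypotheses hold with probability tending to one. -/

lemma l2norm_sq {d : ℕ} (v : Fin d → ℝ) : l2norm v ^ 2 = v ⬝ᵥ v := by
  rw [l2norm, Real.sq_sqrt (Finset.sum_nonneg fun i _ => sq_nonneg _)]
  simp [dotProduct, sq]

lemma l2norm_nonneg {d : ℕ} (v : Fin d → ℝ) : 0 ≤ l2norm v := Real.sqrt_nonneg _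

section

variable {ι κ : Type*} [Fintype ι] [Fintype κ]

lemma dot_self_nonneg (v : ι → ℝ) : 0 ≤ v ⬝ᵥ v :=
  Finset.sum_nonneg fun _ _ => mul_self_nonneg _

lemma dot_sq_le (u v : ι → ℝ) : (u ⬝ᵥ v) ^ 2 ≤ (u ⬝ᵥ u) * (v ⬝ᵥ v) := by
  have := Finset.sum_mul_sq_le_sq_mul_sq Finset.univ u v
  simpa [dotProduct, sq] using this

lemma dot_mulVec_transpose (M : Matrix ι κ ℝ) (u : κ → ℝ) (r : ι → ℝ) :
    u ⬝ᵥ Mᵀ *ᵥ r = r ⬝ᵥ M *ᵥ u := by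
  rw [dotProduct_mulVec, vecMul_transpose, dotProduct_comm]

lemma mulVec_dot_mulVec (M : Matrix ι κ ℝ) (u v : κ → ℝ) :
    M *ᵥ u ⬝ᵥ M *ᵥ v = u ⬝ᵥ (Mᵀ * M) *ᵥ v := by
  rw [← mulVec_mulVec, dot_mulVec_transpose, dotProduct_comm]

lemma sub_dot_self (u v : ι → ℝ) :
    (u - v) ⬝ᵥ (u - v) = u ⬝ᵥ u - 2 * (u ⬝ᵥ v) + v ⬝ᵥ v := by
  simp only [sub_dotProduct, dotProduct_sub, dotProduct_comm v u]; ring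

lemma add_dot_self (u v : ι → ℝ) :
    (u + v) ⬝ᵥ (u + v) = u ⬝ᵥ u + 2 * (u ⬝ᵥ v) + v ⬝ᵥ v := by
  simp only [add_dotProduct, dotProduct_add, dotProduct_comm v u]; ring

lemma add_dot_self_le (u v : ι → ℝ) :
    (u + v) ⬝ᵥ (u + v) ≤ 2 * (u ⬝ᵥ u) + 2 * (v ⬝ᵥ v) := by
  have := dot_self_nonneg (u - v)
  rw [sub_dot_self] at this
  rw [add_dot_self]; linarith

lemma sub_dot_self_le (u v : ι → ℝ) :
    (u - v) ⬝ᵥ (u - v) ≤ 2 * (u ⬝ᵥ u) + 2 * (v ⬝ᵥ v) := by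
  have := dot_self_nonneg (u + v)
  rw [add_dot_self] at this
  rw [sub_dot_self]; linarith

end

lemma dot_mulVec_le_opNorm {ι : Type*} [Fintype ι] [DecidableEq ι] (M : Matrix ι ι ℝ)
    (v : ι → ℝ) : v ⬝ᵥ M *ᵥ v ≤ opNorm M * (v ⬝ᵥ v) := by
  set T := Matrix.toEuclideanCLM (𝕜 := ℝ) M
  set x : EuclideanSpace ℝ ι := WithLp.toLp 2 v
  have h1 : inner ℝ (T x) x = v ⬝ᵥ M *ᵥ v := by
    simp [T, x, EuclideanSpace.inner_eq_star_dotProduct]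
  have h2 : ‖x‖ * ‖x‖ = v ⬝ᵥ v := by
    rw [← real_inner_self_eq_norm_mul_norm, EuclideanSpace.inner_eq_star_dotProduct]
    simp [x]
  calc v ⬝ᵥ M *ᵥ v = inner ℝ (T x) x := h1.symm
    _ ≤ ‖T x‖ * ‖x‖ := real_inner_le_norm _ _
    _ ≤ (‖T‖ * ‖x‖) * ‖x‖ := by gcongr; exact T.le_opNorm x
    _ = opNorm M * (v ⬝ᵥ v) := by rw [mul_assoc, h2]; rfl

lemma opNorm_nonneg {ι : Type*} [Fintype ι] [DecidableEq ι] (M : Matrix ι ι ℝ) :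
    0 ≤ opNorm M := norm_nonneg _

lemma EigenvaluesGE.le_dot {ι : Type*} [Fintype ι] [DecidableEq ι] {M : Matrix ι ι ℝ} {c : ℝ}
    (h : EigenvaluesGE M c) (v : ι → ℝ) : c * (v ⬝ᵥ v) ≤ v ⬝ᵥ M *ᵥ v := by
  have h1 := h.dotProduct_mulVec_nonneg v
  simp only [sub_mulVec, smul_mulVec, one_mulVec, dotProduct_sub, dotProduct_smul, star_trivial,
    smul_eq_mul] at h1
  linarith

/-! ### Spectral moments of a Gram matrix -/

/-- In an orthonormal eigenbasis all these forms are sums over the same weights `c k ^ 2`, so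
comparing polynomials in `S` reduces to scalar inequalities in the eigenvalues. The alternative `μ k
= 0` accounts for the kernel, about which `minPosEigenvalue` says nothing. -/
lemma exists_spectral_moments {d : ℕ} {S : Matrix (Fin d) (Fin d) ℝ} (hS : S.PosSemidef)
    (w : Fin d → ℝ) : ∃ μ c : Fin d → ℝ,
      (∀ k, 0 ≤ μ k ∧ μ k ≤ opNorm S ∧ (μ k = 0 ∨ minPosEigenvalue S ≤ μ k)) ∧
      w ⬝ᵥ S *ᵥ w = ∑ k, μ k * c k ^ 2 ∧
      S *ᵥ w ⬝ᵥ S *ᵥ w = ∑ k, μ k ^ 2 * c k ^ 2 ∧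
      S *ᵥ w ⬝ᵥ S *ᵥ (S *ᵥ w) = ∑ k, μ k ^ 3 * c k ^ 2 := by
  have hH := hS.isHermitian
  set b := hH.eigenvectorBasis
  have key : ∀ (i : Fin d) (x : Fin d → ℝ),
      (b i).ofLp ⬝ᵥ S *ᵥ x = hH.eigenvalues i * ((b i).ofLp ⬝ᵥ x) := by
    intro i x
    have h1 := hH.mulVec_eigenvectorBasis i
    have hT : Sᵀ = S := by simpa using hH.eq
    have h2 := dot_mulVec_transpose S (b i).ofLp x
    rw [hT] at h2
    rw [h2, h1, dotProduct_smul, smul_eq_mul, dotProduct_comm]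
  have pars : ∀ x y : Fin d → ℝ, x ⬝ᵥ y = ∑ i, ((b i).ofLp ⬝ᵥ x) * ((b i).ofLp ⬝ᵥ y) := by
    intro x y
    have := b.sum_inner_mul_inner (WithLp.toLp 2 x) (WithLp.toLp 2 y)
    simp only [EuclideanSpace.inner_eq_star_dotProduct, star_trivial] at this
    rw [dotProduct_comm, ← this]
    refine Finset.sum_congr rfl fun i _ => ?_
    rw [dotProduct_comm y]
  have hnorm : ∀ i, (b i).ofLp ⬝ᵥ (b i).ofLp = 1 := by
    intro i
    have := real_inner_self_eq_norm_sq (b i)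
    rw [b.norm_eq_one, EuclideanSpace.inner_eq_star_dotProduct, one_pow] at this
    simpa using this
  refine ⟨hH.eigenvalues, fun i => (b i).ofLp ⬝ᵥ w, fun k => ⟨hS.eigenvalues_nonneg k, ?_, ?_⟩,
    ?_, ?_, ?_⟩
  · have := dot_mulVec_le_opNorm S (b k).ofLp
    rwa [key, hnorm, mul_one, mul_one] at this
  · rcases (hS.eigenvalues_nonneg k).eq_or_lt with h | h
    · exact Or.inl h.symm
    · refine Or.inr (csInf_le ⟨0, fun x hx => hx.1.le⟩ ⟨h, (b k).ofLp, ?_, ?_⟩)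
      · intro h0
        have := hnorm k
        simp [h0] at this
      · exact hH.mulVec_eigenvectorBasis k
  · rw [pars]; refine Finset.sum_congr rfl fun i _ => ?_
    rw [key]; ring
  · rw [pars]; refine Finset.sum_congr rfl fun i _ => ?_
    rw [key]; ring
  · rw [pars]; refine Finset.sum_congr rfl fun i _ => ?_
    rw [key (x := S *ᵥ w), key]; ring

/-! ### Ridge projections -/

section Ridge

variable {n p : ℕ} (X : Matrix (Fin n) (Fin p) ℝ) (lam : ℝ)

lemma gram_posSemidef : (gram X).PosSemidef := by
  have := (Matrix.posSemidef_conjTranspose_mul_self X).smul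
    (inv_nonneg.2 (Nat.cast_nonneg (α := ℝ) n))
  simpa [gram] using this

lemma dot_gram_mulVec (u v : Fin p → ℝ) :
    u ⬝ᵥ gram X *ᵥ v = (n : ℝ)⁻¹ * (X *ᵥ u ⬝ᵥ X *ᵥ v) := by
  rw [gram, smul_mulVec, dotProduct_smul, smul_eq_mul, mulVec_dot_mulVec]

lemma ridgeMat_transpose : (ridgeMat X lam)ᵀ = ridgeMat X lam := by
  simp [ridgeMat, transpose_add, transpose_mul, transpose_smul]

lemma Pmat_transpose : (Pmat X lam)ᵀ = Pmat X lam := by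
  simp only [Pmat, transpose_mul, transpose_transpose, transpose_nonsing_inv, ridgeMat_transpose,
    Matrix.mul_assoc]

lemma Qmat_transpose : (Qmat X lam)ᵀ = Qmat X lam := by
  simp [Qmat, transpose_sub, Pmat_transpose]

lemma dot_Qmat_comm (u v : Fin n → ℝ) : u ⬝ᵥ Qmat X lam *ᵥ v = v ⬝ᵥ Qmat X lam *ᵥ u := by
  conv_lhs => rw [← Qmat_transpose, dot_mulVec_transpose]

/-- The ridge regression coefficient of `r` on `X`. -/
noncomputable def ridgeCoef (r : Fin n → ℝ) : Fin p → ℝ := (ridgeMat X lam)⁻¹ *ᵥ (Xᵀ *ᵥ r)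

lemma Pmat_mulVec (r : Fin n → ℝ) : Pmat X lam *ᵥ r = X *ᵥ ridgeCoef X lam r := by
  simp [Pmat, ridgeCoef, mulVec_mulVec, Matrix.mul_assoc]

lemma Qmat_mulVec (r : Fin n → ℝ) : Qmat X lam *ᵥ r = r - X *ᵥ ridgeCoef X lam r := by
  rw [Qmat, sub_mulVec, one_mulVec, Pmat_mulVec]

variable {X lam}

lemma ridge_normal_eq (hR : IsUnit (ridgeMat X lam).det) (r : Fin n → ℝ) (d : Fin p → ℝ) :
    r ⬝ᵥ X *ᵥ d = X *ᵥ d ⬝ᵥ X *ᵥ ridgeCoef X lam r + n * lam * (d ⬝ᵥ ridgeCoef X lam r) := by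
  have h : ridgeMat X lam *ᵥ ridgeCoef X lam r = Xᵀ *ᵥ r := by
    rw [ridgeCoef, mulVec_mulVec, Matrix.mul_nonsing_inv _ hR, one_mulVec]
  rw [← dot_mulVec_transpose, ← h, ridgeMat, add_mulVec, dotProduct_add, smul_mulVec, one_mulVec,
    dotProduct_smul, smul_eq_mul, mulVec_dot_mulVec]

/-- Completing the square around the ridge solution. For `lam ≥ 0` the minimum over `d` is the
`Q`-form of `r`, and the excess is a quadratic form in the distance to `ridgeCoef`. -/
lemma ridge_objective_eq (hR : IsUnit (ridgeMat X lam).det) (r : Fin n → ℝ) (d : Fin p → ℝ) :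
    (r - X *ᵥ d) ⬝ᵥ (r - X *ᵥ d) + n * lam * (d ⬝ᵥ d) =
      r ⬝ᵥ Qmat X lam *ᵥ r + X *ᵥ (d - ridgeCoef X lam r) ⬝ᵥ X *ᵥ (d - ridgeCoef X lam r) +
        n * lam * ((d - ridgeCoef X lam r) ⬝ᵥ (d - ridgeCoef X lam r)) := by
  have h1 := ridge_normal_eq hR r d
  have h2 := ridge_normal_eq hR r (ridgeCoef X lam r)
  rw [Qmat_mulVec, mulVec_sub, sub_dot_self, sub_dot_self, sub_dot_self, dotProduct_sub]
  linear_combination -2 * h1 + h2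

lemma Qmat_sq_add (hR : IsUnit (ridgeMat X lam).det) (r : Fin n → ℝ) :
    Qmat X lam *ᵥ r ⬝ᵥ Qmat X lam *ᵥ r +
      n * lam * (ridgeCoef X lam r ⬝ᵥ ridgeCoef X lam r) = r ⬝ᵥ Qmat X lam *ᵥ r := by
  have := ridge_objective_eq hR r (ridgeCoef X lam r)
  rw [← Qmat_mulVec] at this
  simpa using this

/-- This is `Q² ≤ Q` as quadratic forms; the difference is the ridge penalty of the fitted
coefficient. -/
lemma Qmat_dot_self_le (hlam : 0 ≤ lam) (hR : IsUnit (ridgeMat X lam).det) (r : Fin n → ℝ) :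
    Qmat X lam *ᵥ r ⬝ᵥ Qmat X lam *ᵥ r ≤ r ⬝ᵥ Qmat X lam *ᵥ r := by
  have h1 := Qmat_sq_add hR r
  have h2 := mul_nonneg (mul_nonneg (Nat.cast_nonneg (α := ℝ) n) hlam)
    (dot_self_nonneg (ridgeCoef X lam r))
  linarith

lemma Qmat_nonneg (hlam : 0 ≤ lam) (hR : IsUnit (ridgeMat X lam).det) (r : Fin n → ℝ) :
    0 ≤ r ⬝ᵥ Qmat X lam *ᵥ r :=
  (dot_self_nonneg _).trans (Qmat_dot_self_le hlam hR r)

/-- Every `v` can be written as `v = (Σ̂ + λ) w`, and then `Q X v = λ X w`. -/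
lemma exists_Qmat_mulVec_design (hn : 0 < n) (hR : IsUnit (ridgeMat X lam).det)
    (v : Fin p → ℝ) : ∃ w : Fin p → ℝ, v = gram X *ᵥ w + lam • w ∧
      Qmat X lam *ᵥ (X *ᵥ v) = lam • (X *ᵥ w) := by
  have hn' : (n : ℝ) ≠ 0 := by positivity
  -- Since `ridgeMat X lam` is `n (Σ̂ + λ)`, this `w` is `(Σ̂ + λ)⁻¹ v`.
  set w := (n : ℝ) • ((ridgeMat X lam)⁻¹ *ᵥ v) with hw
  have hv : v = gram X *ᵥ w + lam • w := by
    have h : ridgeMat X lam *ᵥ ((ridgeMat X lam)⁻¹ *ᵥ v) = v := by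
      rw [mulVec_mulVec, Matrix.mul_nonsing_inv _ hR, one_mulVec]
    generalize (ridgeMat X lam)⁻¹ *ᵥ v = u at h hw
    rw [← h, hw, ridgeMat, gram, add_mulVec, smul_mulVec, mulVec_smul, smul_mulVec, smul_smul,
      mul_inv_cancel₀ hn', one_smul, one_mulVec, smul_smul, mul_comm lam]
  refine ⟨w, hv, ?_⟩
  have hrc : ridgeCoef X lam (X *ᵥ v) = v - lam • w := by
    have h : Xᵀ *ᵥ (X *ᵥ v) = ridgeMat X lam *ᵥ v - ((n : ℝ) * lam) • v := by
      rw [ridgeMat, add_mulVec, smul_mulVec, one_mulVec, add_sub_cancel_right, mulVec_mulVec]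
    rw [ridgeCoef, h, mulVec_sub, mulVec_mulVec, Matrix.nonsing_inv_mul _ hR, one_mulVec,
      mulVec_smul, hw, smul_smul, mul_comm lam]
  rw [Qmat_mulVec, hrc, mulVec_sub, mulVec_smul, sub_sub_cancel]

/-- Comparison of `XᵀQX` and `XᵀQ²X` with `XᵀX`. -/
lemma Qmat_design_bounds (hn : 0 < n) (hlam : 0 ≤ lam) (hR : IsUnit (ridgeMat X lam).det)
    (v : Fin p → ℝ) :
    lam * (X *ᵥ v ⬝ᵥ X *ᵥ v) ≤
        (opNorm (gram X) + lam) * (X *ᵥ v ⬝ᵥ Qmat X lam *ᵥ (X *ᵥ v)) ∧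
      (minPosEigenvalue (gram X) + lam) ^ 2 *
          (Qmat X lam *ᵥ (X *ᵥ v) ⬝ᵥ Qmat X lam *ᵥ (X *ᵥ v)) ≤
        lam ^ 2 * (X *ᵥ v ⬝ᵥ X *ᵥ v) := by
  have hn' : (0 : ℝ) < n := by positivity
  obtain ⟨w, hv, hQ⟩ := exists_Qmat_mulVec_design hn hR v
  obtain ⟨μ, c, hμ, h1, h2, h3⟩ := exists_spectral_moments (gram_posSemidef X) w
  have hL0 : 0 ≤ opNorm (gram X) := opNorm_nonneg _
  have hq0 : 0 ≤ minPosEigenvalue (gram X) := Real.sInf_nonneg fun x hx => hx.1.le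
  -- With `v = (Σ̂ + λ) w`, the normalised forms of `XᵀX`, `XᵀQX` and `XᵀQ²X` at `v` carry the
  -- spectral weights `μ(μ+λ)²`, `λμ(μ+λ)` and `λ²μ`. Both claims then hold term by term.
  have e1 : (n : ℝ)⁻¹ * (X *ᵥ v ⬝ᵥ X *ᵥ v) =
      ∑ k, (μ k ^ 3 + 2 * lam * μ k ^ 2 + lam ^ 2 * μ k) * c k ^ 2 := by
    rw [← dot_gram_mulVec, hv]
    have : w ⬝ᵥ gram X *ᵥ (gram X *ᵥ w) = gram X *ᵥ w ⬝ᵥ gram X *ᵥ w := by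
      have hT : (gram X)ᵀ = gram X := by simpa using (gram_posSemidef X).isHermitian.eq
      conv_lhs => rw [← hT, dot_mulVec_transpose, hT]
    simp only [mulVec_add, mulVec_smul, add_dotProduct, dotProduct_add, smul_dotProduct,
      dotProduct_smul, smul_eq_mul, h3, h2, h1, this]
    simp only [add_mul, Finset.sum_add_distrib, Finset.mul_sum]
    simp only [mul_assoc, ← Finset.mul_sum]
    ring
  have e2 : (n : ℝ)⁻¹ * (X *ᵥ v ⬝ᵥ Qmat X lam *ᵥ (X *ᵥ v)) =
      ∑ k, lam * (μ k ^ 2 + lam * μ k) * c k ^ 2 := by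
    rw [hQ, ← mulVec_smul, ← dot_gram_mulVec, hv]
    simp only [mulVec_smul, add_dotProduct, smul_dotProduct, dotProduct_smul, smul_eq_mul, h2, h1]
    simp only [mul_add, add_mul, Finset.sum_add_distrib, Finset.mul_sum]
    simp only [mul_assoc, ← Finset.mul_sum]
  have e3 : (n : ℝ)⁻¹ * (Qmat X lam *ᵥ (X *ᵥ v) ⬝ᵥ Qmat X lam *ᵥ (X *ᵥ v)) =
      ∑ k, lam ^ 2 * μ k * c k ^ 2 := by
    rw [hQ, ← mulVec_smul, ← dot_gram_mulVec]
    simp only [mulVec_smul, smul_dotProduct, dotProduct_smul, smul_eq_mul, h1, Finset.mul_sum]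
    exact Finset.sum_congr rfl fun k _ => by ring
  constructor
  · refine le_of_mul_le_mul_left ?_ (inv_pos.2 hn')
    rw [mul_left_comm, e1, mul_left_comm, e2, Finset.mul_sum, Finset.mul_sum]
    refine Finset.sum_le_sum fun k _ => ?_
    obtain ⟨ha, hb, -⟩ := hμ k
    have : μ k ^ 3 + 2 * lam * μ k ^ 2 + lam ^ 2 * μ k ≤
        (opNorm (gram X) + lam) * (μ k ^ 2 + lam * μ k) := by
      have : 0 ≤ (opNorm (gram X) - μ k) * (μ k ^ 2 + lam * μ k) :=
        mul_nonneg (sub_nonneg.2 hb) (by positivity)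
      nlinarith
    calc lam * ((μ k ^ 3 + 2 * lam * μ k ^ 2 + lam ^ 2 * μ k) * c k ^ 2)
        ≤ lam * (((opNorm (gram X) + lam) * (μ k ^ 2 + lam * μ k)) * c k ^ 2) := by gcongr
      _ = _ := by ring
  · refine le_of_mul_le_mul_left ?_ (inv_pos.2 hn')
    rw [mul_left_comm, e3, mul_left_comm, e1, Finset.mul_sum, Finset.mul_sum]
    refine Finset.sum_le_sum fun k _ => ?_
    obtain ⟨ha, -, hb⟩ := hμ k
    rcases hb with hb | hb
    · simp [hb]
    · calc (minPosEigenvalue (gram X) + lam) ^ 2 * (lam ^ 2 * μ k * c k ^ 2)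
          ≤ (μ k + lam) ^ 2 * (lam ^ 2 * μ k * c k ^ 2) := by gcongr
        _ = _ := by ring

lemma Mmat_apply_self (i : Fin p) :
    Mmat X lam i i = (n : ℝ)⁻¹ * (Qmat X lam *ᵥ (X *ᵥ Pi.single i 1) ⬝ᵥ
      Qmat X lam *ᵥ (X *ᵥ Pi.single i 1)) := by
  have : Mmat X lam i i = Pi.single i 1 ⬝ᵥ Mmat X lam *ᵥ Pi.single i 1 := by simp
  rw [this, Mmat, smul_mulVec, dotProduct_smul, smul_eq_mul, mulVec_mulVec, mulVec_dot_mulVec,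
    transpose_mul, Qmat_transpose]
  simp only [Matrix.mul_assoc]

lemma gram_apply_self (i : Fin p) :
    gram X i i = (n : ℝ)⁻¹ * (X *ᵥ Pi.single i 1 ⬝ᵥ X *ᵥ Pi.single i 1) := by
  rw [← dot_gram_mulVec]; simp

lemma gram_mul_inv_eq (hn : 0 < n) :
    gram X * (gram X + lam • (1 : Matrix (Fin p) (Fin p) ℝ))⁻¹ =
      (Xᵀ * X) * (ridgeMat X lam)⁻¹ := by
  have hn' : (n : ℝ) ≠ 0 := by positivity
  have : gram X + lam • (1 : Matrix (Fin p) (Fin p) ℝ) = (n : ℝ)⁻¹ • ridgeMat X lam := by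
    rw [ridgeMat, smul_add, gram, smul_smul, inv_mul_cancel_left₀ hn']
  by_cases hR : IsUnit (ridgeMat X lam).det
  · rw [this]
    have hinv : ((n : ℝ)⁻¹ • ridgeMat X lam)⁻¹ = (n : ℝ) • (ridgeMat X lam)⁻¹ := by
      refine Matrix.inv_eq_left_inv ?_
      rw [Matrix.smul_mul, Matrix.mul_smul, smul_smul, mul_inv_cancel₀ hn', one_smul,
        Matrix.nonsing_inv_mul _ hR]
    rw [hinv, gram, Matrix.smul_mul, Matrix.mul_smul, smul_smul, inv_mul_cancel₀ hn', one_smul]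
  -- A singular matrix has inverse `0` by convention, so in this case both sides vanish.
  · have h2 : ¬ IsUnit ((n : ℝ)⁻¹ • ridgeMat X lam).det := by
      rw [det_smul, IsUnit.mul_iff]; exact fun h => hR h.2
    rw [this, Matrix.nonsing_inv_apply_not_isUnit _ hR, Matrix.nonsing_inv_apply_not_isUnit _ h2]
    simp

/-- Identifies the bias caused by the dense component `A B_j` in the profiled regression with Rem₂,
so that the assumed rate bounds it directly. -/
lemma dot_Qmat_design_eq_rem2 {m K : ℕ} (P : Model p m K) (hn : 0 < n)
    (hR : IsUnit (ridgeMat X lam).det) (j : Fin m) :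
    (n : ℝ)⁻¹ * (X *ᵥ P.delta j ⬝ᵥ Qmat X lam *ᵥ (X *ᵥ P.delta j)) = rem2 P X lam j := by
  set v := P.delta j
  have hn' : (n : ℝ) ≠ 0 := by positivity
  have hq : Qmat X lam *ᵥ (X *ᵥ v) = ((n : ℝ) * lam) • (X *ᵥ ((ridgeMat X lam)⁻¹ *ᵥ v)) := by
    have h : Xᵀ *ᵥ (X *ᵥ v) = ridgeMat X lam *ᵥ v - ((n : ℝ) * lam) • v := by
      rw [ridgeMat, add_mulVec, smul_mulVec, one_mulVec, add_sub_cancel_right, mulVec_mulVec]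
    rw [Qmat_mulVec, ridgeCoef, h, mulVec_sub, mulVec_mulVec, Matrix.nonsing_inv_mul _ hR,
      one_mulVec, mulVec_smul, mulVec_sub, mulVec_smul, sub_sub_cancel]
  rw [rem2, gram_mul_inv_eq hn, hq, dotProduct_smul, smul_eq_mul, mulVec_dot_mulVec,
    mulVec_mulVec, ← mul_assoc, inv_mul_cancel_left₀ hn']

end Ridge

end HiddenVar

namespace HiddenVar

open Matrix

/-! ### The lava estimator -/

section Lava

variable {n p : ℕ} {X : Matrix (Fin n) (Fin p) ℝ} {lam : ℝ}

/-- Isolates the dependence on `d` in a square. What is left after minimising over `d` is a lasso in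
`θ` whose loss is weighted by `Q`. -/
lemma lavaObjective_eq (hn : 0 < n) (hR : IsUnit (ridgeMat X lam).det) (y : Fin n → ℝ) (l1 : ℝ)
    (θ d : Fin p → ℝ) :
    lavaObjective X y l1 lam θ d =
      (n : ℝ)⁻¹ * ((y - X *ᵥ θ) ⬝ᵥ Qmat X lam *ᵥ (y - X *ᵥ θ)) + l1 * l1norm θ +
        ((n : ℝ)⁻¹ * (X *ᵥ (d - ridgeCoef X lam (y - X *ᵥ θ)) ⬝ᵥ
            X *ᵥ (d - ridgeCoef X lam (y - X *ᵥ θ))) +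
          lam * ((d - ridgeCoef X lam (y - X *ᵥ θ)) ⬝ᵥ
            (d - ridgeCoef X lam (y - X *ᵥ θ)))) := by
  have hn' : (n : ℝ) ≠ 0 := by positivity
  have h := ridge_objective_eq hR (y - X *ᵥ θ) d
  rw [lavaObjective, l2norm_sq, l2norm_sq, mulVec_add, ← sub_sub]
  have h' := congrArg (fun t => (n : ℝ)⁻¹ * t) h
  simp only [mul_add, mul_assoc, inv_mul_cancel_left₀ hn'] at h'
  linear_combination h'

/-- Competing against `θ'` paired with its own ridge fit removes the square on the right. The choice
`θ' = θ` forces the square of the solution to vanish; a general `θ'` gives optimality in the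
profiled lasso. Only the fitted vector `X *ᵥ d` is needed later. -/
lemma IsLavaSolution.profile (hn : 0 < n) (hlam : 0 ≤ lam) (hR : IsUnit (ridgeMat X lam).det)
    {y : Fin n → ℝ} {l1 : ℝ} {θ d : Fin p → ℝ} (h : IsLavaSolution X y l1 lam θ d) :
    X *ᵥ d = Pmat X lam *ᵥ (y - X *ᵥ θ) ∧
      ∀ θ' : Fin p → ℝ,
        (n : ℝ)⁻¹ * ((y - X *ᵥ θ) ⬝ᵥ Qmat X lam *ᵥ (y - X *ᵥ θ)) + l1 * l1norm θ ≤
        (n : ℝ)⁻¹ * ((y - X *ᵥ θ') ⬝ᵥ Qmat X lam *ᵥ (y - X *ᵥ θ')) + l1 * l1norm θ' := by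
  have hn' : (0 : ℝ) < n := by positivity
  set u := d - ridgeCoef X lam (y - X *ᵥ θ) with hu
  have hX : 0 ≤ X *ᵥ u ⬝ᵥ X *ᵥ u := dot_self_nonneg _
  have hX' : 0 ≤ (n : ℝ)⁻¹ * (X *ᵥ u ⬝ᵥ X *ᵥ u) := by positivity
  have hU : 0 ≤ lam * (u ⬝ᵥ u) := mul_nonneg hlam (dot_self_nonneg _)
  have key : ∀ θ' : Fin p → ℝ,
      (n : ℝ)⁻¹ * ((y - X *ᵥ θ) ⬝ᵥ Qmat X lam *ᵥ (y - X *ᵥ θ)) + l1 * l1norm θ +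
        ((n : ℝ)⁻¹ * (X *ᵥ u ⬝ᵥ X *ᵥ u) + lam * (u ⬝ᵥ u)) ≤
      (n : ℝ)⁻¹ * ((y - X *ᵥ θ') ⬝ᵥ Qmat X lam *ᵥ (y - X *ᵥ θ')) + l1 * l1norm θ' := by
    intro θ'
    have := h θ' (ridgeCoef X lam (y - X *ᵥ θ'))
    rw [lavaObjective_eq hn hR, lavaObjective_eq hn hR, ← hu] at this
    simpa using this
  constructor
  · have h0 : (n : ℝ)⁻¹ * (X *ᵥ u ⬝ᵥ X *ᵥ u) = 0 := by have := key θ; linarith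
    have h1 : X *ᵥ u ⬝ᵥ X *ᵥ u = 0 := by
      rcases mul_eq_zero.1 h0 with h | h
      · exact absurd h (inv_ne_zero hn'.ne')
      · exact h
    have h2 : X *ᵥ u = 0 := dotProduct_self_eq_zero.1 h1
    rw [hu, mulVec_sub, sub_eq_zero] at h2
    rw [h2, Pmat_mulVec]
  · intro θ'; have := key θ'; linarith

lemma abs_dot_le_l1norm {d : ℕ} (u z : Fin d → ℝ) (b : ℝ) (hz : ∀ i, |z i| ≤ b) :
    |u ⬝ᵥ z| ≤ b * l1norm u := by
  rw [dotProduct, l1norm, Finset.mul_sum]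
  refine (Finset.abs_sum_le_sum_abs _ _).trans (Finset.sum_le_sum fun i _ => ?_)
  rw [abs_mul, mul_comm]
  exact mul_le_mul_of_nonneg_right (hz i) (abs_nonneg _)

lemma l1norm_sub_le_of_support {d : ℕ} (θ θ' : Fin d → ℝ) (S : Finset (Fin d))
    (hS : ∀ i ∉ S, θ i = 0) :
    l1norm θ - l1norm θ' ≤ ∑ i ∈ S, |(θ' - θ) i| - ∑ i ∈ Sᶜ, |(θ' - θ) i| := by
  rw [l1norm, l1norm, ← Finset.sum_add_sum_compl S, ← Finset.sum_add_sum_compl S (fun i => |θ' i|)]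
  have h1 : ∑ i ∈ Sᶜ, |θ i| = 0 :=
    Finset.sum_eq_zero fun i hi => by rw [hS i (Finset.mem_compl.1 hi), abs_zero]
  have h2 : ∑ i ∈ Sᶜ, |θ' i| = ∑ i ∈ Sᶜ, |(θ' - θ) i| :=
    Finset.sum_congr rfl fun i hi => by rw [Pi.sub_apply, hS i (Finset.mem_compl.1 hi), sub_zero]
  have h3 : ∑ i ∈ S, |θ i| ≤ ∑ i ∈ S, |θ' i| + ∑ i ∈ S, |(θ' - θ) i| := by
    rw [← Finset.sum_add_distrib]
    refine Finset.sum_le_sum fun i _ => ?_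
    rw [Pi.sub_apply, abs_sub_comm]
    have := abs_sub_abs_le_abs_sub (θ i) (θ' i)
    linarith
  linarith

lemma kappa_sq_mul_le (hn : 0 < n) {s : ℕ} {α : ℝ} (S : Finset (Fin p)) (hS : S.card ≤ s)
    (v : Fin p → ℝ) (hv : ∑ i ∈ Sᶜ, |v i| ≤ α * ∑ i ∈ S, |v i|) :
    kappa X s α ^ 2 * (n * ∑ i ∈ S, v i ^ 2) ≤ X *ᵥ v ⬝ᵥ X *ᵥ v := by
  have hn' : (0 : ℝ) < n := by positivity
  have hS0 : 0 ≤ ∑ i ∈ S, v i ^ 2 := Finset.sum_nonneg fun i _ => sq_nonneg _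
  -- If `v` vanishes on `S` the bound is trivial; separating this case keeps the denominator in
  -- `kappa` positive.
  rcases hS0.eq_or_lt with h0 | h0
  · rw [← h0, mul_zero, mul_zero]; exact dot_self_nonneg _
  have hv0 : v ≠ 0 := by
    rintro rfl
    simp at h0
  have hbdd : BddBelow {r : ℝ | ∃ (S : Finset (Fin p)) (v : Fin p → ℝ), S.card ≤ s ∧ v ≠ 0 ∧
      ∑ i ∈ Sᶜ, |v i| ≤ α * ∑ i ∈ S, |v i| ∧
      r = l2norm (X.mulVec v) / (Real.sqrt n * Real.sqrt (∑ i ∈ S, v i ^ 2))} := by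
    refine ⟨0, ?_⟩
    rintro _ ⟨S, v, -, -, -, rfl⟩
    exact div_nonneg (l2norm_nonneg _) (by positivity)
  have hk0 : 0 ≤ kappa X s α := by
    refine Real.sInf_nonneg ?_
    rintro _ ⟨S, v, -, -, -, rfl⟩
    exact div_nonneg (l2norm_nonneg _) (by positivity)
  have hk : kappa X s α ≤ l2norm (X *ᵥ v) / (Real.sqrt n * Real.sqrt (∑ i ∈ S, v i ^ 2)) :=
    csInf_le hbdd ⟨S, v, hS, hv0, hv, rfl⟩
  rw [le_div_iff₀ (by positivity)] at hk
  have := pow_le_pow_left₀ (by positivity) hk 2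
  rwa [mul_pow, mul_pow, Real.sq_sqrt hn'.le, Real.sq_sqrt hS0, l2norm_sq] at this

/-- Compares the profiled objective at `θ'` and `θ`. Noise at level `l1 / 4` costs `l1 / 2` times
the `ℓ₁` error, which turns the weights `1` and `-1` on `S` and its complement into `3/2` and
`-1/2`. The bias cross term uses up half of the quadratic loss. -/
lemma lasso_basic_inequality (hn : 0 < n) (hlam : 0 ≤ lam) (hR : IsUnit (ridgeMat X lam).det)
    {l1 : ℝ} (θ δ θ' d' : Fin p → ℝ) (e : Fin n → ℝ)
    (S : Finset (Fin p)) (hS : ∀ i ∉ S, θ i = 0)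
    (hnoise : ∀ i, |(Xᵀ *ᵥ (Qmat X lam *ᵥ e)) i| ≤ n * (l1 / 4))
    (h : IsLavaSolution X (X *ᵥ θ + X *ᵥ δ + e) l1 lam θ' d') :
    (n : ℝ)⁻¹ * (X *ᵥ (θ' - θ) ⬝ᵥ Qmat X lam *ᵥ (X *ᵥ (θ' - θ))) / 2 ≤
      2 * ((n : ℝ)⁻¹ * (X *ᵥ δ ⬝ᵥ Qmat X lam *ᵥ (X *ᵥ δ))) +
        l1 * (3 / 2 * ∑ i ∈ S, |(θ' - θ) i| - 1 / 2 * ∑ i ∈ Sᶜ, |(θ' - θ) i|) := by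
  have hn' : (0 : ℝ) < n := by positivity
  set Δ := θ' - θ with hΔ
  have hb := (h.profile hn hlam hR).2 θ
  have e1 : X *ᵥ θ + X *ᵥ δ + e - X *ᵥ θ = X *ᵥ δ + e := by abel
  have e2 : X *ᵥ θ + X *ᵥ δ + e - X *ᵥ θ' = (X *ᵥ δ + e) - X *ᵥ Δ := by
    rw [hΔ, mulVec_sub]; abel
  rw [e1, e2] at hb
  set u := X *ᵥ δ
  set w := X *ᵥ Δ
  have e3 : (u + e - w) ⬝ᵥ Qmat X lam *ᵥ (u + e - w) =
      (u + e) ⬝ᵥ Qmat X lam *ᵥ (u + e) - 2 * (w ⬝ᵥ Qmat X lam *ᵥ u)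
        - 2 * (w ⬝ᵥ Qmat X lam *ᵥ e) + w ⬝ᵥ Qmat X lam *ᵥ w := by
    have c1 := dot_Qmat_comm X lam (u + e) w
    have c2 : w ⬝ᵥ Qmat X lam *ᵥ (u + e) = w ⬝ᵥ Qmat X lam *ᵥ u + w ⬝ᵥ Qmat X lam *ᵥ e := by
      rw [mulVec_add, dotProduct_add]
    rw [mulVec_sub, sub_dotProduct, dotProduct_sub, dotProduct_sub, c1, c2]
    ring
  -- Nonnegativity of the `Q`-form at `w - 2u`.
  have hcs : 2 * (w ⬝ᵥ Qmat X lam *ᵥ u) ≤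
      w ⬝ᵥ Qmat X lam *ᵥ w / 2 + 2 * (u ⬝ᵥ Qmat X lam *ᵥ u) := by
    have := Qmat_nonneg hlam hR (w - (2 : ℝ) • u)
    have c1 := dot_Qmat_comm X lam u w
    rw [mulVec_sub, sub_dotProduct, dotProduct_sub, dotProduct_sub, mulVec_smul,
      smul_dotProduct, smul_dotProduct, dotProduct_smul, dotProduct_smul, c1] at this
    simp only [smul_eq_mul] at this
    linarith
  have hne : 2 * (w ⬝ᵥ Qmat X lam *ᵥ e) ≤ n * (l1 / 2 * l1norm Δ) := by
    have := (le_abs_self _).trans (abs_dot_le_l1norm Δ _ _ hnoise)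
    rw [dot_mulVec_transpose, dotProduct_comm] at this
    linarith
  have hl : l1norm Δ = ∑ i ∈ S, |Δ i| + ∑ i ∈ Sᶜ, |Δ i| := by
    rw [l1norm, Finset.sum_add_sum_compl]
  have hl1 : l1norm θ - l1norm θ' ≤ ∑ i ∈ S, |Δ i| - ∑ i ∈ Sᶜ, |Δ i| :=
    l1norm_sub_le_of_support θ θ' S hS
  -- The noise bound at any coordinate shows `l1 ≥ 0`; without coordinates all `ℓ₁` terms vanish.
  have hl10 : p = 0 ∨ 0 ≤ l1 := by
    rcases Nat.eq_zero_or_pos p with hp | hp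
    · exact Or.inl hp
    · right
      have := (abs_nonneg _).trans (hnoise ⟨0, hp⟩)
      have := nonneg_of_mul_nonneg_right this hn'
      linarith
  have hl2 : l1 * (l1norm θ - l1norm θ') ≤ l1 * (∑ i ∈ S, |Δ i| - ∑ i ∈ Sᶜ, |Δ i|) := by
    rcases hl10 with rfl | h0
    · simp [l1norm, Finset.eq_empty_of_isEmpty]
    · exact mul_le_mul_of_nonneg_left hl1 h0
  have hfin : (n : ℝ)⁻¹ * (w ⬝ᵥ Qmat X lam *ᵥ w) ≤
      (n : ℝ)⁻¹ * (2 * (w ⬝ᵥ Qmat X lam *ᵥ u) + 2 * (w ⬝ᵥ Qmat X lam *ᵥ e)) +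
        l1 * (l1norm θ - l1norm θ') := by
    rw [e3] at hb
    linarith
  have h4 : (n : ℝ)⁻¹ * (2 * (w ⬝ᵥ Qmat X lam *ᵥ u) + 2 * (w ⬝ᵥ Qmat X lam *ᵥ e)) ≤
      (n : ℝ)⁻¹ * (w ⬝ᵥ Qmat X lam *ᵥ w / 2 + 2 * (u ⬝ᵥ Qmat X lam *ᵥ u) +
        n * (l1 / 2 * l1norm Δ)) := by gcongr
  rw [mul_add, mul_add, inv_mul_cancel_left₀ hn'.ne', hl] at h4
  linarith

/-- The fit `X d' = P(y - X θ')` turns the prediction error into `P e - Q X δ + Q X (θ' - θ)`: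
projected noise, ridge bias and sparse error. Then `Q² ≤ Q` replaces the last two squares by
`Q`-forms. -/
lemma lava_error_decomposition (hn : 0 < n) (hlam : 0 ≤ lam) (hR : IsUnit (ridgeMat X lam).det)
    {l1 : ℝ} (θ δ θ' d' : Fin p → ℝ) (e : Fin n → ℝ)
    (h : IsLavaSolution X (X *ᵥ θ + X *ᵥ δ + e) l1 lam θ' d') :
    (X *ᵥ (θ' + d') - X *ᵥ (θ + δ)) ⬝ᵥ (X *ᵥ (θ' + d') - X *ᵥ (θ + δ)) ≤
      3 * (Pmat X lam *ᵥ e ⬝ᵥ Pmat X lam *ᵥ e + X *ᵥ δ ⬝ᵥ Qmat X lam *ᵥ (X *ᵥ δ) +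
        X *ᵥ (θ' - θ) ⬝ᵥ Qmat X lam *ᵥ (X *ᵥ (θ' - θ))) := by
  have h1 := (h.profile hn hlam hR).1
  have hQ : ∀ v, Qmat X lam *ᵥ v = v - Pmat X lam *ᵥ v := fun v => by
    rw [Qmat, sub_mulVec, one_mulVec]
  have h2 : X *ᵥ (θ' + d') - X *ᵥ (θ + δ) = Pmat X lam *ᵥ e - Qmat X lam *ᵥ (X *ᵥ δ) +
      Qmat X lam *ᵥ (X *ᵥ (θ' - θ)) := by
    rw [mulVec_add, h1, hQ, hQ]
    simp only [mulVec_add, mulVec_sub]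
    abel
  have g1 := Qmat_dot_self_le hlam hR (X *ᵥ δ)
  have g2 := Qmat_dot_self_le hlam hR (X *ᵥ (θ' - θ))
  rw [h2]
  generalize Pmat X lam *ᵥ e = a, Qmat X lam *ᵥ (X *ᵥ δ) = b,
    Qmat X lam *ᵥ (X *ᵥ (θ' - θ)) = c at *
  -- These three squares add up to `3(‖a‖² + ‖b‖² + ‖c‖²) - ‖a - b + c‖²`.
  have k1 := dot_self_nonneg (a + b)
  have k2 := dot_self_nonneg (a - c)
  have k3 := dot_self_nonneg (b + c)
  rw [add_dot_self] at k1 k3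
  rw [sub_dot_self] at k2
  rw [add_dot_self, sub_dot_self, sub_dotProduct]
  linarith

/-- Prediction error of one lava regression. -/
lemma lava_prediction_error {m K : ℕ} (P : Model p m K) {γw γe : ℝ} {s : ℕ} (hn : 0 < n)
    (hlam : 0 ≤ lam) (hR : IsUnit (ridgeMat X lam).det) (j : Fin m) (e : Fin n → ℝ)
    (hs : l0norm (fun i => P.Θ i j) ≤ s) {r : ℝ} (hr : 0 ≤ r)
    (hrem : remTotal P γw γe s X lam j ≤ ENNReal.ofReal r)
    (hnoise : ∀ i, |(Xᵀ *ᵥ (Qmat X lam *ᵥ e)) i| ≤ n * (lambdaOne P γw γe X lam j / 4))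
    {θ' d' : Fin p → ℝ}
    (h : IsLavaSolution X (X *ᵥ (fun i => P.Θ i j) + X *ᵥ P.delta j + e)
      (lambdaOne P γw γe X lam j) lam θ' d') :
    (n : ℝ)⁻¹ * ((X *ᵥ (θ' + d') - X *ᵥ ((fun i => P.Θ i j) + P.delta j)) ⬝ᵥ
        (X *ᵥ (θ' + d') - X *ᵥ ((fun i => P.Θ i j) + P.delta j))) ≤
      3 * ((n : ℝ)⁻¹ * (Pmat X lam *ᵥ e ⬝ᵥ Pmat X lam *ᵥ e) + 873 * r) := by
  classical
  have hn' : (0 : ℝ) < n := by positivity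
  set θ : Fin p → ℝ := fun i => P.Θ i j
  have hrem2 : rem2 P X lam j ≤ r := by
    rw [← ENNReal.ofReal_le_ofReal_iff hr]
    refine le_trans ?_ hrem
    rw [remTotal]
    exact le_trans le_add_self le_self_add
  have hrem3 : rem3 P γw γe s X lam j ≤ ENNReal.ofReal r := le_trans le_add_self hrem
  have hρ := dot_Qmat_design_eq_rem2 P hn hR j
  have hdec := lava_error_decomposition hn hlam hR θ (P.delta j) θ' d' e h
  set Δ := θ' - θ with hΔ
  set a2 := (n : ℝ)⁻¹ * (X *ᵥ Δ ⬝ᵥ Qmat X lam *ᵥ (X *ᵥ Δ)) with ha2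
  -- The constant `873` is `1 + 872`: one `r` for the ridge bias, `872 r` for the sparse part.
  suffices hmain : a2 ≤ 872 * r by
    have := mul_le_mul_of_nonneg_left hdec (inv_nonneg.2 hn'.le)
    rw [mul_left_comm, mul_add (n : ℝ)⁻¹, mul_add (n : ℝ)⁻¹, hρ] at this
    linarith
  have ha20 : 0 ≤ a2 := mul_nonneg (inv_nonneg.2 hn'.le) (Qmat_nonneg hlam hR _)
  -- For `λ = 0` the matrix `Q` annihilates the column space of `X`, so the sparse part is zero.
  -- Below, `λ > 0` makes `Lq + lam` and `L1 + lam` positive.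
  rcases hlam.eq_or_lt with hl0 | hlpos
  · obtain ⟨w, -, hw⟩ := exists_Qmat_mulVec_design hn hR Δ
    rw [ha2, hw, ← hl0, zero_smul, dotProduct_zero, mul_zero]
    positivity
  set S : Finset (Fin p) := Finset.univ.filter fun i => θ i ≠ 0 with hSdef
  have hScard : S.card = l0norm θ := by
    rw [l0norm, hSdef, ← Set.ncard_coe_finset]; congr 1; ext i; simp
  have hS : ∀ i ∉ S, θ i = 0 := fun i hi => by simpa [hSdef] using hi
  have hbasic := lasso_basic_inequality hn hlam hR θ (P.delta j) θ' d' e S hS hnoise h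
  rw [hρ, ← hΔ, ← ha2] at hbasic
  set l1 := lambdaOne P γw γe X lam j with hl1
  have hl10 : 0 ≤ l1 := by rw [hl1, lambdaOne, Model.sigma]; positivity
  set DS := ∑ i ∈ S, |Δ i|
  set DC := ∑ i ∈ Sᶜ, |Δ i|
  have hDS0 : 0 ≤ DS := Finset.sum_nonneg fun i _ => abs_nonneg _
  have hDC0 : 0 ≤ DC := Finset.sum_nonneg fun i _ => abs_nonneg _
  by_cases hcone : DC ≤ 4 * DS
  swap
  -- Outside the cone the `ℓ₁` contribution is nonpositive, and the bias alone bounds the error.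
  · have : l1 * (3 / 2 * DS - 1 / 2 * DC) ≤ 0 :=
      mul_nonpos_of_nonneg_of_nonpos hl10 (by linarith)
    linarith
  have hkap := kappa_sq_mul_le (X := X) hn (s := s) S (hScard ▸ hs) Δ hcone
  set b2 := ∑ i ∈ S, Δ i ^ 2 with hb2
  have hb20 : 0 ≤ b2 := Finset.sum_nonneg fun i _ => sq_nonneg _
  have hDSb : DS ^ 2 ≤ l0norm θ * b2 := by
    rw [← hScard]
    have := sq_sum_le_card_mul_sum_sq (s := S) (f := fun i => |Δ i|)
    simpa [sq_abs] using this
  set L1 := opNorm (gram X)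
  set Lq := minPosEigenvalue (gram X)
  have hL10 : 0 ≤ L1 := opNorm_nonneg _
  have hLq0 : 0 ≤ Lq := Real.sInf_nonneg fun x hx => hx.1.le
  set G := ⨆ i, gram X i i
  set lg := Real.log (max p m : ℕ)
  have hlg0 : 0 ≤ lg := Real.log_natCast_nonneg _
  set num := lam * (L1 + lam) / (Lq + lam) ^ 2 * G * (l0norm θ * lg) *
    (P.sigma γw γe j ^ 2 / n) with hnum
  have hnumle : num ≤ r * kappa X s 4 ^ 2 := by
    rw [rem3, ENNReal.div_le_iff_le_mul (Or.inr ENNReal.ofReal_ne_top)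
      (Or.inl ENNReal.ofReal_ne_top), ← ENNReal.ofReal_mul hr,
      ENNReal.ofReal_le_ofReal_iff (by positivity)] at hrem3
    exact hrem3
  have hG0 : 0 ≤ G := Real.iSup_nonneg fun i => by
    rw [gram_apply_self]; exact mul_nonneg (inv_nonneg.2 hn'.le) (dot_self_nonneg _)
  have hM : (⨆ i, Mmat X lam i i) ≤ lam ^ 2 / (Lq + lam) ^ 2 * G := by
    refine Real.iSup_le (fun i => ?_) (by positivity)
    rw [div_mul_eq_mul_div, le_div_iff₀ (by positivity)]
    have hGi : gram X i i ≤ G := le_ciSup (f := fun i => gram X i i) (Set.finite_range _).bddAbove i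
    have := (Qmat_design_bounds hn hlam hR (Pi.single i 1)).2
    calc Mmat X lam i i * (Lq + lam) ^ 2
        = (n : ℝ)⁻¹ * ((Lq + lam) ^ 2 * (Qmat X lam *ᵥ (X *ᵥ Pi.single i 1) ⬝ᵥ
            Qmat X lam *ᵥ (X *ᵥ Pi.single i 1))) := by rw [Mmat_apply_self]; ring
      _ ≤ (n : ℝ)⁻¹ * (lam ^ 2 * (X *ᵥ Pi.single i 1 ⬝ᵥ X *ᵥ Pi.single i 1)) := by gcongr
      _ = lam ^ 2 * gram X i i := by rw [gram_apply_self]; ring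
      _ ≤ lam ^ 2 * G := by gcongr
  have hM0 : 0 ≤ ⨆ i, Mmat X lam i i := Real.iSup_nonneg fun i => by
    rw [Mmat_apply_self]; exact mul_nonneg (inv_nonneg.2 hn'.le) (dot_self_nonneg _)
  -- Here `96 = 4² · 6` comes from the definition of the lasso penalty, and `num` is the numerator
  -- of Rem₃.
  have hl1sq : l1 ^ 2 * l0norm θ * (L1 + lam) ≤ 96 * lam * num := by
    have e1 : l1 ^ 2 = 96 * P.sigma γw γe j ^ 2 * (⨆ i, Mmat X lam i i) * (lg / n) := by
      rw [hl1, lambdaOne, mul_pow, mul_pow, mul_pow, Real.sq_sqrt (by positivity),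
        Real.sq_sqrt (by positivity)]
      ring
    calc l1 ^ 2 * l0norm θ * (L1 + lam)
        = 96 * P.sigma γw γe j ^ 2 * (⨆ i, Mmat X lam i i) * (lg / n) * l0norm θ * (L1 + lam) := by
          rw [e1]
      _ ≤ 96 * P.sigma γw γe j ^ 2 * (lam ^ 2 / (Lq + lam) ^ 2 * G) * (lg / n) * l0norm θ *
            (L1 + lam) := by gcongr
      _ = 96 * lam * num := by rw [hnum]; ring
  -- The restricted eigenvalue bounds `‖X Δ‖` from below, and the spectral comparison passes from
  -- `XᵀX` to `XᵀQX`. The left side is exactly the product left over when `num ≤ r κ²` is inserted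
  -- into `hl1sq`.
  have hX : lam * (kappa X s 4 ^ 2 * b2) ≤ (L1 + lam) * a2 := by
    have h1 := (Qmat_design_bounds hn hlam hR Δ).1
    calc lam * (kappa X s 4 ^ 2 * b2)
        = (n : ℝ)⁻¹ * (lam * (kappa X s 4 ^ 2 * (n * b2))) := by field_simp
      _ ≤ (n : ℝ)⁻¹ * (lam * (X *ᵥ Δ ⬝ᵥ X *ᵥ Δ)) := by gcongr
      _ ≤ (n : ℝ)⁻¹ * ((L1 + lam) * (X *ᵥ Δ ⬝ᵥ Qmat X lam *ᵥ (X *ᵥ Δ))) := by gcongr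
      _ = (L1 + lam) * a2 := by rw [ha2]; ring
  have ht : (l1 * DS) ^ 2 ≤ 96 * r * a2 := by
    refine le_of_mul_le_mul_right ?_ (by positivity : 0 < L1 + lam)
    calc (l1 * DS) ^ 2 * (L1 + lam) = l1 ^ 2 * (L1 + lam) * DS ^ 2 := by ring
      _ ≤ l1 ^ 2 * (L1 + lam) * (l0norm θ * b2) := by gcongr
      _ = l1 ^ 2 * l0norm θ * (L1 + lam) * b2 := by ring
      _ ≤ 96 * lam * num * b2 := by gcongr
      _ ≤ 96 * lam * (r * kappa X s 4 ^ 2) * b2 := by gcongr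
      _ = 96 * r * (lam * (kappa X s 4 ^ 2 * b2)) := by ring
      _ ≤ 96 * r * ((L1 + lam) * a2) := by gcongr
      _ = 96 * r * a2 * (L1 + lam) := by ring
  -- By the arithmetic-geometric mean inequality, as `(3/2)² · 96 = 216`. With the basic inequality,
  -- `a2 / 2 ≤ 2 r + a2 / 4 + 216 r`, that is, `a2 ≤ 872 r`.
  have ht2 : 3 / 2 * (l1 * DS) ≤ a2 / 4 + 216 * r := by
    refine le_of_pow_le_pow_left₀ two_ne_zero (by positivity) ?_
    have := sq_nonneg (a2 / 4 - 216 * r)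
    nlinarith
  have : 0 ≤ l1 * DC := mul_nonneg hl10 hDC0
  linarith

end Lava

end HiddenVar

namespace HiddenVar

open Matrix

/-! ### Principal components of a perturbed low-rank matrix -/

lemma exists_mulVec_eq_of_injective {k : ℕ} {M : Matrix (Fin k) (Fin k) ℝ}
    (h : ∀ y, M *ᵥ y = 0 → y = 0) (x : Fin k → ℝ) : ∃ y, M *ᵥ y = x := by
  have hinj : Function.Injective M.mulVecLin := by
    rw [← LinearMap.ker_eq_bot, LinearMap.ker_eq_bot']
    exact fun y hy => h y (by simpa using hy)
  exact LinearMap.injective_iff_surjective.1 hinj x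

section Projection

variable {ι κ : Type*} [Fintype ι] [Fintype κ]

lemma dot_proj (U : Matrix ι κ ℝ) (u v : ι → ℝ) :
    u ⬝ᵥ U *ᵥ (Uᵀ *ᵥ v) = Uᵀ *ᵥ u ⬝ᵥ Uᵀ *ᵥ v := by
  rw [← dot_mulVec_transpose, dotProduct_comm]

variable [DecidableEq κ] {U : Matrix ι κ ℝ}

lemma isometry_dot (hU : Uᵀ * U = 1) (x y : κ → ℝ) : U *ᵥ x ⬝ᵥ U *ᵥ y = x ⬝ᵥ y := by
  rw [mulVec_dot_mulVec, hU, one_mulVec]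

lemma sub_proj_dot_self (hU : Uᵀ * U = 1) (v : ι → ℝ) :
    (v - U *ᵥ (Uᵀ *ᵥ v)) ⬝ᵥ (v - U *ᵥ (Uᵀ *ᵥ v)) = v ⬝ᵥ v - Uᵀ *ᵥ v ⬝ᵥ Uᵀ *ᵥ v := by
  rw [sub_dot_self, isometry_dot hU, dot_proj]; ring

lemma sub_proj_dot_self_le (hU : Uᵀ * U = 1) (v : ι → ℝ) :
    (v - U *ᵥ (Uᵀ *ᵥ v)) ⬝ᵥ (v - U *ᵥ (Uᵀ *ᵥ v)) ≤ v ⬝ᵥ v := by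
  rw [sub_proj_dot_self hU]
  have := dot_self_nonneg (Uᵀ *ᵥ v)
  linarith

lemma transpose_mulVec_dot_self_le (hU : Uᵀ * U = 1) (v : ι → ℝ) :
    Uᵀ *ᵥ v ⬝ᵥ Uᵀ *ᵥ v ≤ v ⬝ᵥ v := by
  have h := dot_self_nonneg (v - U *ᵥ (Uᵀ *ᵥ v))
  rw [sub_proj_dot_self hU] at h
  linarith

end Projection

section SVD

variable {n m K : ℕ}

lemma sum_castLE_add {q K : ℕ} (h : K ≤ q) (f : Fin q → ℝ) :
    ∑ l, f l = ∑ i, f (Fin.castLE h i) + ∑ l ∈ Finset.univ.filter (fun l : Fin q => K ≤ l.val), f l := by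
  have h1 : ∑ i, f (Fin.castLE h i) = ∑ l ∈ Finset.univ.filter (fun l : Fin q => ¬ K ≤ l.val), f l := by
    refine (Finset.sum_map Finset.univ (Fin.castLEEmb h) f).symm.trans ?_
    refine Finset.sum_congr ?_ fun _ _ => rfl
    ext l
    simp only [Finset.mem_map, Finset.mem_univ, true_and, Finset.mem_filter, not_le]
    constructor
    · rintro ⟨i, rfl⟩; exact i.2
    · intro hl; exact ⟨⟨l, hl⟩, rfl⟩
  rw [h1, add_comm, Finset.sum_filter_add_sum_filter_not]

variable {M : Matrix (Fin n) (Fin m) ℝ} {U : Matrix (Fin n) (Fin (min n m)) ℝ}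
  {d : Fin (min n m) → ℝ} {V : Matrix (Fin m) (Fin (min n m)) ℝ}

lemma IsSVD.mulVec_eq (hS : IsSVD M U d V) (v : Fin m → ℝ) :
    M *ᵥ v = U *ᵥ fun l => d l * (Vᵀ *ᵥ v) l := by
  conv_lhs => rw [hS.eq]
  rw [← mulVec_mulVec, ← mulVec_mulVec]
  congr 1
  ext l
  rw [mulVec_diagonal]

/-- A Weyl-type inequality: the singular values of `W B + N` after the `K`-th are bounded by the
operator norm of `N`. -/
lemma IsSVD.singularValue_sq_le (hS : IsSVD M U d V) {W : Matrix (Fin n) (Fin K) ℝ}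
    {B : Matrix (Fin K) (Fin m) ℝ} {N : Matrix (Fin n) (Fin m) ℝ} (hM : M = W * B + N) {t : ℝ}
    (hN : ∀ v, N *ᵥ v ⬝ᵥ N *ᵥ v ≤ t * (v ⬝ᵥ v)) (k : Fin (min n m)) (hk : K ≤ (k : ℕ)) :
    d k ^ 2 ≤ t := by
  have hq : K + 1 ≤ min n m := lt_of_le_of_lt hk k.2
  set V1 : Matrix (Fin m) (Fin (K + 1)) ℝ := V.submatrix id (Fin.castLE hq) with hV1
  -- `B * V1` maps a space of dimension `K + 1` to one of dimension `K`. So some combination `x` of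
  -- the first `K + 1` right singular vectors is killed by `B`: there `M` acts as `N`, yet stretches
  -- `x` by at least `d k`.
  have hker := LinearMap.ker_ne_bot_of_finrank_lt (f := (B * V1).mulVecLin) (by simp)
  obtain ⟨c, hc, hc0⟩ := (Submodule.ne_bot_iff _).1 hker
  have hc1 : B *ᵥ (V1 *ᵥ c) = 0 := by
    have : (B * V1) *ᵥ c = 0 := by simpa using hc
    rwa [← mulVec_mulVec] at this
  set x := V1 *ᵥ c with hx
  have hVV : Vᵀ * V1 = (1 : Matrix (Fin (min n m)) (Fin (min n m)) ℝ).submatrix id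
      (Fin.castLE hq) := by
    rw [← hS.right_orthonormal, hV1]
    rfl
  have hV1V1 : V1ᵀ * V1 = 1 := by
    have : V1ᵀ * V1 = (Vᵀ * V1).submatrix (Fin.castLE hq) id := rfl
    rw [this, hVV, submatrix_submatrix]
    exact submatrix_one _ (Fin.castLE_injective hq)
  have hxx : x ⬝ᵥ x = c ⬝ᵥ c := isometry_dot hV1V1 c c
  have hcoord : ∀ i, (Vᵀ *ᵥ x) (Fin.castLE hq i) = c i := by
    intro i
    have h1 : Vᵀ *ᵥ x = (Vᵀ * V1) *ᵥ c := by rw [hx, mulVec_mulVec]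
    have h2 : (V1ᵀ * V1) *ᵥ c = c := by rw [hV1V1, one_mulVec]
    rw [h1]
    exact congrFun h2 i
  have hMx : M *ᵥ x = N *ᵥ x := by
    rw [hM, add_mulVec, ← mulVec_mulVec, hc1, mulVec_zero, zero_add]
  have hcc : 0 < c ⬝ᵥ c := lt_of_le_of_ne (dot_self_nonneg c)
    fun h => hc0 (dotProduct_self_eq_zero.1 h.symm)
  refine le_of_mul_le_mul_right ?_ hcc
  calc d k ^ 2 * (c ⬝ᵥ c) = ∑ i, d k ^ 2 * (c i * c i) := by rw [dotProduct, Finset.mul_sum]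
    _ ≤ ∑ i, d (Fin.castLE hq i) ^ 2 * (c i * c i) := by
        refine Finset.sum_le_sum fun i _ => ?_
        have h1 : d k ≤ d (Fin.castLE hq i) := by
          refine hS.antitone ?_
          rw [Fin.le_def, Fin.val_castLE]
          have := i.2
          omega
        have h0 := hS.nonneg k
        have := mul_self_nonneg (c i)
        gcongr
    _ ≤ ∑ l, (d l * (Vᵀ *ᵥ x) l) * (d l * (Vᵀ *ᵥ x) l) := by
        rw [sum_castLE_add hq]
        refine le_add_of_le_of_nonneg (Finset.sum_le_sum fun i _ => ?_)
          (Finset.sum_nonneg fun l _ => mul_self_nonneg _)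
        rw [hcoord]
        apply le_of_eq; ring
    _ = N *ᵥ x ⬝ᵥ N *ᵥ x := by
        rw [← hMx, hS.mulVec_eq, isometry_dot hS.left_orthonormal]
        rfl
    _ ≤ t * (c ⬝ᵥ c) := by rw [← hxx]; exact hN x

/-- Properties of the leading left singular vectors of a perturbed low-rank matrix. -/
lemma exists_leading_left_singular {ε : Matrix (Fin n) (Fin m) ℝ}
    {Bhat : Matrix (Fin K) (Fin m) ℝ} {What : Matrix (Fin n) (Fin K) ℝ}
    (hF : IsFactorEstimate ε Bhat What) (hn : 0 < n) (hm : 0 < m)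
    {W : Matrix (Fin n) (Fin K) ℝ} {B : Matrix (Fin K) (Fin m) ℝ} {N : Matrix (Fin n) (Fin m) ℝ}
    (hε : ε = W * B + N) {t : ℝ} (hN : ∀ v, N *ᵥ v ⬝ᵥ N *ᵥ v ≤ t * (n * m) * (v ⬝ᵥ v)) :
    ∃ U : Matrix (Fin n) (Fin K) ℝ, Uᵀ * U = 1 ∧ What * Bhat = U * Uᵀ * ε ∧
      ∀ v, (ε *ᵥ v - U *ᵥ (Uᵀ *ᵥ (ε *ᵥ v))) ⬝ᵥ (ε *ᵥ v - U *ᵥ (Uᵀ *ᵥ (ε *ᵥ v))) ≤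
        t * (n * m) * (v ⬝ᵥ v) := by
  obtain ⟨U0, d, V, h, hS, hB, hW⟩ := hF
  have hnm : (0 : ℝ) < n * m := by positivity
  set ρ := Real.sqrt ((n : ℝ) * m) with hρ
  have hρ0 : ρ ≠ 0 := (Real.sqrt_pos.2 hnm).ne'
  have hρ2 : ρ ^ 2 = n * m := Real.sq_sqrt hnm.le
  have hεM : ε = ρ • (ρ⁻¹ • ε) := by rw [smul_smul, mul_inv_cancel₀ hρ0, one_smul]
  set U := U0.submatrix id (Fin.castLE h) with hU
  have hUU0 : Uᵀ * U0 = (1 : Matrix (Fin (min n m)) (Fin (min n m)) ℝ).submatrix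
      (Fin.castLE h) id := by
    rw [← hS.left_orthonormal, hU]; rfl
  have hUU : Uᵀ * U = 1 := by
    have : Uᵀ * U = (Uᵀ * U0).submatrix id (Fin.castLE h) := rfl
    rw [this, hUU0, submatrix_submatrix]
    exact submatrix_one _ (Fin.castLE_injective h)
  have hUy : ∀ (y : Fin (min n m) → ℝ) i, (Uᵀ *ᵥ (U0 *ᵥ y)) i = y (Fin.castLE h i) := by
    intro y i
    rw [mulVec_mulVec, hUU0]
    have : ((1 : Matrix (Fin (min n m)) (Fin (min n m)) ℝ) *ᵥ y) (Fin.castLE h i) =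
      y (Fin.castLE h i) := by rw [one_mulVec]
    exact this
  refine ⟨U, hUU, ?_, ?_⟩
  -- Orthonormality gives `Uᵀ ε = ρ D_K V_Kᵀ`, and the scalings `√n` of `What` and `√m` of `Bhat`
  -- multiply to `ρ`.
  · have hd : ∀ i j, (Uᵀ * ε) i j = ρ * (d (Fin.castLE h i) * V j (Fin.castLE h i)) := by
      intro i j
      have h1 : Uᵀ * ε = ρ • ((Uᵀ * U0) * (diagonal d * Vᵀ)) := by
        conv_lhs => rw [hεM, hS.eq]
        simp only [Matrix.mul_smul, Matrix.mul_assoc]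
      have h2 : (Uᵀ * U0) * (diagonal d * Vᵀ) = (diagonal d * Vᵀ).submatrix (Fin.castLE h) id := by
        rw [hUU0]
        have : (1 : Matrix (Fin (min n m)) (Fin (min n m)) ℝ).submatrix (Fin.castLE h) id *
          (diagonal d * Vᵀ) = ((1 : Matrix (Fin (min n m)) (Fin (min n m)) ℝ) *
            (diagonal d * Vᵀ)).submatrix (Fin.castLE h) id := rfl
        rw [this, Matrix.one_mul]
      rw [h1, h2, Matrix.smul_apply, submatrix_apply, diagonal_mul, smul_eq_mul]
      rfl
    ext i j
    rw [Matrix.mul_assoc, Matrix.mul_apply, Matrix.mul_apply]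
    refine Finset.sum_congr rfl fun k _ => ?_
    rw [hd, hB, hW, hρ, Real.sqrt_mul (Nat.cast_nonneg n), hU, submatrix_apply]
    simp only [id_eq]; ring
  · intro v
    have hM : ρ⁻¹ • ε = (ρ⁻¹ • W) * B + ρ⁻¹ • N := by rw [hε, smul_add, Matrix.smul_mul]
    have hN' : ∀ v, (ρ⁻¹ • N) *ᵥ v ⬝ᵥ (ρ⁻¹ • N) *ᵥ v ≤ t * (v ⬝ᵥ v) := by
      intro v
      have := mul_le_mul_of_nonneg_left (hN v) (by positivity : 0 ≤ (ρ⁻¹) ^ 2)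
      rw [smul_mulVec, smul_dotProduct, dotProduct_smul, smul_eq_mul, smul_eq_mul]
      calc ρ⁻¹ * (ρ⁻¹ * (N *ᵥ v ⬝ᵥ N *ᵥ v)) = ρ⁻¹ ^ 2 * (N *ᵥ v ⬝ᵥ N *ᵥ v) := by ring
        _ ≤ ρ⁻¹ ^ 2 * (t * (n * m) * (v ⬝ᵥ v)) := this
        _ = t * (v ⬝ᵥ v) := by rw [← hρ2]; field_simp
    have hw := hS.singularValue_sq_le hM hN'
    set y : Fin (min n m) → ℝ := fun l => d l * (Vᵀ *ᵥ v) l with hy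
    have hεv : ε *ᵥ v = ρ • (U0 *ᵥ y) := by
      conv_lhs => rw [hεM, smul_mulVec, hS.mulVec_eq]
    have hvv := transpose_mulVec_dot_self_le hS.right_orthonormal v
    have ht : ∑ l ∈ Finset.univ.filter (fun l : Fin (min n m) => K ≤ l.val), y l ^ 2 ≤ t * (v ⬝ᵥ v) := by
      by_cases hE : ∃ k : Fin (min n m), K ≤ (k : ℕ)
      · obtain ⟨k, hk⟩ := hE
        have ht0 : 0 ≤ t := (sq_nonneg _).trans (hw k hk)
        calc ∑ l ∈ Finset.univ.filter (fun l : Fin (min n m) => K ≤ l.val), y l ^ 2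
            ≤ ∑ l ∈ Finset.univ.filter (fun l : Fin (min n m) => K ≤ l.val), t * ((Vᵀ *ᵥ v) l * (Vᵀ *ᵥ v) l) := by
              refine Finset.sum_le_sum fun l hl => ?_
              have := hw l (Finset.mem_filter.1 hl).2
              rw [hy, mul_pow, sq ((Vᵀ *ᵥ v) l)]
              exact mul_le_mul_of_nonneg_right this (mul_self_nonneg _)
          _ ≤ ∑ l, t * ((Vᵀ *ᵥ v) l * (Vᵀ *ᵥ v) l) :=
              Finset.sum_le_sum_of_subset_of_nonneg (Finset.filter_subset _ _)
                fun l _ _ => mul_nonneg ht0 (mul_self_nonneg _)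
          _ = t * (Vᵀ *ᵥ v ⬝ᵥ Vᵀ *ᵥ v) := by rw [← Finset.mul_sum]; rfl
          _ ≤ t * (v ⬝ᵥ v) := by gcongr
      -- No singular value lies beyond the `K`-th, so the sum is empty and only nonnegativity of the
      -- right side is needed.
      · push Not at hE
        rw [Finset.sum_eq_zero]
        · have h1 := (dot_self_nonneg _).trans (hN' v)
          exact h1
        · intro l hl
          exact absurd (Finset.mem_filter.1 hl).2 (not_le.2 (hE l))
    rw [sub_proj_dot_self hUU, hεv, mulVec_smul]
    simp only [smul_dotProduct, dotProduct_smul, smul_eq_mul]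
    rw [isometry_dot hS.left_orthonormal]
    have e1 : y ⬝ᵥ y = ∑ l, y l ^ 2 := by simp [dotProduct, sq]
    have e2 : Uᵀ *ᵥ (U0 *ᵥ y) ⬝ᵥ Uᵀ *ᵥ (U0 *ᵥ y) = ∑ i, y (Fin.castLE h i) ^ 2 := by
      rw [dotProduct]; exact Finset.sum_congr rfl fun i _ => by rw [hUy, sq]
    have e3 := sum_castLE_add h (fun l => y l ^ 2)
    rw [e1, e2, e3]
    calc _ = ρ ^ 2 * ∑ l ∈ Finset.univ.filter (fun l : Fin (min n m) => K ≤ l.val), y l ^ 2 := by ring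
      _ ≤ ρ ^ 2 * (t * (v ⬝ᵥ v)) := by gcongr
      _ = _ := by rw [hρ2]; ring

end SVD

/-! ### Recovery of the factor space and of the residual variance -/

section Factor

variable {n m K : ℕ}

/-- Choose `v = Bᵀ (B Bᵀ)⁻¹ x`, so that `B v = x` and `W x = (W B + N) v - N v`. Both terms are
small off the range of `U`, and pervasiveness of `B` gives `‖v‖² ≤ ‖x‖² / (cB m)`; this gain of
`1/m` offsets the factor `m` in the size of `N`. -/
lemma residual_loading_le {W : Matrix (Fin n) (Fin K) ℝ} {B : Matrix (Fin K) (Fin m) ℝ}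
    {N : Matrix (Fin n) (Fin m) ℝ} {U : Matrix (Fin n) (Fin K) ℝ} (hU : Uᵀ * U = 1)
    (hm : 0 < m) {cB t : ℝ} (hcB : 0 < cB) (hB : EigenvaluesGE (B * Bᵀ) (cB * m))
    (ht : 0 ≤ t)
    (hN : ∀ v, N *ᵥ v ⬝ᵥ N *ᵥ v ≤ t * (n * m) * (v ⬝ᵥ v))
    (hε : ∀ v, ((W * B + N) *ᵥ v - U *ᵥ (Uᵀ *ᵥ ((W * B + N) *ᵥ v))) ⬝ᵥ
      ((W * B + N) *ᵥ v - U *ᵥ (Uᵀ *ᵥ ((W * B + N) *ᵥ v))) ≤ t * (n * m) * (v ⬝ᵥ v))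
    (x : Fin K → ℝ) :
    (W *ᵥ x - U *ᵥ (Uᵀ *ᵥ (W *ᵥ x))) ⬝ᵥ (W *ᵥ x - U *ᵥ (Uᵀ *ᵥ (W *ᵥ x))) ≤
      4 * t / cB * n * (x ⬝ᵥ x) := by
  have hm' : (0 : ℝ) < m := by positivity
  have hcm : 0 < cB * m := by positivity
  have hBB := hB.le_dot
  obtain ⟨y, hy⟩ := exists_mulVec_eq_of_injective (M := B * Bᵀ) (fun y hy => by
    have := hBB y
    rw [hy, dotProduct_zero] at this
    have h0 : y ⬝ᵥ y = 0 := le_antisymm (by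
      by_contra hcon
      have := mul_pos hcm (not_le.1 hcon)
      linarith) (dot_self_nonneg y)
    exact dotProduct_self_eq_zero.1 h0) x
  set v := Bᵀ *ᵥ y with hv
  have hvv : v ⬝ᵥ v = y ⬝ᵥ x := by
    rw [hv, mulVec_dot_mulVec, transpose_transpose, hy]
  have hyx := hBB y
  rw [hy] at hyx
  have hvx : cB * m * (v ⬝ᵥ v) ≤ x ⬝ᵥ x := by
    rw [hvv]
    -- Expanding this square and using `cB m ‖y‖² ≤ y · x` gives `cB m (y · x) ≤ ‖x‖²`.
    have h0 := dot_self_nonneg ((cB * m) • y - x)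
    rw [sub_dot_self, smul_dotProduct, smul_dotProduct, dotProduct_smul] at h0
    simp only [smul_eq_mul] at h0
    have h1 := mul_le_mul_of_nonneg_left hyx hcm.le
    linarith
  have hWx : W *ᵥ x = (W * B + N) *ᵥ v - N *ᵥ v := by
    rw [add_mulVec, add_sub_cancel_right, hv, mulVec_mulVec, ← hy, mulVec_mulVec, Matrix.mul_assoc]
  have hsplit : W *ᵥ x - U *ᵥ (Uᵀ *ᵥ (W *ᵥ x)) =
      ((W * B + N) *ᵥ v - U *ᵥ (Uᵀ *ᵥ ((W * B + N) *ᵥ v))) -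
        (N *ᵥ v - U *ᵥ (Uᵀ *ᵥ (N *ᵥ v))) := by
    rw [hWx, mulVec_sub, mulVec_sub]; abel
  rw [hsplit]
  have h1 := hε v
  have h2 := (sub_proj_dot_self_le hU (N *ᵥ v)).trans (hN v)
  calc _ ≤ 2 * (t * (n * m) * (v ⬝ᵥ v)) + 2 * (t * (n * m) * (v ⬝ᵥ v)) := by
        refine (sub_dot_self_le _ _).trans ?_
        gcongr
    _ = 4 * t / cB * n * (cB * m * (v ⬝ᵥ v)) := by field_simp; ring
    _ ≤ 4 * t / cB * n * (x ⬝ᵥ x) := by gcongr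

/-- As `β ≤ a / 2`, the square matrix `Uᵀ W` stays injective, so `Uᵀ e = Uᵀ W x` for some `x` of
controlled size. Then `‖Uᵀ e‖²` equals `e · W x` minus `e` paired with the part of `W x` outside the
range of `U`; Cauchy–Schwarz bounds the first by `Wᵀ e` and the second by `β`. -/
lemma proj_noise_le {W : Matrix (Fin n) (Fin K) ℝ} {U : Matrix (Fin n) (Fin K) ℝ}
    (hU : Uᵀ * U = 1) (hn : 0 < n) {a β : ℝ} (ha : 0 < a) (hβ0 : 0 ≤ β) (hβa : β ≤ a / 2)
    (hW : ∀ x, a * n * (x ⬝ᵥ x) ≤ W *ᵥ x ⬝ᵥ W *ᵥ x)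
    (hWU : ∀ x, (W *ᵥ x - U *ᵥ (Uᵀ *ᵥ (W *ᵥ x))) ⬝ᵥ (W *ᵥ x - U *ᵥ (Uᵀ *ᵥ (W *ᵥ x))) ≤
      β * n * (x ⬝ᵥ x)) (e : Fin n → ℝ) :
    a * n * (Uᵀ *ᵥ e ⬝ᵥ Uᵀ *ᵥ e) ≤ 4 * (Wᵀ *ᵥ e ⬝ᵥ Wᵀ *ᵥ e + β * n * (e ⬝ᵥ e)) := by
  have hn' : (0 : ℝ) < n := by positivity
  have hH : ∀ x, a / 2 * n * (x ⬝ᵥ x) ≤ Uᵀ *ᵥ (W *ᵥ x) ⬝ᵥ Uᵀ *ᵥ (W *ᵥ x) := by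
    intro x
    have h1 := hWU x
    rw [sub_proj_dot_self hU] at h1
    have h2 := hW x
    have h3 : β * n * (x ⬝ᵥ x) ≤ a / 2 * n * (x ⬝ᵥ x) := by
      have := dot_self_nonneg x
      gcongr
    linarith
  obtain ⟨x, hx⟩ := exists_mulVec_eq_of_injective (M := Uᵀ * W) (fun y hy => by
    have := hH y
    rw [mulVec_mulVec, hy, dotProduct_zero] at this
    have h0 : y ⬝ᵥ y = 0 := le_antisymm (by
      by_contra hcon
      have := mul_pos (by positivity : 0 < a / 2 * n) (not_le.1 hcon)
      linarith) (dot_self_nonneg y)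
    exact dotProduct_self_eq_zero.1 h0) (Uᵀ *ᵥ e)
  rw [← mulVec_mulVec] at hx
  have hHx := hH x
  set z := Uᵀ *ᵥ e with hz
  rw [hx] at hHx
  set u := W *ᵥ x - U *ᵥ (Uᵀ *ᵥ (W *ᵥ x)) with hu
  have hzz : z ⬝ᵥ z = Wᵀ *ᵥ e ⬝ᵥ x - e ⬝ᵥ u := by
    have h1 : z ⬝ᵥ z = e ⬝ᵥ U *ᵥ (Uᵀ *ᵥ (W *ᵥ x)) := by rw [dot_proj, hx]
    rw [h1, hu, dotProduct_sub, dotProduct_comm (Wᵀ *ᵥ e), dot_mulVec_transpose]; ring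
  have hβ : u ⬝ᵥ u ≤ β * n * (x ⬝ᵥ x) := hWU x
  have c1 := dot_sq_le (Wᵀ *ᵥ e) x
  have c2 := dot_sq_le e u
  have hee := dot_self_nonneg e
  have hxx := dot_self_nonneg x
  have hWe := dot_self_nonneg (Wᵀ *ᵥ e)
  have c3 : (e ⬝ᵥ u) ^ 2 ≤ (e ⬝ᵥ e) * (β * n * (x ⬝ᵥ x)) := c2.trans (by gcongr)
  set q := Wᵀ *ᵥ e ⬝ᵥ Wᵀ *ᵥ e + β * n * (e ⬝ᵥ e) with hq
  have hsq : (z ⬝ᵥ z) ^ 2 ≤ 2 * q * (x ⬝ᵥ x) := by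
    have := sq_nonneg (Wᵀ *ᵥ e ⬝ᵥ x + e ⬝ᵥ u)
    rw [hzz, hq]
    nlinarith
  have hz0 := dot_self_nonneg z
  have hq0 : 0 ≤ q := by positivity
  rcases hz0.eq_or_lt with h0 | h0
  · rw [← h0, mul_zero]; positivity
  · refine le_of_mul_le_mul_right ?_ h0
    calc a * n * (z ⬝ᵥ z) * (z ⬝ᵥ z) = a * n * (z ⬝ᵥ z) ^ 2 := by ring
      _ ≤ a * n * (2 * q * (x ⬝ᵥ x)) := by gcongr
      _ = 4 * q * (a / 2 * n * (x ⬝ᵥ x)) := by ring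
      _ ≤ 4 * q * (z ⬝ᵥ z) := by gcongr

/-- Deterministic accuracy of the residual variance of the first response. -/
lemma sigmaHatSq_sub_le [NeZero m] {W : Matrix (Fin n) (Fin K) ℝ} {B : Matrix (Fin K) (Fin m) ℝ}
    {E R : Matrix (Fin n) (Fin m) ℝ} {Bhat : Matrix (Fin K) (Fin m) ℝ}
    {What : Matrix (Fin n) (Fin K) ℝ} (hn : 0 < n)
    (hF : IsFactorEstimate (W * B + (E + R)) Bhat What) {cB CB CE a τ σ2 : ℝ}
    (hcB : 0 < cB) (ha : 0 < a) (hτ : 0 < τ) (hτ1 : τ ≤ 1) (hτa : 4 * τ ^ 2 / cB ≤ a / 2)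
    (hB : EigenvaluesGE (B * Bᵀ) (cB * m)) (hB0 : l2norm (fun k => B k 0) ^ 2 ≤ CB)
    (hσ : σ2 ≤ CE)
    (hN : ∀ v, (E + R) *ᵥ v ⬝ᵥ (E + R) *ᵥ v ≤ τ ^ 2 * (n * m) * (v ⬝ᵥ v))
    (hW : ∀ x, a * n * (x ⬝ᵥ x) ≤ W *ᵥ x ⬝ᵥ W *ᵥ x)
    (hR : (fun i => R i 0) ⬝ᵥ (fun i => R i 0) ≤ τ ^ 2 * n)
    (hWE : Wᵀ *ᵥ (fun i => E i 0) ⬝ᵥ Wᵀ *ᵥ (fun i => E i 0) ≤ τ ^ 2 * n ^ 2)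
    (hE : |(n : ℝ)⁻¹ * ((fun i => E i 0) ⬝ᵥ (fun i => E i 0)) - σ2| ≤ τ) :
    |sigmaHatSq (W * B + (E + R)) Bhat What - σ2| ≤
      τ * (2 * (8 * CB / cB + 2) + (CE + 1) + 4 / a * (1 + 4 / cB * (CE + 1)) + 1) := by
  have hm : 0 < m := Nat.pos_of_ne_zero (NeZero.ne m)
  have hn' : (0 : ℝ) < n := by positivity
  obtain ⟨U, hU, hWB, hεU⟩ := exists_leading_left_singular hF hn hm rfl hN
  have hWU := residual_loading_le hU hm hcB hB (sq_nonneg τ) hN hεU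
  set e : Fin n → ℝ := fun i => E i 0
  set ρ : Fin n → ℝ := fun i => R i 0
  set b : Fin K → ℝ := fun k => B k 0
  have hz := proj_noise_le hU hn ha (by positivity) hτa hW hWU e
  set z := Uᵀ *ᵥ e
  set β := 4 * τ ^ 2 / cB with hβ
  have hβ0 : 0 ≤ β := by positivity
  rw [l2norm_sq] at hB0
  have hCB : 0 ≤ CB := (dot_self_nonneg _).trans hB0
  have hx1 := hWU b
  set x1 := W *ᵥ b - U *ᵥ (Uᵀ *ᵥ (W *ᵥ b)) with hx1d
  have hx2 := (sub_proj_dot_self_le hU ρ).trans hR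
  set x2 := ρ - U *ᵥ (Uᵀ *ᵥ ρ) with hx2d
  have hy := sub_proj_dot_self hU e
  set y := e - U *ᵥ (Uᵀ *ᵥ e) with hyd
  -- The part of the first column outside the range of `U` splits into noise `y`, leaked loading
  -- `x1` and prediction error `x2`.
  have hres : (fun i => (W * B + (E + R)) i 0 - (What * Bhat) i 0) = y + (x1 + x2) := by
    have h1 : (fun i => (W * B + (E + R)) i 0) = W *ᵥ b + (e + ρ) := by
      ext i
      simp only [Matrix.add_apply, Pi.add_apply, Matrix.mul_apply, mulVec, dotProduct, e, ρ, b]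
    have h2 : (fun i => (What * Bhat) i 0) = U *ᵥ (Uᵀ *ᵥ (W *ᵥ b + (e + ρ))) := by
      rw [hWB, ← h1, mulVec_mulVec]; rfl
    calc (fun i => (W * B + (E + R)) i 0 - (What * Bhat) i 0)
        = (fun i => (W * B + (E + R)) i 0) - fun i => (What * Bhat) i 0 := rfl
      _ = _ := by
        rw [h1, h2, hx1d, hx2d, hyd]
        simp only [mulVec_add]
        abel
  rw [sigmaHatSq, l2norm_sq, hres, add_dot_self]
  set x := x1 + x2 with hxd
  have hxx : x ⬝ᵥ x ≤ n * (τ ^ 2 * (8 * CB / cB + 2)) := by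
    calc x ⬝ᵥ x ≤ 2 * (x1 ⬝ᵥ x1) + 2 * (x2 ⬝ᵥ x2) := add_dot_self_le _ _
      _ ≤ 2 * (β * n * CB) + 2 * (τ ^ 2 * n) := by
          gcongr
          exact hx1.trans (by gcongr)
      _ = _ := by rw [hβ]; ring
  -- Young's inequality with weight `τ`: `x ⬝ᵥ x` has order `τ² n`, so dividing it by `τ` still
  -- leaves order `τ n`.
  have hcross : |2 * (y ⬝ᵥ x)| ≤ τ⁻¹ * (x ⬝ᵥ x) + τ * (y ⬝ᵥ y) := by
    have k1 := dot_self_nonneg (τ • y - x)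
    have k2 := dot_self_nonneg (τ • y + x)
    rw [sub_dot_self] at k1
    rw [add_dot_self] at k2
    simp only [smul_dotProduct, dotProduct_smul, smul_eq_mul] at k1 k2
    rw [abs_le]
    have e1 : τ⁻¹ * (x ⬝ᵥ x) + τ * (y ⬝ᵥ y) =
      τ⁻¹ * (x ⬝ᵥ x + τ * (τ * (y ⬝ᵥ y))) := by field_simp
    have e2 : 2 * (y ⬝ᵥ x) = τ⁻¹ * (2 * (τ * (y ⬝ᵥ x))) := by field_simp
    rw [e1, e2, ← mul_neg]
    constructor <;> exact mul_le_mul_of_nonneg_left (by linarith) (by positivity)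
  set T := (n : ℝ)⁻¹ * (e ⬝ᵥ e) with hT
  have hTσ : T ≤ CE + 1 := by have := (abs_le.1 hE).2; linarith
  have hT0 : 0 ≤ T := mul_nonneg (by positivity) (dot_self_nonneg e)
  have hz0 := dot_self_nonneg z
  have hyy : y ⬝ᵥ y = e ⬝ᵥ e - z ⬝ᵥ z := hy
  have hzn : (n : ℝ)⁻¹ * (z ⬝ᵥ z) ≤ τ * (4 / a * (1 + 4 / cB * (CE + 1))) := by
    have h1 : a * n * (z ⬝ᵥ z) ≤ 4 * (τ ^ 2 * n ^ 2 + β * n * (n * T)) := by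
      have : (n : ℝ) * T = e ⬝ᵥ e := by rw [hT, mul_inv_cancel_left₀ hn'.ne']
      rw [this]
      exact hz.trans (by gcongr)
    calc (n : ℝ)⁻¹ * (z ⬝ᵥ z) = (a * n ^ 2)⁻¹ * (a * n * (z ⬝ᵥ z)) := by field_simp
      _ ≤ (a * n ^ 2)⁻¹ * (4 * (τ ^ 2 * n ^ 2 + β * n * (n * T))) := by gcongr
      _ = τ ^ 2 * (4 / a * (1 + 4 / cB * T)) := by rw [hβ]; field_simp
      _ ≤ τ * (4 / a * (1 + 4 / cB * (CE + 1))) := by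
          gcongr
          nlinarith
  have hxn : (n : ℝ)⁻¹ * (x ⬝ᵥ x) ≤ τ ^ 2 * (8 * CB / cB + 2) := by
    rw [inv_mul_le_iff₀ hn']; exact hxx
  have hx0 : 0 ≤ (n : ℝ)⁻¹ * (x ⬝ᵥ x) := mul_nonneg (by positivity) (dot_self_nonneg x)
  have hyn : (n : ℝ)⁻¹ * (y ⬝ᵥ y) = T - (n : ℝ)⁻¹ * (z ⬝ᵥ z) := by rw [hyy, hT]; ring
  have hzn0 : 0 ≤ (n : ℝ)⁻¹ * (z ⬝ᵥ z) := by positivity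
  have hcn : |(n : ℝ)⁻¹ * (2 * (y ⬝ᵥ x))| ≤ τ * (8 * CB / cB + 2) + τ * (CE + 1) := by
    rw [abs_mul, abs_of_pos (inv_pos.2 hn')]
    calc (n : ℝ)⁻¹ * |2 * (y ⬝ᵥ x)| ≤ (n : ℝ)⁻¹ * (τ⁻¹ * (x ⬝ᵥ x) + τ * (y ⬝ᵥ y)) := by gcongr
      _ = τ⁻¹ * ((n : ℝ)⁻¹ * (x ⬝ᵥ x)) + τ * ((n : ℝ)⁻¹ * (y ⬝ᵥ y)) := by ring
      _ ≤ τ⁻¹ * (τ ^ 2 * (8 * CB / cB + 2)) + τ * (CE + 1) := by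
          gcongr
          rw [hyn]; linarith
      _ = _ := by field_simp
  have hτ2 : τ ^ 2 * (8 * CB / cB + 2) ≤ τ * (8 * CB / cB + 2) := by
    gcongr
    nlinarith
  have hfin : (n : ℝ)⁻¹ * (y ⬝ᵥ y + 2 * (y ⬝ᵥ x) + x ⬝ᵥ x) - σ2 =
      (T - σ2) - (n : ℝ)⁻¹ * (z ⬝ᵥ z) + (n : ℝ)⁻¹ * (2 * (y ⬝ᵥ x)) +
        (n : ℝ)⁻¹ * (x ⬝ᵥ x) := by
    rw [mul_add, mul_add, hyn]; ring
  rw [hfin, abs_le]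
  have a1 := abs_le.1 hE
  have a2 := abs_le.1 hcn
  constructor <;> linarith

end Factor

end HiddenVar

namespace HiddenVar

open Matrix

/-! ### Sub-Gaussian variables -/

section SubGaussian

variable {Ω : Type*} {mΩ : MeasurableSpace Ω} {μ : Measure Ω} {X Y : Ω → ℝ} {c : NNReal}

lemma pow_le_factorial_mul_exp (k : ℕ) (x : ℝ) :
    |x| ^ k ≤ (k.factorial : ℝ) * (Real.exp x + Real.exp (-x)) := by
  have h1 := Real.pow_div_factorial_le_exp |x| (abs_nonneg x) k
  rw [div_le_iff₀' (by positivity)] at h1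
  refine h1.trans (mul_le_mul_of_nonneg_left ?_ (by positivity))
  rcases abs_choice x with h | h <;> rw [h]
  · linarith [Real.exp_pos (-x)]
  · linarith [Real.exp_pos x]

/-- At scale `t = 1 / √C` the exponential moments of `±t X` are at most `e ≤ 3`, and `|x|^k ≤ k! (eˣ
+ e⁻ˣ)`; hence `6 = 3 + 3`. Bounding by some `C > 0` instead of `c` allows a degenerate proxy. -/
lemma _root_.ProbabilityTheory.HasSubgaussianMGF.integral_abs_pow_le
    (h : HasSubgaussianMGF X c μ) {C : ℝ} (hC : 0 < C) (hcC : c ≤ C) (k : ℕ) :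
    ∫ ω, |X ω| ^ k ∂μ ≤ 6 * (k.factorial : ℝ) * Real.sqrt C ^ k := by
  set t := (Real.sqrt C)⁻¹ with ht
  have hs : 0 < Real.sqrt C := Real.sqrt_pos.2 hC
  have ht0 : 0 < t := inv_pos.2 hs
  have hexp : ∀ r : ℝ, r ^ 2 = t ^ 2 → ∫ ω, Real.exp (r * X ω) ∂μ ≤ 3 := by
    intro r hr
    refine (h.mgf_le r).trans ?_
    have : (c : ℝ) * r ^ 2 / 2 ≤ 1 := by
      rw [hr, ht, inv_pow, Real.sq_sqrt hC.le]
      have : (c : ℝ) * C⁻¹ ≤ 1 := by rw [← div_eq_mul_inv]; exact (div_le_one hC).2 hcC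
      linarith
    refine (Real.exp_le_exp.2 this).trans ?_
    have := Real.exp_one_lt_d9
    linarith
  have hint := (h.integrable_exp_mul t).add (h.integrable_exp_mul (-t))
  calc ∫ ω, |X ω| ^ k ∂μ
      ≤ ∫ ω, Real.sqrt C ^ k * ((k.factorial : ℝ) *
          (Real.exp (t * X ω) + Real.exp (-t * X ω))) ∂μ := by
        refine integral_mono_of_nonneg (ae_of_all _ fun ω => by positivity)
          ((hint.const_mul _).const_mul _) (ae_of_all _ fun ω => ?_)
        have h1 := pow_le_factorial_mul_exp k (t * X ω)
        rw [abs_mul, abs_of_pos ht0, mul_pow] at h1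
        have h2 := mul_le_mul_of_nonneg_left h1 (by positivity : 0 ≤ Real.sqrt C ^ k)
        rw [← mul_assoc, ← mul_pow, ht, mul_inv_cancel₀ hs.ne', one_pow, one_mul, ← neg_mul] at h2
        exact h2
    _ = Real.sqrt C ^ k * ((k.factorial : ℝ) *
          (∫ ω, Real.exp (t * X ω) ∂μ + ∫ ω, Real.exp (-t * X ω) ∂μ)) := by
        rw [integral_const_mul, integral_const_mul,
          integral_add (h.integrable_exp_mul t) (h.integrable_exp_mul (-t))]
    _ ≤ Real.sqrt C ^ k * ((k.factorial : ℝ) * (3 + 3)) := by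
        gcongr
        · exact hexp t rfl
        · exact hexp (-t) (by ring)
    _ = _ := by ring

lemma _root_.ProbabilityTheory.HasSubgaussianMGF.integrable_abs_pow
    (h : HasSubgaussianMGF X c μ) (k : ℕ) : Integrable (fun ω => |X ω| ^ k) μ := by
  rcases Nat.eq_zero_or_pos k with rfl | hk
  · have := h.integrable_exp_mul 0
    simpa using this
  · have := (h.memLp (k : NNReal)).integrable_norm_pow (p := k) hk.ne'
    simpa using this

/-- The lower integral suits Tonelli and Markov, where no integrability has to be checked. The
constant is `12 = 6 · 2!`; a zero proxy is treated apart since the moment bound rescales by `√c`. -/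
lemma _root_.ProbabilityTheory.HasSubgaussianMGF.lintegral_sq_le
    (h : HasSubgaussianMGF X c μ) :
    ∫⁻ ω, ENNReal.ofReal (X ω ^ 2) ∂μ ≤ ENNReal.ofReal (12 * c) := by
  rcases eq_or_ne c 0 with rfl | hc
  · have h0 := h.ae_eq_zero_of_hasSubgaussianMGF_zero
    rw [lintegral_congr_ae (g := fun _ => 0)]
    · simp
    · filter_upwards [h0] with ω hω
      simp [hω]
  · have hc' : (0 : ℝ) < c := by positivity
    have h1 := h.integral_abs_pow_le hc' le_rfl 2
    have h2 := h.integrable_abs_pow 2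
    simp only [sq_abs] at h1 h2
    rw [← ofReal_integral_eq_lintegral_ofReal h2 (ae_of_all _ fun ω => sq_nonneg _)]
    refine ENNReal.ofReal_le_ofReal (h1.trans (le_of_eq ?_))
    rw [Real.sq_sqrt hc'.le, Nat.factorial_two]; norm_num

/-- From `(XY)² ≤ (X⁴ + Y⁴) / 2` and fourth moments; `144 = 6 · 4!`. -/
lemma _root_.ProbabilityTheory.HasSubgaussianMGF.memLp_mul_two
    {c' : NNReal} (hX : HasSubgaussianMGF X c μ) (hY : HasSubgaussianMGF Y c' μ) {C : ℝ}
    (hC : 0 < C) (hcC : c ≤ C) (hcC' : c' ≤ C) :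
    MemLp (fun ω => X ω * Y ω) 2 μ ∧ ∫ ω, (X ω * Y ω) ^ 2 ∂μ ≤ 144 * C ^ 2 := by
  have i1 := hX.integrable_abs_pow 4
  have i2 := hY.integrable_abs_pow 4
  have hb : ∀ ω, (X ω * Y ω) ^ 2 ≤ (1 / 2) * (|X ω| ^ 4 + |Y ω| ^ 4) := by
    intro ω
    have e1 : |X ω| ^ 4 = (X ω ^ 2) ^ 2 := by rw [← sq_abs (X ω)]; ring
    have e2 : |Y ω| ^ 4 = (Y ω ^ 2) ^ 2 := by rw [← sq_abs (Y ω)]; ring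
    rw [e1, e2]
    nlinarith [sq_nonneg (X ω ^ 2 - Y ω ^ 2)]
  have i3 := (i1.add i2).const_mul (1 / 2)
  have hm : AEStronglyMeasurable (fun ω => X ω * Y ω) μ :=
    hX.aestronglyMeasurable.mul hY.aestronglyMeasurable
  constructor
  · rw [memLp_two_iff_integrable_sq hm]
    refine i3.mono' (hm.pow 2) (ae_of_all _ fun ω => ?_)
    rw [Real.norm_of_nonneg (sq_nonneg _)]
    exact hb ω
  · calc ∫ ω, (X ω * Y ω) ^ 2 ∂μ ≤ ∫ ω, (1 / 2) * (|X ω| ^ 4 + |Y ω| ^ 4) ∂μ :=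
          integral_mono_of_nonneg (ae_of_all _ fun ω => sq_nonneg _) i3 (ae_of_all _ hb)
      _ = (1 / 2) * (∫ ω, |X ω| ^ 4 ∂μ + ∫ ω, |Y ω| ^ 4 ∂μ) := by
          rw [integral_const_mul, integral_add i1 i2]
      _ ≤ (1 / 2) * (6 * (Nat.factorial 4 : ℝ) * Real.sqrt C ^ 4 +
            6 * (Nat.factorial 4 : ℝ) * Real.sqrt C ^ 4) := by
          gcongr
          · exact hX.integral_abs_pow_le hC hcC 4
          · exact hY.integral_abs_pow_le hC hcC' 4
      _ = 144 * C ^ 2 := by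
          have : Real.sqrt C ^ 4 = C ^ 2 := by
            rw [show (4 : ℕ) = 2 * 2 from rfl, pow_mul, Real.sq_sqrt hC.le]
          rw [this, show Nat.factorial 4 = 24 from rfl]
          push_cast; ring

/-- The threshold makes each one-sided Chernoff bound equal to `exp(-3L)`. The strict inequality
matters when `c = 0`: the threshold is then `0` and `X` vanishes almost everywhere. -/
lemma _root_.ProbabilityTheory.HasSubgaussianMGF.measure_abs_gt_le [IsProbabilityMeasure μ]
    (h : HasSubgaussianMGF X c μ) {L : ℝ} (hL : 0 ≤ L) :
    μ {ω | Real.sqrt (6 * L * c) < |X ω|} ≤ ENNReal.ofReal (2 * Real.exp (-(3 * L))) := by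
  rcases eq_or_ne c 0 with rfl | hc
  · have h0 := h.ae_eq_zero_of_hasSubgaussianMGF_zero
    have : μ {ω | Real.sqrt (6 * L * (0 : NNReal)) < |X ω|} = 0 := by
      rw [measure_eq_zero_iff_ae_notMem]
      filter_upwards [h0] with ω hω
      simp [hω]
    rw [this]; exact zero_le
  · have hc' : (0 : ℝ) < c := by positivity
    set T := Real.sqrt (6 * L * c) with hT
    have hT2 : T ^ 2 = 6 * L * c := Real.sq_sqrt (by positivity)
    have e : -T ^ 2 / (2 * c) = -(3 * L) := by rw [hT2]; field_simp; ring
    have h1 := h.measure_ge_le (Real.sqrt_nonneg (6 * L * c))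
    have h2 := h.neg.measure_ge_le (Real.sqrt_nonneg (6 * L * c))
    rw [← hT, e] at h1 h2
    have hsub : {ω | T < |X ω|} ⊆ {ω | T ≤ X ω} ∪ {ω | T ≤ (-X) ω} := by
      intro ω hω
      have hω' : T < |X ω| := hω
      rcases lt_abs.1 hω' with h | h
      · exact Or.inl h.le
      · exact Or.inr h.le
    refine (measure_mono hsub).trans ((measure_union_le _ _).trans ?_)
    rw [two_mul, ENNReal.ofReal_add (Real.exp_pos _).le (Real.exp_pos _).le]
    gcongr
    · rw [← ofReal_measureReal]; exact ENNReal.ofReal_le_ofReal h1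
    · rw [← ofReal_measureReal]; exact ENNReal.ofReal_le_ofReal h2

end SubGaussian

/-! ### Whitened sub-Gaussian laws -/

section Whitened

variable {d : ℕ} {γ : ℝ} {ν : Measure (Fin d → ℝ)}

lemma measurable_mulVec {d' : ℕ} (M : Matrix (Fin d') (Fin d) ℝ) :
    Measurable fun x : Fin d → ℝ => M *ᵥ x := by
  unfold mulVec dotProduct
  fun_prop

lemma PosDef_transpose {R : Matrix (Fin d) (Fin d) ℝ} (hR : R.PosDef) : Rᵀ = R := by
  simpa using hR.isHermitian.eq

lemma PosDef_mulVec_inv {R : Matrix (Fin d) (Fin d) ℝ} (hR : R.PosDef) (x : Fin d → ℝ) :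
    R *ᵥ (R⁻¹ *ᵥ x) = x := by
  rw [mulVec_mulVec, Matrix.mul_nonsing_inv _ hR.det_pos.ne'.isUnit, one_mulVec]

lemma IsWhitenedSubGaussian.cov_nonneg (h : IsWhitenedSubGaussian γ ν) (u : Fin d → ℝ) :
    0 ≤ u ⬝ᵥ covMatrix ν *ᵥ u := by
  obtain ⟨R, hR, hRR, -⟩ := h
  have : Rᵀ * R = covMatrix ν := by rw [PosDef_transpose hR, hRR]
  rw [← this, ← mulVec_dot_mulVec]
  exact dot_self_nonneg _

/-- Moving the symmetric root across the product, `u · x = (R u) · (R⁻¹ x)`, and `‖R u‖²` is the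
variance of `u · x`. -/
lemma IsWhitenedSubGaussian.hasSubgaussianMGF (h : IsWhitenedSubGaussian γ ν)
    (u : Fin d → ℝ) :
    HasSubgaussianMGF (fun x => u ⬝ᵥ x) (γ ^ 2 * (u ⬝ᵥ covMatrix ν *ᵥ u)).toNNReal ν := by
  have hnn := h.cov_nonneg u
  obtain ⟨R, hR, hRR, hs⟩ := h
  have hm : Measurable fun x : Fin d → ℝ => R⁻¹ *ᵥ x := measurable_mulVec _
  have hdot : ∀ (t : ℝ) (x : Fin d → ℝ), t * (u ⬝ᵥ x) = (t • R *ᵥ u) ⬝ᵥ R⁻¹ *ᵥ x := by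
    intro t x
    rw [smul_dotProduct, smul_eq_mul]
    congr 1
    have h1 := dot_mulVec_transpose R (R⁻¹ *ᵥ x) u
    rw [PosDef_transpose hR, PosDef_mulVec_inv hR, dotProduct_comm] at h1
    rw [h1.symm]
  have hm2 : ∀ v : Fin d → ℝ, Measurable fun x : Fin d → ℝ => Real.exp (v ⬝ᵥ x) := by
    intro v; unfold dotProduct; fun_prop
  constructor
  · intro t
    have := (integrable_map_measure (hm2 _).aestronglyMeasurable hm.aemeasurable).1
      (hs.integrable_exp (t • R *ᵥ u))
    refine this.congr (ae_of_all _ fun x => ?_)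
    simp only [Function.comp]
    rw [hdot]
  · intro t
    have h1 := hs.mgf_le (t • R *ᵥ u)
    rw [integral_map hm.aemeasurable (hm2 _).aestronglyMeasurable] at h1
    have h2 : mgf (fun x => u ⬝ᵥ x) ν t = ∫ x, Real.exp ((t • R *ᵥ u) ⬝ᵥ R⁻¹ *ᵥ x) ∂ν := by
      unfold mgf
      exact integral_congr_ae (ae_of_all _ fun x => by simp only; rw [hdot])
    rw [h2]
    refine h1.trans (le_of_eq ?_)
    have e : l2norm (t • R *ᵥ u) ^ 2 = t ^ 2 * (u ⬝ᵥ covMatrix ν *ᵥ u) := by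
      rw [l2norm_sq, smul_dotProduct, dotProduct_smul, mulVec_dot_mulVec, PosDef_transpose hR, hRR]
      simp only [smul_eq_mul]; ring
    rw [e, Real.coe_toNNReal _ (by positivity)]
    congr 1; ring

lemma IsWhitenedSubGaussian.integral_coord (h : IsWhitenedSubGaussian γ ν) (i : Fin d) :
    ∫ x, x i ∂ν = 0 := by
  obtain ⟨R, hR, hRR, hs⟩ := h
  have hm : Measurable fun x : Fin d → ℝ => R⁻¹ *ᵥ x := measurable_mulVec _
  have h1 : ∀ k, Integrable (fun x => (R⁻¹ *ᵥ x) k) ν := fun k =>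
    (integrable_map_measure (measurable_pi_apply k).aestronglyMeasurable hm.aemeasurable).1
      (hs.integrable_coord k)
  have h2 : ∀ k, ∫ x, (R⁻¹ *ᵥ x) k ∂ν = 0 := fun k => by
    have := hs.centered k
    rwa [integral_map hm.aemeasurable (measurable_pi_apply k).aestronglyMeasurable] at this
  have h3 : ∀ x : Fin d → ℝ, x i = ∑ k, R i k * (R⁻¹ *ᵥ x) k := fun x =>
    (congrFun (PosDef_mulVec_inv hR x) i).symm
  simp_rw [h3]
  rw [integral_finsetSum _ fun k _ => (h1 k).const_mul _]
  simp [integral_const_mul, h2]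

lemma IsWhitenedSubGaussian.hasSubgaussianMGF_coord (h : IsWhitenedSubGaussian γ ν) (i : Fin d) :
    HasSubgaussianMGF (fun x => x i) (γ ^ 2 * covMatrix ν i i).toNNReal ν := by
  simpa using h.hasSubgaussianMGF (Pi.single i 1)

lemma IsWhitenedSubGaussian.integral_mul [IsProbabilityMeasure ν]
    (h : IsWhitenedSubGaussian γ ν) (i j : Fin d) :
    ∫ x, x i * x j ∂ν = covMatrix ν i j := by
  have h1 := (h.hasSubgaussianMGF_coord i).memLp 2
  have h2 := (h.hasSubgaussianMGF_coord j).memLp 2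
  rw [covMatrix, of_apply, covariance_eq_sub h1 h2, h.integral_coord, zero_mul, sub_zero]
  rfl

lemma diag_le_opNorm (M : Matrix (Fin d) (Fin d) ℝ) (i : Fin d) : M i i ≤ opNorm M := by
  simpa using dot_mulVec_le_opNorm M (Pi.single i 1)

end Whitened

/-! ### A law of large numbers -/

/-- Chebyshev's inequality, with each variance bounded by the second moment that the sub-Gaussian
estimates provide. -/
lemma measure_abs_mean_sub_ge_le {Ω : Type*} {mΩ : MeasurableSpace Ω} {μ : Measure Ω}
    [IsProbabilityMeasure μ] {n : ℕ} (hn : 0 < n) {Y : Fin n → Ω → ℝ} (hY : iIndepFun Y μ)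
    {a V t : ℝ} (ht : 0 < t) (hL : ∀ i, MemLp (Y i) 2 μ) (ha : ∀ i, ∫ ω, Y i ω ∂μ = a)
    (hV : ∀ i, ∫ ω, Y i ω ^ 2 ∂μ ≤ V) :
    μ {ω | t ≤ |(n : ℝ)⁻¹ * ∑ i, Y i ω - a|} ≤ ENNReal.ofReal (V / (n * t ^ 2)) := by
  have hn' : (0 : ℝ) < n := by positivity
  have hS : MemLp (∑ i, Y i) 2 μ := memLp_finsetSum' _ fun i _ => hL i
  have hmean : ∫ ω, (∑ i, Y i) ω ∂μ = n * a := by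
    simp only [Finset.sum_apply]
    rw [integral_finsetSum _ fun i _ => (hL i).integrable (by norm_num)]
    simp [ha]
  have hvar : variance (∑ i, Y i) μ ≤ n * V := by
    rw [IndepFun.variance_sum (fun i _ => hL i) fun i _ j _ hij => hY.indepFun hij]
    calc ∑ i, variance (Y i) μ ≤ ∑ _i : Fin n, V := by
          refine Finset.sum_le_sum fun i _ => ?_
          refine (variance_le_expectation_sq (hL i).aestronglyMeasurable).trans ?_
          exact hV i
      _ = n * V := by simp
  have hch := meas_ge_le_variance_div_sq hS (mul_pos hn' ht)
  rw [hmean] at hch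
  have hset : {ω | t ≤ |(n : ℝ)⁻¹ * ∑ i, Y i ω - a|} = {ω | n * t ≤ |(∑ i, Y i) ω - n * a|} := by
    ext ω
    simp only [Set.mem_ofPred_eq, Finset.sum_apply]
    have : (n : ℝ)⁻¹ * ∑ i, Y i ω - a = (n : ℝ)⁻¹ * (∑ i, Y i ω - n * a) := by
      rw [mul_sub, inv_mul_cancel_left₀ hn'.ne']
    rw [this, abs_mul, abs_of_pos (inv_pos.2 hn'), le_inv_mul_iff₀ hn']
  rw [hset]
  refine hch.trans (ENNReal.ofReal_le_ofReal ?_)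
  calc variance (∑ i, Y i) μ / (n * t) ^ 2 ≤ n * V / (n * t) ^ 2 := by gcongr
    _ = V / (n * t ^ 2) := by field_simp

end HiddenVar

namespace HiddenVar

open Matrix

/-! ### Measurability of the ridge projections -/

section Measurability

variable {α : Type*} [MeasurableSpace α]

lemma measurable_matrix_det {d : ℕ} {f : α → Matrix (Fin d) (Fin d) ℝ}
    (hf : ∀ i j, Measurable fun a => f a i j) : Measurable fun a => (f a).det := by
  simp only [det_apply]
  refine Finset.measurable_sum _ fun σ _ => ?_
  refine Measurable.const_smul ?_ _
  exact Finset.measurable_prod _ fun i _ => hf _ _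

/-- The adjugate formula with the inverse of `0` set to `0` covers singular matrices too, so no
invertibility is required of the random ridge matrix. -/
lemma measurable_matrix_inv {d : ℕ} {f : α → Matrix (Fin d) (Fin d) ℝ}
    (hf : ∀ i j, Measurable fun a => f a i j) (i j : Fin d) :
    Measurable fun a => (f a)⁻¹ i j := by
  simp only [inv_def, Ring.inverse_eq_inv', Matrix.smul_apply, smul_eq_mul, adjugate_apply]
  refine (measurable_matrix_det hf).inv.mul (measurable_matrix_det fun k l => ?_)
  simp only [updateRow_apply]
  by_cases h : k = j
  · simp [h]
  · simp [h, hf]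

lemma measurable_matrix_mul {a b c : ℕ} {f : α → Matrix (Fin a) (Fin b) ℝ}
    {g : α → Matrix (Fin b) (Fin c) ℝ} (hf : ∀ i j, Measurable fun x => f x i j)
    (hg : ∀ i j, Measurable fun x => g x i j) (i : Fin a) (j : Fin c) :
    Measurable fun x => (f x * g x) i j := by
  simp only [mul_apply]
  exact Finset.measurable_sum _ fun k _ => (hf _ _).mul (hg _ _)

variable {n p : ℕ} {lam : Matrix (Fin n) (Fin p) ℝ → ℝ}

lemma measurable_Pmat (hl : Measurable fun x : Fin n → Fin p → ℝ => lam (of x)) (i k : Fin n) :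
    Measurable fun x : Fin n → Fin p → ℝ => Pmat (of x) (lam (of x)) i k := by
  have hx : ∀ i j, Measurable fun x : Fin n → Fin p → ℝ => (of x : Matrix _ _ ℝ) i j := by
    intro i j; simp only [of_apply]; fun_prop
  have hxt : ∀ i j, Measurable fun x : Fin n → Fin p → ℝ => (of x : Matrix _ _ ℝ)ᵀ i j :=
    fun i j => hx j i
  unfold Pmat
  refine measurable_matrix_mul (measurable_matrix_mul hx (measurable_matrix_inv fun a b => ?_))
    hxt i k
  simp only [ridgeMat, Matrix.add_apply, Matrix.smul_apply, smul_eq_mul]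
  exact (measurable_matrix_mul hxt hx a b).add ((hl.const_mul _).mul_const _)

lemma measurable_Qmat (hl : Measurable fun x : Fin n → Fin p → ℝ => lam (of x)) (i k : Fin n) :
    Measurable fun x : Fin n → Fin p → ℝ => Qmat (of x) (lam (of x)) i k := by
  simp only [Qmat, Matrix.sub_apply]
  exact measurable_const.sub (measurable_Pmat hl i k)

end Measurability

/-! ### Joint law of the design and of the errors -/

namespace Model

variable {n p m K : ℕ} (P : Model p m K)

lemma measurable_W : Measurable P.W := by
  unfold Model.W
  exact measurable_snd.sub ((measurable_mulVec _).comp measurable_fst)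

/-- The joint law of the factor residual `W` and of the noise `E`. -/
noncomputable def lawErr : Measure ((Fin K → ℝ) × (Fin m → ℝ)) := P.lawW.prod P.lawE

/-- The `j`-th error `B_jᵀ W + E_j`. -/
noncomputable def err (j : Fin m) (q : (Fin K → ℝ) × (Fin m → ℝ)) : ℝ := (fun k => P.B k j) ⬝ᵥ q.1 + q.2 j

lemma measurable_err (j : Fin m) : Measurable (P.err j) := by
  unfold err dotProduct
  fun_prop

variable {P}

lemma IsStandard.prob_lawX (hP : P.IsStandard) : IsProbabilityMeasure P.lawX :=
  have := hP.probXZ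
  Measure.isProbabilityMeasure_map measurable_fst.aemeasurable

lemma IsStandard.prob_lawW (hP : P.IsStandard) : IsProbabilityMeasure P.lawW :=
  have := hP.probXZ
  Measure.isProbabilityMeasure_map P.measurable_W.aemeasurable

lemma IsStandard.prob_lawErr (hP : P.IsStandard) : IsProbabilityMeasure P.lawErr := by
  have := hP.prob_lawW
  have := hP.probE
  unfold lawErr; infer_instance

/-- Split a draw into the features and the errors. -/
noncomputable def split (P : Model p m K) (w : ((Fin p → ℝ) × (Fin K → ℝ)) × (Fin m → ℝ)) :
    (Fin p → ℝ) × ((Fin K → ℝ) × (Fin m → ℝ)) := (w.1.1, (P.W w.1, w.2))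

lemma measurable_split (P : Model p m K) : Measurable P.split := by
  unfold split
  exact (measurable_fst.comp measurable_fst).prodMk
    ((P.measurable_W.comp measurable_fst).prodMk measurable_snd)

/-- `W` is independent of `X`, and `E` of `(X, Z)`; hence the features are independent of the pair
`(W, E)`. This is what lets `P_λ` and `Q_λ` be treated as constants in the noise bounds. -/
lemma IsStandard.map_split (hP : P.IsStandard) (hXW : IndepFun Prod.fst P.W P.lawXZ) :
    P.law.map P.split = P.lawX.prod P.lawErr := by
  have := hP.probXZ
  have := hP.probE
  have := hP.prob_lawX
  have := hP.prob_lawW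
  have h1 := (indepFun_iff_map_prod_eq_prod_map_map measurable_fst.aemeasurable
    P.measurable_W.aemeasurable).1 hXW
  have hm : Measurable fun w => ((w.1 : Fin p → ℝ), P.W w) :=
    measurable_fst.prodMk P.measurable_W
  have h2 := Measure.map_prod_map P.lawXZ P.lawE hm measurable_id
  rw [h1, Measure.map_id] at h2
  have h3 := (measurePreserving_prodAssoc P.lawX P.lawW P.lawE).map_eq
  have h4 : P.split = MeasurableEquiv.prodAssoc ∘
      Prod.map (fun w => ((w.1 : Fin p → ℝ), P.W w)) id := rfl
  rw [h4, ← Measure.map_map MeasurableEquiv.prodAssoc.measurable (hm.prodMap measurable_id), law,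
    ← h2]
  exact h3

/-- The design and the errors of a sample, separately. -/
noncomputable def splitSample (P : Model p m K) (D : Sample n p m K) :
    (Fin n → Fin p → ℝ) × (Fin n → (Fin K → ℝ) × (Fin m → ℝ)) :=
  (fun i => (D i).1.1, fun i => (P.W (D i).1, (D i).2))

variable {Ω : Type*} {mΩ : MeasurableSpace Ω} {μ : Measure Ω} [IsProbabilityMeasure μ]
  {D : Ω → Sample n p m K}

lemma IsStandard.hasLaw_splitSample (hP : P.IsStandard)
    (hXW : IndepFun Prod.fst P.W P.lawXZ)
    (hlaw : ∀ i, HasLaw (fun ω => D ω i) P.law μ) (hind : iIndepFun (fun i ω => D ω i) μ) :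
    HasLaw (fun ω => P.splitSample (D ω))
      ((Measure.pi fun _ => P.lawX).prod (Measure.pi fun _ => P.lawErr)) μ := by
  have := hP.prob_lawX
  have := hP.prob_lawErr
  have hm : ∀ i, AEMeasurable (fun ω => P.split (D ω i)) μ := fun i =>
    P.measurable_split.comp_aemeasurable (hlaw i).aemeasurable
  have hi : iIndepFun (fun i ω => P.split (D ω i)) μ :=
    hind.comp (fun _ => P.split) fun _ => P.measurable_split
  have h1 := (iIndepFun_iff_map_fun_eq_pi_map hm).1 hi
  have h2 : ∀ i, μ.map (fun ω => P.split (D ω i)) = P.lawX.prod P.lawErr := fun i => by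
    rw [← hP.map_split hXW, ← (hlaw i).map_eq,
      AEMeasurable.map_map_of_aemeasurable P.measurable_split.aemeasurable (hlaw i).aemeasurable]
    rfl
  simp only [h2] at h1
  have h3 := (measurePreserving_arrowProdEquivProdArrow (Fin p → ℝ) ((Fin K → ℝ) × (Fin m → ℝ))
    (Fin n) (fun _ => P.lawX) fun _ => P.lawErr).map_eq
  have hme : Measurable (MeasurableEquiv.arrowProdEquivProdArrow (Fin p → ℝ)
    ((Fin K → ℝ) × (Fin m → ℝ)) (Fin n)) := MeasurableEquiv.measurable _
  have h5 : AEMeasurable (fun ω i => P.split (D ω i)) μ := aemeasurable_pi_lambda _ hm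
  have h4 : (fun ω => P.splitSample (D ω)) = (MeasurableEquiv.arrowProdEquivProdArrow (Fin p → ℝ)
    ((Fin K → ℝ) × (Fin m → ℝ)) (Fin n)) ∘ fun ω i => P.split (D ω i) := rfl
  refine ⟨?_, ?_⟩
  · rw [h4]; exact hme.comp_aemeasurable h5
  · rw [h4, ← AEMeasurable.map_map_of_aemeasurable hme.aemeasurable h5, h1, h3]

/-! ### Sub-Gaussian errors -/

variable {γw γe : ℝ}

lemma sigma_sq (h : P.SubGaussianErrors γw γe) (j : Fin m) :
    P.sigma γw γe j ^ 2 = γw ^ 2 * P.hiddenVar j + γe ^ 2 * P.SigE j j := by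
  have h1 : 0 ≤ P.hiddenVar j := h.subW.cov_nonneg _
  have h2 : 0 ≤ P.SigE j j := by
    simpa [SigE] using h.subE.cov_nonneg (Pi.single j 1)
  rw [sigma, Real.sq_sqrt (by positivity)]

lemma hasSubgaussianMGF_err (hP : P.IsStandard) (h : P.SubGaussianErrors γw γe) (j : Fin m) :
    HasSubgaussianMGF (P.err j) (P.sigma γw γe j ^ 2).toNNReal P.lawErr := by
  have := hP.prob_lawW
  have := hP.probE
  have h1 : 0 ≤ P.hiddenVar j := h.subW.cov_nonneg _
  have h2 : 0 ≤ P.SigE j j := by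
    simpa [SigE] using h.subE.cov_nonneg (Pi.single j 1)
  have hX : HasSubgaussianMGF (fun q : (Fin K → ℝ) × (Fin m → ℝ) => (fun k => P.B k j) ⬝ᵥ q.1)
      (γw ^ 2 * P.hiddenVar j).toNNReal P.lawErr := by
    refine HasSubgaussianMGF.of_map (X := fun w : Fin K → ℝ => (fun k => P.B k j) ⬝ᵥ w)
      measurable_fst.aemeasurable ?_
    rw [lawErr, Measure.map_fst_prod, measure_univ, one_smul]
    exact h.subW.hasSubgaussianMGF _
  have hY : HasSubgaussianMGF (fun q : (Fin K → ℝ) × (Fin m → ℝ) => q.2 j)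
      (γe ^ 2 * P.SigE j j).toNNReal P.lawErr := by
    refine HasSubgaussianMGF.of_map (X := fun e : Fin m → ℝ => e j)
      measurable_snd.aemeasurable ?_
    rw [lawErr, Measure.map_snd_prod, measure_univ, one_smul]
    exact h.subE.hasSubgaussianMGF_coord j
  have hind : IndepFun (fun q : (Fin K → ℝ) × (Fin m → ℝ) => (fun k => P.B k j) ⬝ᵥ q.1)
      (fun q => q.2 j) P.lawErr := by
    refine indepFun_prod (X := fun w : Fin K → ℝ => (fun k => P.B k j) ⬝ᵥ w)
      (Y := fun e : Fin m → ℝ => e j) ?_ ?_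
    · unfold dotProduct; fun_prop
    · fun_prop
  have := hX.add_of_indepFun hY hind
  rw [← Real.toNNReal_add (by positivity) (by positivity), ← sigma_sq h] at this
  exact this

/-- Rows are independent, so the proxies add up. The vector `a` will be a row of `P_λ` or a column
of `Q_λ X` at a fixed design. -/
lemma hasSubgaussianMGF_dot_err (hP : P.IsStandard) (h : P.SubGaussianErrors γw γe) (j : Fin m)
    (a : Fin n → ℝ) :
    HasSubgaussianMGF (fun q : Fin n → (Fin K → ℝ) × (Fin m → ℝ) => a ⬝ᵥ fun i => P.err j (q i))
      (P.sigma γw γe j ^ 2 * (a ⬝ᵥ a)).toNNReal (Measure.pi fun _ => P.lawErr) := by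
  have := hP.prob_lawErr
  have hi : iIndepFun (fun (i : Fin n) (q : Fin n → (Fin K → ℝ) × (Fin m → ℝ)) =>
      a i * P.err j (q i)) (Measure.pi fun _ => P.lawErr) :=
    iIndepFun_pi (μ := fun _ : Fin n => P.lawErr) (X := fun i q => a i * P.err j q)
      fun i => ((P.measurable_err j).const_mul _).aemeasurable
  have hs : ∀ i, HasSubgaussianMGF (fun q : Fin n → (Fin K → ℝ) × (Fin m → ℝ) =>
      a i * P.err j (q i)) (P.sigma γw γe j ^ 2 * (a i * a i)).toNNReal
      (Measure.pi fun _ => P.lawErr) := by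
    intro i
    have h1 : HasSubgaussianMGF (fun q : Fin n → (Fin K → ℝ) × (Fin m → ℝ) => P.err j (q i))
        (P.sigma γw γe j ^ 2).toNNReal (Measure.pi fun _ => P.lawErr) := by
      refine HasSubgaussianMGF.of_map (X := P.err j) (measurable_pi_apply i).aemeasurable ?_
      rw [(measurePreserving_eval (fun _ : Fin n => P.lawErr) i).map_eq]
      exact hasSubgaussianMGF_err hP h j
    have h2 := h1.const_mul (a i)
    convert h2 using 1
    ext
    rw [Real.coe_toNNReal _ (mul_nonneg (sq_nonneg _) (mul_self_nonneg _))]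
    change _ = a i ^ 2 * ((P.sigma γw γe j ^ 2).toNNReal : ℝ)
    rw [Real.coe_toNNReal _ (sq_nonneg _)]
    ring
  have := HasSubgaussianMGF.sum_of_iIndepFun hi (s := Finset.univ) fun i _ => hs i
  have e : ∑ i, (P.sigma γw γe j ^ 2 * (a i * a i)).toNNReal =
      (P.sigma γw γe j ^ 2 * (a ⬝ᵥ a)).toNNReal := by
    rw [dotProduct, Finset.mul_sum, Real.toNNReal_sum_of_nonneg
      fun i _ => mul_nonneg (sq_nonneg _) (mul_self_nonneg _)]
  rw [e] at this
  exact this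

end Model

end HiddenVar

/-! ### Noise bounds with the design held fixed -/

namespace HiddenVar

open Matrix

/-- Conditioning on the design in the form of Tonelli's theorem: a bound valid for every fixed first
component holds for the joint law. -/
lemma measure_preimage_le_of_section_le {Ω α β : Type*} {mΩ : MeasurableSpace Ω}
    {mα : MeasurableSpace α} {mβ : MeasurableSpace β} {μ : Measure Ω} {μa : Measure α}
    {μb : Measure β} [IsProbabilityMeasure μa] [IsProbabilityMeasure μb] {Z : Ω → α × β}
    (hZ : HasLaw Z (μa.prod μb) μ) {S : Set (α × β)} (hS : MeasurableSet S) {b : ENNReal}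
    (h : ∀ x, μb (Prod.mk x ⁻¹' S) ≤ b) : μ (Z ⁻¹' S) ≤ b := by
  rw [← Measure.map_apply_of_aemeasurable hZ.aemeasurable hS, hZ.map_eq, Measure.prod_apply hS]
  calc ∫⁻ x, μb (Prod.mk x ⁻¹' S) ∂μa ≤ ∫⁻ _, b ∂μa := lintegral_mono h
    _ = b := by simp

lemma lintegral_le_of_section_le {Ω α β : Type*} {mΩ : MeasurableSpace Ω}
    {mα : MeasurableSpace α} {mβ : MeasurableSpace β} {μ : Measure Ω} {μa : Measure α}
    {μb : Measure β} [IsProbabilityMeasure μa] [IsProbabilityMeasure μb] {Z : Ω → α × β}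
    (hZ : HasLaw Z (μa.prod μb) μ) {f : α × β → ENNReal} (hf : Measurable f) {b : ENNReal}
    (h : ∀ x, ∫⁻ y, f (x, y) ∂μb ≤ b) : ∫⁻ ω, f (Z ω) ∂μ ≤ b := by
  rw [← lintegral_map' hf.aemeasurable hZ.aemeasurable, hZ.map_eq, lintegral_prod _ hf.aemeasurable]
  calc ∫⁻ x, ∫⁻ y, f (x, y) ∂μb ∂μa ≤ ∫⁻ _, b ∂μa := lintegral_mono h
    _ = b := by simp

namespace Model

variable {n p m K : ℕ} {P : Model p m K} {γw γe : ℝ}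
  {Ω : Type*} {mΩ : MeasurableSpace Ω} {μ : Measure Ω} {D : Ω → Sample n p m K}

/-- The vector of the `j`-th errors of a sample. -/
noncomputable def errVec (P : Model p m K) (j : Fin m)
    (q : Fin n → (Fin K → ℝ) × (Fin m → ℝ)) : Fin n → ℝ := fun i => P.err j (q i)

lemma measurable_errVec (j : Fin m) (i : Fin n) :
    Measurable fun q : Fin n → (Fin K → ℝ) × (Fin m → ℝ) => P.errVec j q i :=
  (P.measurable_err j).comp (measurable_pi_apply i)

/-- Calibration of the penalty: the left side is the sub-Gaussian threshold at level `3 log (p ∨ m)`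
for coordinate `i` of `Xᵀ Q e`, and `‖Q X_i‖² = n M_ii` is at most `n` times the maximum in the
penalty. -/
lemma sqrt_le_lambdaOne (hn : 0 < n) (X : Matrix (Fin n) (Fin p) ℝ) (lam : ℝ) (j : Fin m)
    (i : Fin p) :
    Real.sqrt (6 * Real.log (max p m : ℕ) * (P.sigma γw γe j ^ 2 *
      ((Qmat X lam * X).col i ⬝ᵥ (Qmat X lam * X).col i))) ≤
      n * (lambdaOne P γw γe X lam j / 4) := by
  have hn' : (0 : ℝ) < n := by positivity
  set L := Real.log (max p m : ℕ)
  have hL : 0 ≤ L := Real.log_natCast_nonneg _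
  have hcol : (Qmat X lam * X).col i = Qmat X lam *ᵥ (X *ᵥ Pi.single i 1) := by
    rw [mulVec_mulVec, mulVec_single_one]
  have hM : (Qmat X lam * X).col i ⬝ᵥ (Qmat X lam * X).col i = n * Mmat X lam i i := by
    rw [hcol, Mmat_apply_self, mul_inv_cancel_left₀ hn'.ne']
  have hMi : Mmat X lam i i ≤ ⨆ i, Mmat X lam i i :=
    le_ciSup (f := fun i => Mmat X lam i i) (Set.finite_range _).bddAbove i
  have hM0 : 0 ≤ Mmat X lam i i := by
    rw [Mmat_apply_self]; exact mul_nonneg (inv_nonneg.2 hn'.le) (dot_self_nonneg _)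
  have hM1 := hM0.trans hMi
  have hs : 0 ≤ P.sigma γw γe j := Real.sqrt_nonneg _
  rw [hM, lambdaOne]
  refine Real.sqrt_le_iff.2 ⟨by positivity, ?_⟩
  have e : (n * (4 * P.sigma γw γe j * Real.sqrt (6 * ⨆ i, Mmat X lam i i) *
      Real.sqrt (L / n) / 4)) ^ 2 =
      n ^ 2 * P.sigma γw γe j ^ 2 * (6 * ⨆ i, Mmat X lam i i) * (L / n) := by
    rw [← Real.sq_sqrt (by positivity : 0 ≤ 6 * ⨆ i, Mmat X lam i i),
      ← Real.sq_sqrt (by positivity : 0 ≤ L / n), Real.sqrt_sq (Real.sqrt_nonneg _),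
      Real.sqrt_sq (Real.sqrt_nonneg _)]
    ring
  rw [e]
  calc 6 * L * (P.sigma γw γe j ^ 2 * (n * Mmat X lam i i))
      ≤ 6 * L * (P.sigma γw γe j ^ 2 * (n * ⨆ i, Mmat X lam i i)) := by gcongr
    _ = _ := by field_simp

/-- With high probability all the lasso penalties dominate the noise. -/
lemma measure_noise_not_le [NeZero p] [NeZero m] (hn : 0 < n) (hP : P.IsStandard)
    (herr : P.SubGaussianErrors γw γe)
    (hsplit : HasLaw (fun ω => P.splitSample (D ω))
      ((Measure.pi fun _ => P.lawX).prod (Measure.pi fun _ => P.lawErr)) μ)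
    {lam : Fin m → Matrix (Fin n) (Fin p) ℝ → ℝ}
    (hlam : ∀ j, Measurable fun x : Fin n → Fin p → ℝ => lam j (of x)) :
    μ {ω | ¬ ∀ j i, |((designMat (D ω))ᵀ *ᵥ (Qmat (designMat (D ω)) (lam j (designMat (D ω))) *ᵥ
        P.errVec j (P.splitSample (D ω)).2)) i| ≤
      n * (lambdaOne P γw γe (designMat (D ω)) (lam j (designMat (D ω))) j / 4)} ≤
      ENNReal.ofReal (2 / m) := by
  have := hP.prob_lawX
  have := hP.prob_lawErr
  set L := Real.log (max p m : ℕ)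
  have hL : 0 ≤ L := Real.log_natCast_nonneg _
  set a : Fin m → Fin p → (Fin n → Fin p → ℝ) → Fin n → ℝ := fun j i x =>
    (Qmat (of x) (lam j (of x)) * of x).col i with ha
  have ham : ∀ j i k, Measurable fun x => a j i x k := by
    intro j i k
    refine measurable_matrix_mul (measurable_Qmat (hlam j)) (fun k l => ?_) k i
    simp only [of_apply]; fun_prop
  set S : Fin m → Fin p → Set ((Fin n → Fin p → ℝ) × (Fin n → (Fin K → ℝ) × (Fin m → ℝ))) :=
    fun j i => {z | Real.sqrt (6 * L * (P.sigma γw γe j ^ 2 * (a j i z.1 ⬝ᵥ a j i z.1))) <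
      |a j i z.1 ⬝ᵥ P.errVec j z.2|} with hS
  have hSm : ∀ j i, MeasurableSet (S j i) := by
    intro j i
    have h1 : ∀ k, Measurable fun z : (Fin n → Fin p → ℝ) × (Fin n → (Fin K → ℝ) × (Fin m → ℝ)) =>
      a j i z.1 k := fun k => (ham j i k).comp measurable_fst
    have h2 : ∀ k, Measurable fun z : (Fin n → Fin p → ℝ) × (Fin n → (Fin K → ℝ) × (Fin m → ℝ)) =>
      P.errVec j z.2 k := fun k => (measurable_errVec j k).comp measurable_snd
    refine measurableSet_lt ?_ ?_
    · refine Real.continuous_sqrt.measurable.comp (Measurable.const_mul (Measurable.const_mul ?_ _) _)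
      exact Finset.measurable_sum _ fun k _ => (h1 k).mul (h1 k)
    · have : Measurable fun z : (Fin n → Fin p → ℝ) × (Fin n → (Fin K → ℝ) × (Fin m → ℝ)) =>
        a j i z.1 ⬝ᵥ P.errVec j z.2 := Finset.measurable_sum _ fun k _ => (h1 k).mul (h2 k)
      exact continuous_abs.measurable.comp this
  have hSle : ∀ j i, μ ((fun ω => P.splitSample (D ω)) ⁻¹' S j i) ≤
      ENNReal.ofReal (2 * Real.exp (-(3 * L))) := by
    intro j i
    refine measure_preimage_le_of_section_le hsplit (hSm j i) fun x => ?_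
    have := (hasSubgaussianMGF_dot_err hP herr j (a j i x)).measure_abs_gt_le hL
    rw [Real.coe_toNNReal _ (mul_nonneg (sq_nonneg _) (dot_self_nonneg _))] at this
    exact this
  have hsub : {ω | ¬ ∀ j i, |((designMat (D ω))ᵀ *ᵥ (Qmat (designMat (D ω))
      (lam j (designMat (D ω))) *ᵥ P.errVec j (P.splitSample (D ω)).2)) i| ≤
      n * (lambdaOne P γw γe (designMat (D ω)) (lam j (designMat (D ω))) j / 4)} ⊆
      ⋃ j, ⋃ i, (fun ω => P.splitSample (D ω)) ⁻¹' S j i := by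
    intro ω hω
    by_contra hcon
    simp only [Set.mem_iUnion, not_exists] at hcon
    refine hω fun j i => ?_
    have h1 : Real.sqrt (6 * L * (P.sigma γw γe j ^ 2 * (a j i (P.splitSample (D ω)).1 ⬝ᵥ
        a j i (P.splitSample (D ω)).1))) ≥
      |a j i (P.splitSample (D ω)).1 ⬝ᵥ P.errVec j (P.splitSample (D ω)).2| := not_lt.1 (hcon j i)
    have h2 := sqrt_le_lambdaOne (P := P) (γw := γw) (γe := γe) hn (designMat (D ω))
      (lam j (designMat (D ω))) j i
    refine le_trans (le_of_eq ?_) (h1.trans h2)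
    have h3 : ((designMat (D ω))ᵀ *ᵥ (Qmat (designMat (D ω)) (lam j (designMat (D ω))) *ᵥ
        P.errVec j (P.splitSample (D ω)).2)) i =
        ((Qmat (designMat (D ω)) (lam j (designMat (D ω))) * designMat (D ω))ᵀ *ᵥ
        P.errVec j (P.splitSample (D ω)).2) i := by
      rw [transpose_mul, Qmat_transpose, mulVec_mulVec]
    rw [h3]
    rfl
  refine (measure_mono hsub).trans ?_
  calc μ (⋃ j, ⋃ i, (fun ω => P.splitSample (D ω)) ⁻¹' S j i)
      ≤ ∑ _j : Fin m, ∑ _i : Fin p, ENNReal.ofReal (2 * Real.exp (-(3 * L))) :=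
        (measure_iUnion_fintype_le _ _).trans (Finset.sum_le_sum fun j _ =>
          (measure_iUnion_fintype_le _ _).trans (Finset.sum_le_sum fun i _ => hSle j i))
    _ = ENNReal.ofReal (m * (p * (2 * Real.exp (-(3 * L))))) := by
        simp only [Finset.sum_const, Finset.card_univ, Fintype.card_fin, nsmul_eq_mul]
        rw [ENNReal.ofReal_mul (Nat.cast_nonneg _), ENNReal.ofReal_mul (Nat.cast_nonneg _),
          ENNReal.ofReal_natCast, ENNReal.ofReal_natCast]
    _ ≤ ENNReal.ofReal (2 / m) := by
        refine ENNReal.ofReal_le_ofReal ?_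
        have hm : (0 : ℝ) < m := by exact_mod_cast Nat.pos_of_ne_zero (NeZero.ne m)
        have hmN : (m : ℝ) ≤ (max p m : ℕ) := by exact_mod_cast le_max_right p m
        have hpN : (p : ℝ) ≤ (max p m : ℕ) := by exact_mod_cast le_max_left p m
        set N : ℝ := ((max p m : ℕ) : ℝ)
        have hN : 0 < N := hm.trans_le hmN
        -- Each of the `p m` events has probability at most `2 N⁻³`, and `p m · 2 N⁻³ ≤ 2 / N ≤ 2 /
        -- m`.
        have hexp : Real.exp (-(3 * L)) = (N ^ 3)⁻¹ := by
          rw [Real.exp_neg, mul_comm, Real.exp_mul, Real.exp_log hN]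
          norm_cast
        rw [hexp, le_div_iff₀ hm]
        calc m * (p * (2 * (N ^ 3)⁻¹)) * m ≤ N * (N * (2 * (N ^ 3)⁻¹)) * N := by gcongr
          _ = 2 := by field_simp

/-- Prediction error due to the ridge-projected noise, over a set of responses. -/
lemma measure_proj_noise_ge_le (hn : 0 < n) (hP : P.IsStandard)
    (herr : P.SubGaussianErrors γw γe)
    (hsplit : HasLaw (fun ω => P.splitSample (D ω))
      ((Measure.pi fun _ => P.lawX).prod (Measure.pi fun _ => P.lawErr)) μ)
    {lam : Fin m → Matrix (Fin n) (Fin p) ℝ → ℝ}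
    (hlam : ∀ j, Measurable fun x : Fin n → Fin p → ℝ => lam j (of x))
    (J : Finset (Fin m)) (hJ : J.Nonempty) {r θ : ℝ} (hθ : 0 < θ) :
    μ {ω | (∀ j ∈ J, P.sigma γw γe j ^ 2 *
          (Pmat (designMat (D ω)) (lam j (designMat (D ω))) *
            Pmat (designMat (D ω)) (lam j (designMat (D ω)))).trace ≤ n * r) ∧
        n * J.card * θ ≤ ∑ j ∈ J,
          Pmat (designMat (D ω)) (lam j (designMat (D ω))) *ᵥ
            P.errVec j (P.splitSample (D ω)).2 ⬝ᵥ
          Pmat (designMat (D ω)) (lam j (designMat (D ω))) *ᵥ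
            P.errVec j (P.splitSample (D ω)).2} ≤ ENNReal.ofReal (12 * r / θ) := by
  have := hP.prob_lawX
  have := hP.prob_lawErr
  have hn' : (0 : ℝ) < n := by positivity
  have hJ' : (0 : ℝ) < J.card := by exact_mod_cast hJ.card_pos
  set Pm : Fin m → (Fin n → Fin p → ℝ) → Matrix (Fin n) (Fin n) ℝ := fun j x =>
    Pmat (of x) (lam j (of x)) with hPm
  have hPmm : ∀ j i k, Measurable fun x => Pm j x i k := fun j i k => measurable_Pmat (hlam j) i k
  set G : Fin m → Set (Fin n → Fin p → ℝ) := fun j =>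
    {x | P.sigma γw γe j ^ 2 * (Pm j x * Pm j x).trace ≤ n * r} with hG
  have hGm : ∀ j, MeasurableSet (G j) := by
    intro j
    refine measurableSet_le (Measurable.const_mul ?_ _) measurable_const
    simp only [trace, diag_apply]
    exact Finset.measurable_sum _ fun k _ => measurable_matrix_mul (hPmm j) (hPmm j) k k
  -- The indicator discards designs with a large trace, so the bound on the inner integral holds for
  -- every design; on the event in the statement it equals one for all `j ∈ J`.
  set g : Fin m → (Fin n → Fin p → ℝ) × (Fin n → (Fin K → ℝ) × (Fin m → ℝ)) → ENNReal :=
    fun j z => (G j).indicator 1 z.1 *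
      ∑ k, ENNReal.ofReal ((Pm j z.1 k ⬝ᵥ P.errVec j z.2) ^ 2) with hg
  have hgm : ∀ j, Measurable (g j) := by
    intro j
    refine Measurable.mul ((measurable_one.indicator (hGm j)).comp measurable_fst)
      (Finset.measurable_sum _ fun k _ => Measurable.ennreal_ofReal (Measurable.pow_const ?_ _))
    exact Finset.measurable_sum _ fun l _ => ((hPmm j k l).comp measurable_fst).mul
      ((measurable_errVec j l).comp measurable_snd)
  have hgi : ∀ j, ∫⁻ ω, g j (P.splitSample (D ω)) ∂μ ≤ ENNReal.ofReal (12 * (n * r)) := by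
    intro j
    refine lintegral_le_of_section_le hsplit (hgm j) fun x => ?_
    by_cases hx : x ∈ G j
    · simp only [hg, Set.indicator_of_mem hx, Pi.one_apply, one_mul]
      have hm2 : ∀ k, Measurable fun q : Fin n → (Fin K → ℝ) × (Fin m → ℝ) =>
          ENNReal.ofReal ((Pm j x k ⬝ᵥ P.errVec j q) ^ 2) := by
        intro k
        refine Measurable.ennreal_ofReal (Measurable.pow_const ?_ _)
        exact Finset.measurable_sum _ fun l _ => (measurable_errVec j l).const_mul _
      rw [lintegral_finsetSum _ fun k _ => hm2 k]
      have h0 : ∀ k, 0 ≤ P.sigma γw γe j ^ 2 * (Pm j x k ⬝ᵥ Pm j x k) := fun k =>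
        mul_nonneg (sq_nonneg _) (dot_self_nonneg _)
      calc ∑ k, ∫⁻ q, ENNReal.ofReal ((Pm j x k ⬝ᵥ P.errVec j q) ^ 2)
              ∂(Measure.pi fun _ => P.lawErr)
          ≤ ∑ k, ENNReal.ofReal (12 * (P.sigma γw γe j ^ 2 * (Pm j x k ⬝ᵥ Pm j x k))) := by
            refine Finset.sum_le_sum fun k _ => ?_
            have := (hasSubgaussianMGF_dot_err hP herr j (Pm j x k)).lintegral_sq_le
            rw [Real.coe_toNNReal _ (h0 k)] at this
            exact this
        -- By symmetry of `P`, the squared norms of its rows add up to the trace of `P²`.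
        _ = ENNReal.ofReal (12 * (P.sigma γw γe j ^ 2 * (Pm j x * Pm j x).trace)) := by
            rw [← ENNReal.ofReal_sum_of_nonneg fun k _ => mul_nonneg (by norm_num) (h0 k),
              ← Finset.mul_sum, ← Finset.mul_sum]
            congr 3
            rw [trace]
            refine Finset.sum_congr rfl fun k _ => ?_
            rw [diag_apply, mul_apply, dotProduct]
            refine Finset.sum_congr rfl fun l _ => ?_
            have hsym : Pm j x l k = Pm j x k l :=
              congrFun (congrFun (Pmat_transpose (of x) (lam j (of x))) k) l
            rw [hsym]
        _ ≤ ENNReal.ofReal (12 * (n * r)) := by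
            refine ENNReal.ofReal_le_ofReal ?_
            have : P.sigma γw γe j ^ 2 * (Pm j x * Pm j x).trace ≤ n * r := hx
            linarith
    · simp only [hg, Set.indicator_of_notMem hx, zero_mul, lintegral_zero]
      exact zero_le
  have hgae : ∀ j, AEMeasurable (fun ω => g j (P.splitSample (D ω))) μ := fun j =>
    (hgm j).comp_aemeasurable hsplit.aemeasurable
  have hmk := mul_meas_ge_le_lintegral₀ (μ := μ)
    (Finset.aemeasurable_fun_sum J fun j _ => hgae j) (ENNReal.ofReal (n * J.card * θ))
  rw [lintegral_finsetSum' _ fun j _ => hgae j] at hmk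
  have hsum : ∑ j ∈ J, ∫⁻ ω, g j (P.splitSample (D ω)) ∂μ ≤
      ENNReal.ofReal (n * J.card * θ) * ENNReal.ofReal (12 * r / θ) := by
    calc ∑ j ∈ J, ∫⁻ ω, g j (P.splitSample (D ω)) ∂μ
        ≤ ∑ _j ∈ J, ENNReal.ofReal (12 * (n * r)) := Finset.sum_le_sum fun j _ => hgi j
      _ = ENNReal.ofReal (J.card * (12 * (n * r))) := by
          rw [Finset.sum_const, nsmul_eq_mul, ENNReal.ofReal_mul (Nat.cast_nonneg _),
            ENNReal.ofReal_natCast]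
      _ = _ := by
          rw [← ENNReal.ofReal_mul (by positivity)]
          congr 1; field_simp
  have hpos : 0 < (n : ℝ) * J.card * θ := by positivity
  have hfin := (ENNReal.mul_le_mul_iff_right (ENNReal.ofReal_pos.2 hpos).ne'
    ENNReal.ofReal_ne_top).1 (hmk.trans hsum)
  refine (measure_mono ?_).trans hfin
  rintro ω ⟨h1, h2⟩
  have h3 : ∑ j ∈ J, g j (P.splitSample (D ω)) = ENNReal.ofReal (∑ j ∈ J,
      Pmat (designMat (D ω)) (lam j (designMat (D ω))) *ᵥ P.errVec j (P.splitSample (D ω)).2 ⬝ᵥ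
      Pmat (designMat (D ω)) (lam j (designMat (D ω))) *ᵥ
        P.errVec j (P.splitSample (D ω)).2) := by
    rw [ENNReal.ofReal_sum_of_nonneg fun j _ => dot_self_nonneg _]
    refine Finset.sum_congr rfl fun j hj => ?_
    have hx : (P.splitSample (D ω)).1 ∈ G j := h1 j hj
    simp only [hg, Set.indicator_of_mem hx, Pi.one_apply, one_mul]
    rw [← ENNReal.ofReal_sum_of_nonneg fun j _ => sq_nonneg _]
    congr 1
    exact Finset.sum_congr rfl fun k _ => sq _
  change ENNReal.ofReal _ ≤ ∑ j ∈ J, g j (P.splitSample (D ω))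
  rw [h3]
  exact ENNReal.ofReal_le_ofReal h2

end Model

end HiddenVar

/-! ### Moments and concentration of the noise and of the factor residuals -/

namespace HiddenVar

open Matrix

namespace Model

variable {n p m K : ℕ} {P : Model p m K} {γw γe : ℝ}
  {Ω : Type*} {mΩ : MeasurableSpace Ω} {μ : Measure Ω}
  {D : Ω → Sample n p m K}

lemma IsStandard.hasLaw_err (hP : P.IsStandard) (hXW : IndepFun Prod.fst P.W P.lawXZ)
    (hlaw : ∀ i, HasLaw (fun ω => D ω i) P.law μ) (i : Fin n) :
    HasLaw (fun ω => (P.splitSample (D ω)).2 i) P.lawErr μ := by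
  have := hP.prob_lawX
  have := hP.prob_lawErr
  have hm : Measurable fun w => (P.split w).2 := measurable_snd.comp P.measurable_split
  refine ⟨hm.comp_aemeasurable (hlaw i).aemeasurable, ?_⟩
  have h1 : μ.map (fun ω => (P.splitSample (D ω)).2 i) =
      (μ.map fun ω => D ω i).map fun w => (P.split w).2 :=
    (AEMeasurable.map_map_of_aemeasurable hm.aemeasurable (hlaw i).aemeasurable).symm
  have h2 : P.law.map (fun w => (P.split w).2) = (P.law.map P.split).map Prod.snd :=
    (Measure.map_map measurable_snd P.measurable_split).symm
  rw [h1, (hlaw i).map_eq, h2, hP.map_split hXW, Measure.map_snd_prod, measure_univ, one_smul]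

lemma iIndepFun_err (hind : iIndepFun (fun i ω => D ω i) μ) :
    iIndepFun (fun i ω => (P.splitSample (D ω)).2 i) μ :=
  hind.comp (fun _ w => (P.split w).2) fun _ => measurable_snd.comp P.measurable_split

lemma measure_err_mean_sub_ge_le [IsProbabilityMeasure μ] (hn : 0 < n) (hP : P.IsStandard)
    (hXW : IndepFun Prod.fst P.W P.lawXZ) (hlaw : ∀ i, HasLaw (fun ω => D ω i) P.law μ)
    (hind : iIndepFun (fun i ω => D ω i) μ) {f : (Fin K → ℝ) × (Fin m → ℝ) → ℝ}
    (hf : Measurable f) (hf2 : MemLp f 2 P.lawErr) {a V t : ℝ} (ht : 0 < t)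
    (ha : ∫ q, f q ∂P.lawErr = a) (hV : ∫ q, f q ^ 2 ∂P.lawErr ≤ V) :
    μ {ω | t ≤ |(n : ℝ)⁻¹ * ∑ i, f ((P.splitSample (D ω)).2 i) - a|} ≤
      ENNReal.ofReal (V / (n * t ^ 2)) := by
  have hq := hP.hasLaw_err hXW hlaw
  refine measure_abs_mean_sub_ge_le hn
    ((iIndepFun_err (P := P) hind).comp (fun _ => f) fun _ => hf) ht (fun i => ?_) (fun i => ?_)
    fun i => ?_
  · rw [← (hq i).map_eq] at hf2
    exact (memLp_map_measure_iff hf.aestronglyMeasurable (hq i).aemeasurable).1 hf2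
  · rw [← ha, ← (hq i).map_eq, integral_map (hq i).aemeasurable hf.aestronglyMeasurable]
    rfl
  · refine le_trans (le_of_eq ?_) hV
    rw [← (hq i).map_eq,
      integral_map (hq i).aemeasurable (hf.pow_const 2).aestronglyMeasurable]
    rfl

section Coordinates

variable {Λ : ℝ}

lemma hasSubgaussianMGF_W (hP : P.IsStandard) (herr : P.SubGaussianErrors γw γe) (k : Fin K) :
    HasSubgaussianMGF (fun q : (Fin K → ℝ) × (Fin m → ℝ) => q.1 k)
      (γw ^ 2 * P.SigW k k).toNNReal P.lawErr := by
  have := hP.prob_lawW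
  have := hP.probE
  refine HasSubgaussianMGF.of_map (X := fun w : Fin K → ℝ => w k) measurable_fst.aemeasurable ?_
  rw [lawErr, Measure.map_fst_prod, measure_univ, one_smul]
  exact herr.subW.hasSubgaussianMGF_coord k

lemma hasSubgaussianMGF_E (hP : P.IsStandard) (herr : P.SubGaussianErrors γw γe) (j : Fin m) :
    HasSubgaussianMGF (fun q : (Fin K → ℝ) × (Fin m → ℝ) => q.2 j)
      (γe ^ 2 * P.SigE j j).toNNReal P.lawErr := by
  have := hP.prob_lawW
  have := hP.probE
  refine HasSubgaussianMGF.of_map (X := fun e : Fin m → ℝ => e j) measurable_snd.aemeasurable ?_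
  rw [lawErr, Measure.map_snd_prod, measure_univ, one_smul]
  exact herr.subE.hasSubgaussianMGF_coord j

lemma toNNReal_le {x : ℝ} (hΛ : 0 < Λ) (h : x ≤ Λ) : (x.toNNReal : ℝ) ≤ Λ := by
  rw [Real.coe_toNNReal']; exact max_le h hΛ.le

lemma integral_W_mul_W (hP : P.IsStandard) (herr : P.SubGaussianErrors γw γe) (k l : Fin K) :
    ∫ q, q.1 k * q.1 l ∂P.lawErr = P.SigW k l := by
  have := hP.prob_lawW
  have := hP.probE
  have h := integral_map (μ := P.lawErr) (φ := Prod.fst) measurable_fst.aemeasurable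
    (f := fun w : Fin K → ℝ => w k * w l) (by fun_prop)
  rw [← h, lawErr, Measure.map_fst_prod, measure_univ, one_smul]
  exact herr.subW.integral_mul k l

lemma integral_E_mul_E (hP : P.IsStandard) (herr : P.SubGaussianErrors γw γe) (k l : Fin m) :
    ∫ q, q.2 k * q.2 l ∂P.lawErr = P.SigE k l := by
  have := hP.prob_lawW
  have := hP.probE
  have h := integral_map (μ := P.lawErr) (φ := Prod.snd) measurable_snd.aemeasurable
    (f := fun e : Fin m → ℝ => e k * e l) (by fun_prop)
  rw [← h, lawErr, Measure.map_snd_prod, measure_univ, one_smul]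
  exact herr.subE.integral_mul k l

lemma integral_W_mul_E (hP : P.IsStandard) (herr : P.SubGaussianErrors γw γe) (k : Fin K)
    (j : Fin m) : ∫ q, q.1 k * q.2 j ∂P.lawErr = 0 := by
  have := hP.prob_lawW
  have := hP.probE
  have h := integral_prod_mul (μ := P.lawW) (ν := P.lawE) (fun w : Fin K → ℝ => w k)
    (fun e : Fin m → ℝ => e j)
  rw [herr.subE.integral_coord j, mul_zero] at h
  exact h

lemma hasSubgaussianMGF_dot_E (hP : P.IsStandard) (herr : P.SubGaussianErrors γw γe)
    (u : Fin m → ℝ) :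
    HasSubgaussianMGF (fun q : (Fin K → ℝ) × (Fin m → ℝ) => u ⬝ᵥ q.2)
      (γe ^ 2 * (u ⬝ᵥ P.SigE *ᵥ u)).toNNReal P.lawErr := by
  have := hP.prob_lawW
  have := hP.probE
  refine HasSubgaussianMGF.of_map (X := fun e : Fin m → ℝ => u ⬝ᵥ e) measurable_snd.aemeasurable ?_
  rw [lawErr, Measure.map_snd_prod, measure_univ, one_smul]
  exact herr.subE.hasSubgaussianMGF u

/-- Diagonal entries of `E Eᵀ`: Cauchy–Schwarz over the `m` coordinates reduces the square to fourth
moments and costs the order `m²`. -/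
lemma lintegral_E_dot_self_sq_le (hP : P.IsStandard) (herr : P.SubGaussianErrors γw γe)
    (hΛ : 0 < Λ) (hE : γe ^ 2 * opNorm P.SigE ≤ Λ) :
    ∫⁻ q, ENNReal.ofReal ((q.2 ⬝ᵥ q.2) ^ 2) ∂P.lawErr ≤ ENNReal.ofReal (144 * Λ ^ 2 * m ^ 2) := by
  have hE' : ∀ j, γe ^ 2 * P.SigE j j ≤ Λ := fun j =>
    (mul_le_mul_of_nonneg_left (diag_le_opNorm _ j) (sq_nonneg γe)).trans hE
  have hj : ∀ j, ∫⁻ q, ENNReal.ofReal ((q.2 j * q.2 j) ^ 2) ∂P.lawErr ≤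
      ENNReal.ofReal (144 * Λ ^ 2) := by
    intro j
    have h := hasSubgaussianMGF_E hP herr j
    obtain ⟨h1, h2⟩ := h.memLp_mul_two h hΛ (toNNReal_le hΛ (hE' j)) (toNNReal_le hΛ (hE' j))
    rw [← ofReal_integral_eq_lintegral_ofReal h1.integrable_sq (ae_of_all _ fun _ => sq_nonneg _)]
    exact ENNReal.ofReal_le_ofReal h2
  have hpt : ∀ q : (Fin K → ℝ) × (Fin m → ℝ), ENNReal.ofReal ((q.2 ⬝ᵥ q.2) ^ 2) ≤
      ∑ j, ENNReal.ofReal m * ENNReal.ofReal ((q.2 j * q.2 j) ^ 2) := by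
    intro q
    rw [← Finset.mul_sum, ← ENNReal.ofReal_sum_of_nonneg fun j _ => sq_nonneg _,
      ← ENNReal.ofReal_mul (Nat.cast_nonneg _)]
    refine ENNReal.ofReal_le_ofReal ?_
    have := sq_sum_le_card_mul_sum_sq (s := Finset.univ) (f := fun j => q.2 j * q.2 j)
    simpa [dotProduct] using this
  calc ∫⁻ q, ENNReal.ofReal ((q.2 ⬝ᵥ q.2) ^ 2) ∂P.lawErr
      ≤ ∫⁻ q, ∑ j, ENNReal.ofReal m * ENNReal.ofReal ((q.2 j * q.2 j) ^ 2) ∂P.lawErr :=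
        lintegral_mono hpt
    _ = ∑ j, ENNReal.ofReal m * ∫⁻ q, ENNReal.ofReal ((q.2 j * q.2 j) ^ 2) ∂P.lawErr := by
        rw [lintegral_finsetSum _ fun j _ => by fun_prop]
        exact Finset.sum_congr rfl fun j _ => lintegral_const_mul _ (by fun_prop)
    _ ≤ ∑ _j : Fin m, ENNReal.ofReal m * ENNReal.ofReal (144 * Λ ^ 2) := by
        gcongr with j
        exact hj j
    _ = ENNReal.ofReal (144 * Λ ^ 2 * m ^ 2) := by
        rw [Finset.sum_const, Finset.card_univ, Fintype.card_fin, nsmul_eq_mul,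
          ← ENNReal.ofReal_mul (Nat.cast_nonneg _), ← ENNReal.ofReal_natCast,
          ← ENNReal.ofReal_mul (Nat.cast_nonneg _)]
        congr 1; ring

/-- Off-diagonal entries of `E Eᵀ`: with one row `u` fixed, the other contributes at most `12 Λ
‖u‖²`, whose mean has order `m`. Independence thus gains a factor `m` over the diagonal; here the
operator norm of `Σ_E` is needed, not just its diagonal. -/
lemma lintegral_prod_E_dot_sq_le (hP : P.IsStandard) (herr : P.SubGaussianErrors γw γe)
    (hΛ : 0 < Λ) (hE : γe ^ 2 * opNorm P.SigE ≤ Λ) :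
    ∫⁻ z, ENNReal.ofReal ((z.1.2 ⬝ᵥ z.2.2) ^ 2) ∂P.lawErr.prod P.lawErr ≤
      ENNReal.ofReal (144 * Λ ^ 2 * m) := by
  have := hP.prob_lawErr
  have hE' : ∀ u : Fin m → ℝ, γe ^ 2 * (u ⬝ᵥ P.SigE *ᵥ u) ≤ Λ * (u ⬝ᵥ u) := fun u => by
    calc γe ^ 2 * (u ⬝ᵥ P.SigE *ᵥ u) ≤ γe ^ 2 * (opNorm P.SigE * (u ⬝ᵥ u)) :=
          mul_le_mul_of_nonneg_left (dot_mulVec_le_opNorm _ u) (sq_nonneg γe)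
      _ = γe ^ 2 * opNorm P.SigE * (u ⬝ᵥ u) := by ring
      _ ≤ Λ * (u ⬝ᵥ u) := mul_le_mul_of_nonneg_right hE (dot_self_nonneg u)
  have hsec : ∀ u : Fin m → ℝ, ∫⁻ q, ENNReal.ofReal ((u ⬝ᵥ q.2) ^ 2) ∂P.lawErr ≤
      ENNReal.ofReal (12 * Λ * (u ⬝ᵥ u)) := by
    intro u
    refine (hasSubgaussianMGF_dot_E hP herr u).lintegral_sq_le.trans (ENNReal.ofReal_le_ofReal ?_)
    rw [Real.coe_toNNReal', mul_assoc]
    gcongr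
    exact max_le (hE' u) (mul_nonneg hΛ.le (dot_self_nonneg u))
  have hcoord : ∀ j, ∫⁻ q, ENNReal.ofReal (q.2 j ^ 2) ∂P.lawErr ≤ ENNReal.ofReal (12 * Λ) := by
    intro j
    have := hsec (Pi.single j 1)
    simpa using this
  have hm : Measurable fun z : ((Fin K → ℝ) × (Fin m → ℝ)) × ((Fin K → ℝ) × (Fin m → ℝ)) =>
      ENNReal.ofReal ((z.1.2 ⬝ᵥ z.2.2) ^ 2) := by
    unfold dotProduct; fun_prop
  rw [lintegral_prod _ hm.aemeasurable]
  calc ∫⁻ x, ∫⁻ y, ENNReal.ofReal ((x.2 ⬝ᵥ y.2) ^ 2) ∂P.lawErr ∂P.lawErr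
      ≤ ∫⁻ x, ∑ j, ENNReal.ofReal (12 * Λ) * ENNReal.ofReal (x.2 j ^ 2) ∂P.lawErr := by
        refine lintegral_mono fun x => (hsec x.2).trans (le_of_eq ?_)
        rw [← Finset.mul_sum, ← ENNReal.ofReal_sum_of_nonneg fun j _ => sq_nonneg _,
          ← ENNReal.ofReal_mul (by positivity)]
        simp only [dotProduct, sq]
    _ = ∑ j, ENNReal.ofReal (12 * Λ) * ∫⁻ x, ENNReal.ofReal (x.2 j ^ 2) ∂P.lawErr := by
        rw [lintegral_finsetSum _ fun j _ => by fun_prop]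
        exact Finset.sum_congr rfl fun j _ => lintegral_const_mul _ (by fun_prop)
    _ ≤ ∑ _j : Fin m, ENNReal.ofReal (12 * Λ) * ENNReal.ofReal (12 * Λ) := by
        gcongr with j
        exact hcoord j
    _ = ENNReal.ofReal (144 * Λ ^ 2 * m) := by
        rw [Finset.sum_const, Finset.card_univ, Fintype.card_fin, nsmul_eq_mul,
          ← ENNReal.ofReal_mul (by positivity), ← ENNReal.ofReal_natCast,
          ← ENNReal.ofReal_mul (Nat.cast_nonneg _)]
        congr 1; ring

/-- Expected squared inner products of the noise rows. -/
lemma lintegral_noise_dot_sq_le [IsProbabilityMeasure μ] (hP : P.IsStandard)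
    (hXW : IndepFun Prod.fst P.W P.lawXZ)
    (hlaw : ∀ i, HasLaw (fun ω => D ω i) P.law μ) (hind : iIndepFun (fun i ω => D ω i) μ)
    (herr : P.SubGaussianErrors γw γe) (hΛ : 0 < Λ) (hE : γe ^ 2 * opNorm P.SigE ≤ Λ)
    (i i' : Fin n) :
    ∫⁻ ω, ENNReal.ofReal ((noiseMat (D ω) i ⬝ᵥ noiseMat (D ω) i') ^ 2) ∂μ ≤
      ENNReal.ofReal (144 * Λ ^ 2 * ((if i = i' then (m : ℝ) ^ 2 else 0) + m)) := by
  have hq := hP.hasLaw_err hXW hlaw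
  have := hP.prob_lawErr
  by_cases h : i = i'
  · subst h
    rw [if_pos rfl]
    have hm : Measurable fun q : (Fin K → ℝ) × (Fin m → ℝ) =>
        ENNReal.ofReal ((q.2 ⬝ᵥ q.2) ^ 2) := by
      unfold dotProduct; fun_prop
    have h1 := lintegral_map' (μ := μ) hm.aemeasurable (hq i).aemeasurable
    rw [(hq i).map_eq] at h1
    refine (le_of_eq h1.symm).trans ((lintegral_E_dot_self_sq_le hP herr hΛ hE).trans
      (ENNReal.ofReal_le_ofReal ?_))
    gcongr
    exact le_add_of_nonneg_right (Nat.cast_nonneg m)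
  · rw [if_neg h, zero_add]
    have hI := (iIndepFun_err (P := P) hind).indepFun h
    have hmap := (indepFun_iff_map_prod_eq_prod_map_map (hq i).aemeasurable
      (hq i').aemeasurable).1 hI
    rw [(hq i).map_eq, (hq i').map_eq] at hmap
    have hm : Measurable fun z : ((Fin K → ℝ) × (Fin m → ℝ)) × ((Fin K → ℝ) × (Fin m → ℝ)) =>
        ENNReal.ofReal ((z.1.2 ⬝ᵥ z.2.2) ^ 2) := by
      unfold dotProduct; fun_prop
    have h1 := lintegral_map' (μ := μ) hm.aemeasurable
      ((hq i).aemeasurable.prodMk (hq i').aemeasurable)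
    rw [hmap] at h1
    exact (le_of_eq h1.symm).trans (lintegral_prod_E_dot_sq_le hP herr hΛ hE)

/-- The squared Frobenius norm of `E Eᵀ` is of smaller order than `n² m²`. -/
lemma measure_noise_gram_ge_le [IsProbabilityMeasure μ] [NeZero m] (hn : 0 < n)
    (hP : P.IsStandard) (hXW : IndepFun Prod.fst P.W P.lawXZ)
    (hlaw : ∀ i, HasLaw (fun ω => D ω i) P.law μ) (hind : iIndepFun (fun i ω => D ω i) μ)
    (herr : P.SubGaussianErrors γw γe) (hΛ : 0 < Λ) (hE : γe ^ 2 * opNorm P.SigE ≤ Λ)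
    {t : ℝ} (ht : 0 < t) :
    μ {ω | t * (n * m) ^ 2 ≤ ∑ i, ∑ i', (noiseMat (D ω) i ⬝ᵥ noiseMat (D ω) i') ^ 2} ≤
      ENNReal.ofReal (144 * Λ ^ 2 / t * (1 / n + 1 / m)) := by
  have hn' : (0 : ℝ) < n := by positivity
  have hm' : (0 : ℝ) < m := by exact_mod_cast Nat.pos_of_ne_zero (NeZero.ne m)
  have hq := hP.hasLaw_err hXW hlaw
  have hmeas : ∀ i i' : Fin n, AEMeasurable (fun ω => ENNReal.ofReal
      ((noiseMat (D ω) i ⬝ᵥ noiseMat (D ω) i') ^ 2)) μ := by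
    intro i i'
    have hm : Measurable fun z : ((Fin K → ℝ) × (Fin m → ℝ)) × ((Fin K → ℝ) × (Fin m → ℝ)) =>
        ENNReal.ofReal ((z.1.2 ⬝ᵥ z.2.2) ^ 2) := by
      unfold dotProduct; fun_prop
    exact hm.comp_aemeasurable
      (f := fun ω => ((P.splitSample (D ω)).2 i, (P.splitSample (D ω)).2 i'))
      ((hq i).aemeasurable.prodMk (hq i').aemeasurable)
  have hmk := mul_meas_ge_le_lintegral₀ (μ := μ)
    (f := fun ω => ∑ i, ∑ i', ENNReal.ofReal ((noiseMat (D ω) i ⬝ᵥ noiseMat (D ω) i') ^ 2))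
    (Finset.aemeasurable_fun_sum _ fun i _ => Finset.aemeasurable_fun_sum _ fun i' _ => hmeas i i')
    (ENNReal.ofReal (t * (n * m) ^ 2))
  rw [lintegral_finsetSum' _ fun i _ => Finset.aemeasurable_fun_sum _ fun i' _ => hmeas i i'] at hmk
  have hsum : ∑ i : Fin n, ∫⁻ ω, ∑ i' : Fin n,
      ENNReal.ofReal ((noiseMat (D ω) i ⬝ᵥ noiseMat (D ω) i') ^ 2) ∂μ ≤
      ENNReal.ofReal (t * (n * m) ^ 2) * ENNReal.ofReal (144 * Λ ^ 2 / t * (1 / n + 1 / m)) := by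
    calc _ = ∑ i : Fin n, ∑ i' : Fin n, ∫⁻ ω,
          ENNReal.ofReal ((noiseMat (D ω) i ⬝ᵥ noiseMat (D ω) i') ^ 2) ∂μ :=
          Finset.sum_congr rfl fun i _ => lintegral_finsetSum' _ fun i' _ => hmeas i i'
      _ ≤ ∑ i : Fin n, ∑ i' : Fin n,
            ENNReal.ofReal (144 * Λ ^ 2 * ((if i = i' then (m : ℝ) ^ 2 else 0) + m)) := by
          gcongr with i _ i' _
          exact lintegral_noise_dot_sq_le hP hXW hlaw hind herr hΛ hE i i'
      _ = ENNReal.ofReal (∑ i : Fin n, ∑ i' : Fin n,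
            144 * Λ ^ 2 * ((if i = i' then (m : ℝ) ^ 2 else 0) + m)) := by
          have h0 : ∀ i i' : Fin n,
              0 ≤ 144 * Λ ^ 2 * ((if i = i' then (m : ℝ) ^ 2 else 0) + m) := by
            intro i i'; split_ifs <;> positivity
          rw [ENNReal.ofReal_sum_of_nonneg fun i _ => Finset.sum_nonneg fun i' _ => h0 i i']
          exact Finset.sum_congr rfl fun i _ =>
            (ENNReal.ofReal_sum_of_nonneg fun i' _ => h0 i i').symm
      -- The sum is `n m² + n² m`, which relative to `(n m)²` is `1/m · (m/n) · 1 + 1/m`, that is,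
      -- `1/n + 1/m`.
      _ = _ := by
          rw [← ENNReal.ofReal_mul (by positivity)]
          congr 1
          simp only [← Finset.mul_sum, Finset.sum_add_distrib, Finset.sum_ite_eq,
            Finset.mem_univ, if_true, Finset.sum_const, Finset.card_univ, Fintype.card_fin,
            nsmul_eq_mul]
          field_simp
  have hpos : 0 < t * ((n : ℝ) * m) ^ 2 := by positivity
  have hfin := (ENNReal.mul_le_mul_iff_right (ENNReal.ofReal_pos.2 hpos).ne'
    ENNReal.ofReal_ne_top).1 (hmk.trans hsum)
  refine (measure_mono ?_).trans hfin
  intro ω hω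
  change ENNReal.ofReal _ ≤ _
  refine (ENNReal.ofReal_le_ofReal hω).trans (le_of_eq ?_)
  rw [ENNReal.ofReal_sum_of_nonneg fun i _ => Finset.sum_nonneg fun i' _ => sq_nonneg _]
  exact Finset.sum_congr rfl fun i _ => ENNReal.ofReal_sum_of_nonneg fun i' _ => sq_nonneg _

/-- The `n × K` matrix of factor residuals. -/
noncomputable def factorMat (P : Model p m K) (D : Sample n p m K) : Matrix (Fin n) (Fin K) ℝ :=
  of fun i => P.W (D i).1

/-- As `K` is fixed, an entrywise law of large numbers suffices: entries within `t` of `Σ_W` change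
the quadratic form by at most `t K ‖x‖² ≤ (cW / 2) ‖x‖²`. Using `K + 1` in `t` avoids dividing by
zero. -/
lemma measure_factor_gram_not_ge_le [IsProbabilityMeasure μ] (hn : 0 < n) (hP : P.IsStandard)
    (hXW : IndepFun Prod.fst P.W P.lawXZ)
    (hlaw : ∀ i, HasLaw (fun ω => D ω i) P.law μ) (hind : iIndepFun (fun i ω => D ω i) μ)
    (herr : P.SubGaussianErrors γw γe) (hΛ : 0 < Λ) (hW : γw ^ 2 * opNorm P.SigW ≤ Λ)
    {cW : ℝ} (hcW : 0 < cW) (hge : EigenvaluesGE P.SigW cW) :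
    μ {ω | ¬ ∀ x : Fin K → ℝ, cW / 2 * n * (x ⬝ᵥ x) ≤
        P.factorMat (D ω) *ᵥ x ⬝ᵥ P.factorMat (D ω) *ᵥ x} ≤
      ENNReal.ofReal (K ^ 2 * (144 * Λ ^ 2 / (n * (cW / (2 * (K + 1))) ^ 2))) := by
  have hn' : (0 : ℝ) < n := by positivity
  set t := cW / (2 * ((K : ℝ) + 1)) with ht
  have ht0 : 0 < t := by positivity
  have hW' : ∀ k, γw ^ 2 * P.SigW k k ≤ Λ := fun k =>
    (mul_le_mul_of_nonneg_left (diag_le_opNorm _ k) (sq_nonneg γw)).trans hW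
  set S : Fin K → Fin K → Set Ω := fun k l => {ω | t ≤ |(n : ℝ)⁻¹ *
    ∑ i, ((P.splitSample (D ω)).2 i).1 k * ((P.splitSample (D ω)).2 i).1 l - P.SigW k l|} with hS
  have hSle : ∀ k l, μ (S k l) ≤ ENNReal.ofReal (144 * Λ ^ 2 / (n * t ^ 2)) := by
    intro k l
    obtain ⟨h1, h2⟩ := (hasSubgaussianMGF_W hP herr k).memLp_mul_two
      (hasSubgaussianMGF_W hP herr l) hΛ (toNNReal_le hΛ (hW' k)) (toNNReal_le hΛ (hW' l))
    exact measure_err_mean_sub_ge_le hn hP hXW hlaw hind (by fun_prop) h1 ht0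
      (integral_W_mul_W hP herr k l) h2
  have hsub : {ω | ¬ ∀ x : Fin K → ℝ, cW / 2 * n * (x ⬝ᵥ x) ≤
      P.factorMat (D ω) *ᵥ x ⬝ᵥ P.factorMat (D ω) *ᵥ x} ⊆ ⋃ k, ⋃ l, S k l := by
    intro ω hω
    by_contra hcon
    simp only [Set.mem_iUnion, not_exists] at hcon
    refine hω fun x => ?_
    set W := P.factorMat (D ω)
    set Δ : Matrix (Fin K) (Fin K) ℝ := (n : ℝ)⁻¹ • (Wᵀ * W) - P.SigW with hΔ
    have hΔle : ∀ k l, |Δ k l| ≤ t := by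
      intro k l
      have h1 : ¬ t ≤ |(n : ℝ)⁻¹ * ∑ i, ((P.splitSample (D ω)).2 i).1 k *
        ((P.splitSample (D ω)).2 i).1 l - P.SigW k l| := hcon k l
      exact (not_le.1 h1).le
    have hquad : |x ⬝ᵥ Δ *ᵥ x| ≤ t * (K * (x ⬝ᵥ x)) := by
      have h1 : |x ⬝ᵥ Δ *ᵥ x| ≤ (t * l1norm x) * l1norm x := by
        refine abs_dot_le_l1norm _ _ _ fun k => ?_
        rw [mulVec, dotProduct_comm]
        exact abs_dot_le_l1norm _ _ _ (hΔle k)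
      have h2 : l1norm x ^ 2 ≤ K * (x ⬝ᵥ x) := by
        have := sq_sum_le_card_mul_sum_sq (s := Finset.univ) (f := fun k => |x k|)
        simpa [l1norm, dotProduct, sq] using this
      calc _ ≤ t * l1norm x ^ 2 := by rw [sq, ← mul_assoc]; exact h1
        _ ≤ _ := by gcongr
    have hxx := dot_self_nonneg x
    have htK : t * (K * (x ⬝ᵥ x)) ≤ cW / 2 * (x ⬝ᵥ x) := by
      have : t * K ≤ cW / 2 := by
        rw [ht, div_mul_eq_mul_div, div_le_div_iff₀ (by positivity) (by norm_num)]
        nlinarith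
      rw [← mul_assoc]; gcongr
    have hsig := hge.le_dot x
    have hdec : (n : ℝ)⁻¹ * (W *ᵥ x ⬝ᵥ W *ᵥ x) = x ⬝ᵥ P.SigW *ᵥ x + x ⬝ᵥ Δ *ᵥ x := by
      rw [hΔ, sub_mulVec, smul_mulVec, dotProduct_sub, dotProduct_smul, smul_eq_mul,
        mulVec_dot_mulVec]; ring
    have h3 := (abs_le.1 hquad).1
    have h4 : cW / 2 * (x ⬝ᵥ x) ≤ (n : ℝ)⁻¹ * (W *ᵥ x ⬝ᵥ W *ᵥ x) := by rw [hdec]; linarith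
    rw [le_inv_mul_iff₀ hn'] at h4
    linarith
  refine (measure_mono hsub).trans ?_
  calc μ (⋃ k, ⋃ l, S k l)
      ≤ ∑ _k : Fin K, ∑ _l : Fin K, ENNReal.ofReal (144 * Λ ^ 2 / (n * t ^ 2)) :=
        (measure_iUnion_fintype_le _ _).trans (Finset.sum_le_sum fun k _ =>
          (measure_iUnion_fintype_le _ _).trans (Finset.sum_le_sum fun l _ => hSle k l))
    _ = _ := by
        simp only [Finset.sum_const, Finset.card_univ, Fintype.card_fin, nsmul_eq_mul]
        rw [ENNReal.ofReal_mul (by positivity), ENNReal.ofReal_pow (Nat.cast_nonneg _),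
          ENNReal.ofReal_natCast, sq (K : ENNReal), mul_assoc]

/-- The products `W_k E_1` have mean zero because `W` and `E` are independent and `E` is centered,
so each of the `K` averages is small. -/
lemma measure_factor_noise_gt_le [IsProbabilityMeasure μ] [NeZero m] (hn : 0 < n)
    (hP : P.IsStandard) (hXW : IndepFun Prod.fst P.W P.lawXZ)
    (hlaw : ∀ i, HasLaw (fun ω => D ω i) P.law μ) (hind : iIndepFun (fun i ω => D ω i) μ)
    (herr : P.SubGaussianErrors γw γe) (hΛ : 0 < Λ) (hW : γw ^ 2 * opNorm P.SigW ≤ Λ)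
    (hE : γe ^ 2 * opNorm P.SigE ≤ Λ) {τ : ℝ} (hτ : 0 < τ) :
    μ {ω | ¬ (P.factorMat (D ω))ᵀ *ᵥ (fun i => noiseMat (D ω) i 0) ⬝ᵥ
        (P.factorMat (D ω))ᵀ *ᵥ (fun i => noiseMat (D ω) i 0) ≤ τ ^ 2 * n ^ 2} ≤
      ENNReal.ofReal (K * (144 * Λ ^ 2 / (n * (τ / (K + 1)) ^ 2))) := by
  have hn' : (0 : ℝ) < n := by positivity
  set t := τ / ((K : ℝ) + 1) with ht
  have ht0 : 0 < t := by positivity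
  have hW' : ∀ k, γw ^ 2 * P.SigW k k ≤ Λ := fun k =>
    (mul_le_mul_of_nonneg_left (diag_le_opNorm _ k) (sq_nonneg γw)).trans hW
  have hE' : γe ^ 2 * P.SigE 0 0 ≤ Λ :=
    (mul_le_mul_of_nonneg_left (diag_le_opNorm _ 0) (sq_nonneg γe)).trans hE
  set S : Fin K → Set Ω := fun k => {ω | t ≤ |(n : ℝ)⁻¹ *
    ∑ i, ((P.splitSample (D ω)).2 i).1 k * ((P.splitSample (D ω)).2 i).2 0 - 0|} with hS
  have hSle : ∀ k, μ (S k) ≤ ENNReal.ofReal (144 * Λ ^ 2 / (n * t ^ 2)) := by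
    intro k
    obtain ⟨h1, h2⟩ := (hasSubgaussianMGF_W hP herr k).memLp_mul_two
      (hasSubgaussianMGF_E hP herr 0) hΛ (toNNReal_le hΛ (hW' k)) (toNNReal_le hΛ hE')
    exact measure_err_mean_sub_ge_le hn hP hXW hlaw hind (by fun_prop) h1 ht0
      (integral_W_mul_E hP herr k 0) h2
  refine (measure_mono (t := ⋃ k, S k) ?_).trans ?_
  · intro ω hω
    by_contra hcon
    simp only [Set.mem_iUnion, not_exists] at hcon
    refine hω ?_
    set z := (P.factorMat (D ω))ᵀ *ᵥ (fun i => noiseMat (D ω) i 0)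
    have hz : ∀ k, z k * z k ≤ (n * t) ^ 2 := by
      intro k
      have h1 : ¬ t ≤ |(n : ℝ)⁻¹ * z k - 0| := hcon k
      rw [sub_zero, abs_mul, abs_of_pos (inv_pos.2 hn'), not_le, inv_mul_lt_iff₀ hn'] at h1
      rw [← sq, ← sq_abs]
      exact pow_le_pow_left₀ (abs_nonneg _) h1.le 2
    calc z ⬝ᵥ z ≤ ∑ _k : Fin K, ((n : ℝ) * t) ^ 2 := Finset.sum_le_sum fun k _ => hz k
      _ = (K * t ^ 2) * n ^ 2 := by
          rw [Finset.sum_const, Finset.card_univ, Fintype.card_fin, nsmul_eq_mul]; ring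
      _ ≤ τ ^ 2 * n ^ 2 := by
          gcongr
          rw [ht, div_pow, ← mul_div_assoc, div_le_iff₀ (by positivity)]
          have : (K : ℝ) ≤ (K + 1) ^ 2 := by nlinarith [(Nat.cast_nonneg K : (0 : ℝ) ≤ K)]
          nlinarith [sq_nonneg τ]
  · calc μ (⋃ k, S k) ≤ ∑ _k : Fin K, ENNReal.ofReal (144 * Λ ^ 2 / (n * t ^ 2)) :=
          (measure_iUnion_fintype_le _ _).trans (Finset.sum_le_sum fun k _ => hSle k)
      _ = _ := by
        rw [Finset.sum_const, Finset.card_univ, Fintype.card_fin, nsmul_eq_mul,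
          ENNReal.ofReal_mul (Nat.cast_nonneg _), ENNReal.ofReal_natCast]

lemma measure_noise_variance_ge_le [IsProbabilityMeasure μ] [NeZero m] (hn : 0 < n)
    (hP : P.IsStandard) (hXW : IndepFun Prod.fst P.W P.lawXZ)
    (hlaw : ∀ i, HasLaw (fun ω => D ω i) P.law μ) (hind : iIndepFun (fun i ω => D ω i) μ)
    (herr : P.SubGaussianErrors γw γe) (hΛ : 0 < Λ) (hE : γe ^ 2 * opNorm P.SigE ≤ Λ)
    {τ : ℝ} (hτ : 0 < τ) :
    μ {ω | τ ≤ |(n : ℝ)⁻¹ * ((fun i => noiseMat (D ω) i 0) ⬝ᵥ fun i => noiseMat (D ω) i 0) -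
        P.SigE 0 0|} ≤ ENNReal.ofReal (144 * Λ ^ 2 / (n * τ ^ 2)) := by
  have hE' : γe ^ 2 * P.SigE 0 0 ≤ Λ :=
    (mul_le_mul_of_nonneg_left (diag_le_opNorm _ 0) (sq_nonneg γe)).trans hE
  have h := hasSubgaussianMGF_E hP herr 0
  obtain ⟨h1, h2⟩ := h.memLp_mul_two h hΛ (toNNReal_le hΛ hE') (toNNReal_le hΛ hE')
  exact measure_err_mean_sub_ge_le (f := fun q => q.2 0 * q.2 0) hn hP hXW hlaw hind (by fun_prop)
    h1 hτ (integral_E_mul_E hP herr 0 0) h2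

end Coordinates

end Model

end HiddenVar

namespace HiddenVar

open Matrix

/-! ### The good event -/

lemma mulVec_dot_self_le_frobenius {n m : ℕ} (R : Matrix (Fin n) (Fin m) ℝ) (v : Fin m → ℝ) :
    R *ᵥ v ⬝ᵥ R *ᵥ v ≤ (∑ j, (fun i => R i j) ⬝ᵥ fun i => R i j) * (v ⬝ᵥ v) := by
  calc R *ᵥ v ⬝ᵥ R *ᵥ v = ∑ i, (R i ⬝ᵥ v) ^ 2 := Finset.sum_congr rfl fun i _ => (sq _).symm
    _ ≤ ∑ i, (R i ⬝ᵥ R i) * (v ⬝ᵥ v) := Finset.sum_le_sum fun i _ => dot_sq_le _ _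
    _ = _ := by
        rw [← Finset.sum_mul]
        congr 1
        simp only [dotProduct]
        exact Finset.sum_comm

/-- The squared operator norm of `E` is that of `E Eᵀ`, hence at most the Frobenius norm of `E Eᵀ`.
This is far better than the Frobenius norm of `E`, whose square is typically of the full order `n
m`. -/
lemma mulVec_dot_self_le_gram {n m : ℕ} (E : Matrix (Fin n) (Fin m) ℝ) {f : ℝ} (hf : 0 ≤ f)
    (hE : ∑ i, ∑ i', (E i ⬝ᵥ E i') ^ 2 ≤ f ^ 2) (v : Fin m → ℝ) :
    E *ᵥ v ⬝ᵥ E *ᵥ v ≤ f * (v ⬝ᵥ v) := by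
  set u := E *ᵥ v with hu
  have huu := dot_self_nonneg u
  have hG : ∀ i, ((E * Eᵀ) *ᵥ u) i = (fun i' => E i ⬝ᵥ E i') ⬝ᵥ u := fun i => rfl
  have h1 : (E * Eᵀ) *ᵥ u ⬝ᵥ (E * Eᵀ) *ᵥ u ≤ f ^ 2 * (u ⬝ᵥ u) := by
    calc (E * Eᵀ) *ᵥ u ⬝ᵥ (E * Eᵀ) *ᵥ u = ∑ i, ((fun i' => E i ⬝ᵥ E i') ⬝ᵥ u) ^ 2 :=
          Finset.sum_congr rfl fun i _ => by rw [hG, sq]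
      _ ≤ ∑ i, ((fun i' => E i ⬝ᵥ E i') ⬝ᵥ fun i' => E i ⬝ᵥ E i') * (u ⬝ᵥ u) :=
          Finset.sum_le_sum fun i _ => dot_sq_le _ _
      _ = (∑ i, ∑ i', (E i ⬝ᵥ E i') ^ 2) * (u ⬝ᵥ u) := by
          rw [← Finset.sum_mul]
          simp only [dotProduct, sq]
      _ ≤ f ^ 2 * (u ⬝ᵥ u) := by gcongr
  have h2 : Eᵀ *ᵥ u ⬝ᵥ Eᵀ *ᵥ u ≤ f * (u ⬝ᵥ u) := by
    refine le_of_pow_le_pow_left₀ two_ne_zero (by positivity) ?_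
    rw [mulVec_dot_mulVec, transpose_transpose]
    refine (dot_sq_le _ _).trans ?_
    calc (u ⬝ᵥ u) * ((E * Eᵀ) *ᵥ u ⬝ᵥ (E * Eᵀ) *ᵥ u) ≤ (u ⬝ᵥ u) * (f ^ 2 * (u ⬝ᵥ u)) := by gcongr
      _ = _ := by ring
  have h3 : (u ⬝ᵥ u) ^ 2 ≤ (v ⬝ᵥ v) * (f * (u ⬝ᵥ u)) := by
    have : u ⬝ᵥ u = v ⬝ᵥ Eᵀ *ᵥ u := by rw [dot_mulVec_transpose]
    calc (u ⬝ᵥ u) ^ 2 = (v ⬝ᵥ Eᵀ *ᵥ u) ^ 2 := by rw [← this]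
      _ ≤ (v ⬝ᵥ v) * (Eᵀ *ᵥ u ⬝ᵥ Eᵀ *ᵥ u) := dot_sq_le _ _
      _ ≤ _ := by have := dot_self_nonneg v; gcongr
  rcases huu.eq_or_lt with h0 | h0
  · rw [← h0]; exact mul_nonneg hf (dot_self_nonneg v)
  · refine le_of_mul_le_mul_right ?_ h0
    calc (u ⬝ᵥ u) * (u ⬝ᵥ u) = (u ⬝ᵥ u) ^ 2 := (sq _).symm
      _ ≤ _ := h3
      _ = _ := by ring

namespace Model

variable {n p m K : ℕ} (P : Model p m K) (D : Sample n p m K)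

lemma hiddenMat_eq : hiddenMat D = P.factorMat D + designMat D * P.A := by
  ext i k
  have : P.W (D i).1 k = (D i).1.2 k - (P.Aᵀ *ᵥ (D i).1.1) k := rfl
  rw [Matrix.add_apply, factorMat, of_apply, this, mul_apply]
  simp only [hiddenMat, designMat, of_apply, mulVec, dotProduct, transpose_apply, mul_comm]
  ring

lemma responseMat_eq : responseMat P D =
    P.factorMat D * P.B + noiseMat D + designMat D * (P.Θ + P.A * P.B) := by
  rw [responseMat, P.hiddenMat_eq, Matrix.add_mul, Matrix.mul_add, Matrix.mul_assoc]
  abel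

lemma responseMat_col (j : Fin m) : (fun i => responseMat P D i j) =
    designMat D *ᵥ (fun i => P.Θ i j) + designMat D *ᵥ P.delta j +
      P.errVec j (P.splitSample D).2 := by
  ext i
  rw [responseMat_eq, Matrix.mul_add]
  have h1 : (P.factorMat D * P.B) i j + noiseMat D i j = P.errVec j (P.splitSample D).2 i := by
    change ∑ k, P.factorMat D i k * P.B k j + _ = (∑ k, P.B k j * _) + _
    congr 1
    exact Finset.sum_congr rfl fun k _ => mul_comm _ _
  simp only [Matrix.add_apply, Pi.add_apply]
  rw [← h1, add_comm]
  rfl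

/-- Only the trace part of Rem₁ is kept; the operator norm part is nonnegative and all remainders
are at most `r`. -/
lemma sigma_sq_trace_le {γw γe : ℝ} {s : ℕ} {X : Matrix (Fin n) (Fin p) ℝ} {lam r : ℝ}
    (hn : 0 < n) (hr : 0 ≤ r) (j : Fin m)
    (h : remTotal P γw γe s X lam j ≤ ENNReal.ofReal r) :
    P.sigma γw γe j ^ 2 * (Pmat X lam * Pmat X lam).trace ≤ n * r := by
  have hn' : (0 : ℝ) < n := by positivity
  have h1 : rem1 P γw γe X lam j ≤ r := by
    rw [← ENNReal.ofReal_le_ofReal_iff hr]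
    refine le_trans ?_ h
    rw [remTotal, add_assoc]
    exact le_self_add
  rw [rem1] at h1
  have h2 : 0 ≤ opNorm (Pmat X lam * Pmat X lam) * Real.log m :=
    mul_nonneg (opNorm_nonneg _) (Real.log_natCast_nonneg _)
  have h3 : (Pmat X lam * Pmat X lam).trace * (P.sigma γw γe j ^ 2 / n) ≤ r := by
    refine le_trans ?_ h1
    gcongr
    linarith
  rw [mul_div_assoc', div_le_iff₀ hn'] at h3
  linarith

/-- On the good event the residual variance is close to the noise variance. -/
lemma sigmaHatSq_sub_le_of_good [NeZero m] (hn : 0 < n) {γw γe : ℝ} {s : ℕ} {M : ℝ}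
    (hΘ : P.InClass s M) {cW CW cB CB CE cε : ℝ} (hcW : 0 < cW) (hcB : 0 < cB)
    (hfac : P.FactorRegularity cW CW cB CB CE cε)
    {lam : Fin m → ℝ} (hlam : ∀ j, 0 ≤ lam j) {r τ : ℝ} (hr : 0 ≤ r)
    (hτ : 0 < τ) (hτ1 : τ ≤ 1) (hτc : 4 * τ ^ 2 / cB ≤ cW / 4) (hrτ : 873 * r ≤ τ ^ 2 / 24)
    {Fhat : Matrix (Fin p) (Fin m) ℝ} {Bhat : Matrix (Fin K) (Fin m) ℝ}
    {What : Matrix (Fin n) (Fin K) ℝ}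
    (hR : ∀ j, IsUnit (ridgeMat (designMat D) (lam j)).det)
    (hrem : ∀ j, remTotal P γw γe s (designMat D) (lam j) j ≤ ENNReal.ofReal r)
    (hnoise : ∀ j i, |((designMat D)ᵀ *ᵥ (Qmat (designMat D) (lam j) *ᵥ
        P.errVec j (P.splitSample D).2)) i| ≤
      n * (lambdaOne P γw γe (designMat D) (lam j) j / 4))
    (hproj : ∑ j, Pmat (designMat D) (lam j) *ᵥ P.errVec j (P.splitSample D).2 ⬝ᵥ
      Pmat (designMat D) (lam j) *ᵥ P.errVec j (P.splitSample D).2 ≤ n * m * (τ ^ 2 / 24))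
    (hproj0 : Pmat (designMat D) (lam 0) *ᵥ P.errVec 0 (P.splitSample D).2 ⬝ᵥ
      Pmat (designMat D) (lam 0) *ᵥ P.errVec 0 (P.splitSample D).2 ≤ n * (τ ^ 2 / 24))
    (hE : ∑ i, ∑ i', (noiseMat D i ⬝ᵥ noiseMat D i') ^ 2 ≤ τ ^ 4 / 16 * (n * m) ^ 2)
    (hW : ∀ x : Fin K → ℝ, cW / 2 * n * (x ⬝ᵥ x) ≤ P.factorMat D *ᵥ x ⬝ᵥ P.factorMat D *ᵥ x)
    (hWE : (P.factorMat D)ᵀ *ᵥ (fun i => noiseMat D i 0) ⬝ᵥ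
        (P.factorMat D)ᵀ *ᵥ (fun i => noiseMat D i 0) ≤ τ ^ 2 * n ^ 2)
    (hvar : |(n : ℝ)⁻¹ * ((fun i => noiseMat D i 0) ⬝ᵥ fun i => noiseMat D i 0) -
        P.SigE 0 0| ≤ τ)
    (hF : IsLavaEstimate (designMat D) (responseMat P D)
      (fun j => lambdaOne P γw γe (designMat D) (lam j) j) lam Fhat)
    (hBW : IsFactorEstimate (residual (designMat D) (responseMat P D) Fhat) Bhat What) :
    |sigmaHatSq (residual (designMat D) (responseMat P D) Fhat) Bhat What - P.SigE 0 0| ≤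
      τ * (2 * (8 * CB / cB + 2) + (CE + 1) +
        4 / (cW / 2) * (1 + 4 / cB * (CE + 1)) + 1) := by
  have hn' : (0 : ℝ) < n := by positivity
  have hm' : (0 : ℝ) < m := by exact_mod_cast Nat.pos_of_ne_zero (NeZero.ne m)
  set X := designMat D with hX
  set R : Matrix (Fin n) (Fin m) ℝ := X * (P.Θ + P.A * P.B) - X * Fhat with hRdef
  have hres : residual X (responseMat P D) Fhat = P.factorMat D * P.B + (noiseMat D + R) := by
    rw [residual, responseMat_eq, hRdef, hX]; abel
  set e : Fin m → ℝ := fun j => Pmat X (lam j) *ᵥ P.errVec j (P.splitSample D).2 ⬝ᵥ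
      Pmat X (lam j) *ᵥ P.errVec j (P.splitSample D).2 with he
  have hRj : ∀ j, ((fun i => R i j) ⬝ᵥ fun i => R i j) ≤ 3 * (e j + n * (τ ^ 2 / 24)) := by
    intro j
    obtain ⟨θ', d', hsol, hFj⟩ := hF j
    rw [responseMat_col] at hsol
    have hs : l0norm (fun i => P.Θ i j) ≤ s := by
      refine le_trans (Set.ncard_le_ncard ?_ (Set.toFinite _)) hΘ.1
      intro i hi h0
      exact hi (congrFun h0 j)
    have h1 := lava_prediction_error P hn (hlam j) (hR j) j _ hs hr (hrem j) (hnoise j) hsol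
    have hcol : (fun i => R i j) =
        -(X *ᵥ (θ' + d') - X *ᵥ ((fun i => P.Θ i j) + P.delta j)) := by
      rw [neg_sub, ← hFj, hRdef]
      rfl
    rw [hcol, neg_dotProduct_neg]
    rw [inv_mul_le_iff₀ hn'] at h1
    refine h1.trans ?_
    have h2 : (n : ℝ) * (3 * ((n : ℝ)⁻¹ * e j + 873 * r)) = 3 * (e j + n * (873 * r)) := by
      field_simp
    calc _ = 3 * (e j + n * (873 * r)) := h2
      _ ≤ 3 * (e j + n * (τ ^ 2 / 24)) := by gcongr
  -- The tolerance `τ² / 24` enters twice and is multiplied by three, giving `τ² / 4`.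
  have hRsum : ∑ j, ((fun i => R i j) ⬝ᵥ fun i => R i j) ≤ τ ^ 2 / 4 * (n * m) := by
    calc ∑ j, ((fun i => R i j) ⬝ᵥ fun i => R i j) ≤ ∑ j, 3 * (e j + n * (τ ^ 2 / 24)) :=
          Finset.sum_le_sum fun j _ => hRj j
      _ = 3 * (∑ j, e j + m * (n * (τ ^ 2 / 24))) := by
          rw [← Finset.mul_sum, Finset.sum_add_distrib, Finset.sum_const, Finset.card_univ,
            Fintype.card_fin, nsmul_eq_mul]
      _ ≤ 3 * (n * m * (τ ^ 2 / 24) + m * (n * (τ ^ 2 / 24))) := by gcongr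
      _ = τ ^ 2 / 4 * (n * m) := by ring
  -- `E` and `R` each contribute `τ² / 4`, and splitting the square of the sum doubles both.
  have hN : ∀ v, (noiseMat D + R) *ᵥ v ⬝ᵥ (noiseMat D + R) *ᵥ v ≤
      τ ^ 2 * (n * m) * (v ⬝ᵥ v) := by
    intro v
    have hv := dot_self_nonneg v
    have h1 := mulVec_dot_self_le_gram (noiseMat D) (f := τ ^ 2 / 4 * (n * m)) (by positivity)
      (hE.trans (le_of_eq (by ring))) v
    have h2 := (mulVec_dot_self_le_frobenius R v).trans (mul_le_mul_of_nonneg_right hRsum hv)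
    rw [add_mulVec]
    refine (add_dot_self_le _ _).trans ?_
    linarith
  have hR0 : ((fun i => R i 0) ⬝ᵥ fun i => R i 0) ≤ τ ^ 2 * n := by
    refine (hRj 0).trans ?_
    have : e 0 ≤ n * (τ ^ 2 / 24) := hproj0
    have h0 : 0 ≤ (n : ℝ) * τ ^ 2 := by positivity
    linarith
  rw [hres] at hBW ⊢
  refine sigmaHatSq_sub_le hn hBW hcB (by positivity) hτ hτ1 (by linarith) hfac.B_pervasive
    (hfac.B_col_le 0) ((diag_le_opNorm _ 0).trans hfac.sigE_le) hN hW hR0 hWE hvar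

end Model

end HiddenVar

/-! ### The main theorem: collecting the exceptional events -/

theorem mainTheorem5
    -- the number `K` of hidden variables is fixed; `p` and `m` grow with the sample size `n`
    (K : ℕ) (p m : ℕ → ℕ) [∀ n, NeZero (p n)] [∀ n, NeZero (m n)]
    (hp : Tendsto p atTop atTop) (hm : Tendsto m atTop atTop)
    -- the model and the i.i.d. sample of size `n`, for every `n`
    (P : (n : ℕ) → HiddenVar.Model (p n) (m n) K) (hP : ∀ n, (P n).IsStandard)
    (Ω : ℕ → Type*) [∀ n, MeasurableSpace (Ω n)] (μ : (n : ℕ) → Measure (Ω n))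
    [∀ n, IsProbabilityMeasure (μ n)]
    (D : (n : ℕ) → Ω n → HiddenVar.Sample n (p n) (m n) K)
    (hD_law : ∀ n (i : Fin n), HasLaw (fun ω => D n ω i) (P n).law (μ n))
    (hD_indep : ∀ n, iIndepFun (fun (i : Fin n) ω => D n ω i) (μ n))
    -- sparsity class of the coefficient matrix
    (s : ℕ → ℕ) (M : ℕ → ℝ) (hs : ∀ n, 1 ≤ s n ∧ s n ≤ p n) (hM : ∀ n, 0 < M n)
    (hΘ : ∀ n, (P n).InClass (s n) (M n))
    -- sub-Gaussian errors; `W` is independent of `X`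
    (γw γe : ℝ) (hγw : 0 < γw) (hγe : 0 < γe)
    (h_err : ∀ n, (P n).SubGaussianErrors γw γe)
    (hXW : ∀ n, IndepFun Prod.fst (P n).W (P n).lawXZ)
    -- regularity of `B`, `Σ_W`, `Σ_E`
    (cW CW cB CB CE cε : ℝ) (hcW : 0 < cW) (hCW : cW ≤ CW) (hcB : 0 < cB) (hCB : cB ≤ CB)
    (hCE : 0 < CE) (hcε : 0 < cε)
    (h_fac : ∀ n, (P n).FactorRegularity cW CW cB CB CE cε)
    -- regularity of the design
    (c C : ℝ) (hc : 0 < c) (hcC : c < C)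
    (h_des : ∀ n, (P n).DesignRegularity (s n) c C)
    -- ridge parameters, possibly depending on the design, such that `P_λ` exists
    (lam2 : (n : ℕ) → Fin (m n) → Matrix (Fin n) (Fin (p n)) ℝ → ℝ)
    (h_lam2_meas : ∀ n j, Measurable fun x : Fin n → Fin (p n) → ℝ => lam2 n j (Matrix.of x))
    (h_lam2_nonneg : ∀ n j X, 0 ≤ lam2 n j X)
    (h_lam2_exists : Tendsto (fun n => μ n {ω | ¬ ∀ j, IsUnit (HiddenVar.ridgeMat
        (HiddenVar.designMat (D n ω)) (lam2 n j (HiddenVar.designMat (D n ω)))).det})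
      atTop (𝓝 0))
    -- the deterministic rate `r_n` bounding the remainder terms with probability tending to one
    (r : ℕ → ℝ) (hr_pos : ∀ n, 0 < r n) (hr : Tendsto r atTop (𝓝 0))
    (h_rem : Tendsto (fun n => μ n {ω | ¬ ∀ j, HiddenVar.remTotal (P n) γw γe (s n)
        (HiddenVar.designMat (D n ω)) (lam2 n j (HiddenVar.designMat (D n ω))) j
          ≤ ENNReal.ofReal (r n)})
      atTop (𝓝 0))
    -- remaining conditions: Gaussian first error, bounded `Cov(Z)`, growth conditions
    (hE1 : ∀ n, (P n).lawE.map (fun e => e 0) = gaussianReal 0 ((P n).SigE 0 0).toNNReal)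
    (hZ : (fun n => HiddenVar.opNorm (HiddenVar.covMatrix (P n).lawZ)) =O[atTop]
      (fun _ => (1 : ℝ)))
    (sΩ : ℕ → ℕ) (hsΩ : ∀ n, sΩ n = HiddenVar.l0norm (fun i => (P n).Omega i 0))
    (h_growth1 : (fun n => ((max (s n) (sΩ n) : ℕ) : ℝ) * Real.log (p n) * Real.log (m n))
      =o[atTop] (fun n => (n : ℝ)))
    (h_growth2 : (fun n => (s n : ℝ) * Real.log (p n)) =o[atTop] (fun n => Real.sqrt n))
    (h_Mn : (fun n => M n * Real.sqrt n) =o[atTop] (fun n => (m n : ℝ)))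
    (h_rn : Tendsto (fun n =>
        HiddenVar.l2norm ((P n).A 0) * Real.sqrt (Real.log (m n)) +
          (HiddenVar.l2norm ((P n).A 0) * Real.sqrt n +
            Real.sqrt (((max (s n) (sΩ n) : ℕ) : ℝ) * Real.log (p n))) * r n)
      atTop (𝓝 0))
    -- the estimators: any versions of the minimizers and of the singular vectors
    (Fhat : (n : ℕ) → Ω n → Matrix (Fin (p n)) (Fin (m n)) ℝ)
    (hF : ∀ n, ∀ᵐ ω ∂μ n, HiddenVar.IsLavaEstimate (HiddenVar.designMat (D n ω))
      (HiddenVar.responseMat (P n) (D n ω))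
      (fun j => HiddenVar.lambdaOne (P n) γw γe (HiddenVar.designMat (D n ω))
        (lam2 n j (HiddenVar.designMat (D n ω))) j)
      (fun j => lam2 n j (HiddenVar.designMat (D n ω))) (Fhat n ω))
    (Bhat : (n : ℕ) → Ω n → Matrix (Fin K) (Fin (m n)) ℝ)
    (What : (n : ℕ) → Ω n → Matrix (Fin n) (Fin K) ℝ)
    (hBW : ∀ n, K ≤ min n (m n) → ∀ᵐ ω ∂μ n, HiddenVar.IsFactorEstimate
      (HiddenVar.residual (HiddenVar.designMat (D n ω)) (HiddenVar.responseMat (P n) (D n ω))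
        (Fhat n ω)) (Bhat n ω) (What n ω)) :
    -- `|σ̂² - σ²| = o_P(1)`
    ∀ η : ℝ, 0 < η → Tendsto (fun n => μ n {ω | η ≤ |HiddenVar.sigmaHatSq
        (HiddenVar.residual (HiddenVar.designMat (D n ω)) (HiddenVar.responseMat (P n) (D n ω))
          (Fhat n ω)) (Bhat n ω) (What n ω) - (P n).SigE 0 0|})
      atTop (𝓝 0) := by
  intro η hη
  set Λ : ℝ := max (γw ^ 2 * CW) (γe ^ 2 * CE) with hΛdef
  have hΛ : 0 < Λ := lt_of_lt_of_le (by positivity) (le_max_right _ _)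
  have hW : ∀ n, γw ^ 2 * HiddenVar.opNorm (P n).SigW ≤ Λ := fun n =>
    (mul_le_mul_of_nonneg_left (h_fac n).sigW_le (sq_nonneg γw)).trans (le_max_left _ _)
  have hE : ∀ n, γe ^ 2 * HiddenVar.opNorm (P n).SigE ≤ Λ := fun n =>
    (mul_le_mul_of_nonneg_left (h_fac n).sigE_le (sq_nonneg γe)).trans (le_max_right _ _)
  set T : ℝ := 2 * (8 * CB / cB + 2) + (CE + 1) +
    4 / (cW / 2) * (1 + 4 / cB * (CE + 1)) + 1 with hT
  have hCB0 : 0 < CB := hcB.trans_le hCB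
  have hT0 : 0 < T := by positivity
  obtain ⟨τ, hτ, hτ1, hτc, hτη⟩ : ∃ τ : ℝ, 0 < τ ∧ τ ≤ 1 ∧ 4 * τ ^ 2 / cB ≤ cW / 4 ∧
      τ * T < η := by
    -- With `τ ≤ 1` and `τ ≤ cW cB / 16`, `4 τ² ≤ 4 τ ≤ cW cB / 4`; the last entry leaves `τ T ≤ η /
    -- 2`.
    refine ⟨min 1 (min (cW * cB / 16) (η / (2 * T))), by positivity, min_le_left _ _, ?_, ?_⟩
    · set τ := min 1 (min (cW * cB / 16) (η / (2 * T)))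
      have h0 : 0 < τ := by positivity
      have h1 : τ ≤ 1 := min_le_left _ _
      have h2 : τ ≤ cW * cB / 16 := (min_le_right _ _).trans (min_le_left _ _)
      rw [div_le_iff₀ hcB]
      nlinarith
    · have h3 : min 1 (min (cW * cB / 16) (η / (2 * T))) ≤ η / (2 * T) :=
        (min_le_right _ _).trans (min_le_right _ _)
      calc _ ≤ η / (2 * T) * T := mul_le_mul_of_nonneg_right h3 hT0.le
        _ = η / 2 := by field_simp
        _ < η := by linarith
  -- One summand per way of failing: existence of the ridge inverses, size of the remainders, noise
  -- above the penalties, projected noise over all responses and then for the first one, `‖E Eᵀ‖_F`,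
  -- the lower bound on `WᵀW`, `Wᵀ E_1`, and the average of `E_1²`.
  set bound : ℕ → ENNReal := fun n =>
    μ n {ω | ¬ ∀ j, IsUnit (HiddenVar.ridgeMat
        (HiddenVar.designMat (D n ω)) (lam2 n j (HiddenVar.designMat (D n ω)))).det} +
    μ n {ω | ¬ ∀ j, HiddenVar.remTotal (P n) γw γe (s n)
        (HiddenVar.designMat (D n ω)) (lam2 n j (HiddenVar.designMat (D n ω))) j
          ≤ ENNReal.ofReal (r n)} +
    ENNReal.ofReal (2 / m n) + ENNReal.ofReal (12 * r n / (τ ^ 2 / 24)) +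
    ENNReal.ofReal (12 * r n / (τ ^ 2 / 24)) +
    ENNReal.ofReal (144 * Λ ^ 2 / (τ ^ 4 / 16) * (1 / n + 1 / m n)) +
    ENNReal.ofReal (K ^ 2 * (144 * Λ ^ 2 / (n * (cW / (2 * (K + 1))) ^ 2))) +
    ENNReal.ofReal (K * (144 * Λ ^ 2 / (n * (τ / (K + 1)) ^ 2))) +
    ENNReal.ofReal (144 * Λ ^ 2 / (n * τ ^ 2)) with hbound
  have hmR : Tendsto (fun n => (m n : ℝ)) atTop atTop := tendsto_natCast_atTop_atTop.comp hm
  have hnR : Tendsto (fun n : ℕ => (n : ℝ)) atTop atTop := tendsto_natCast_atTop_atTop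
  have hof : ∀ {f : ℕ → ℝ}, Tendsto f atTop (𝓝 0) →
      Tendsto (fun n => ENNReal.ofReal (f n)) atTop (𝓝 0) := fun h => by
    simpa using ENNReal.tendsto_ofReal h
  have hinv : ∀ a b : ℝ, 0 < b → Tendsto (fun n : ℕ => a / (n * b)) atTop (𝓝 0) :=
    fun a b hb => (hnR.atTop_mul_const hb).const_div_atTop a
  have hbound0 : Tendsto bound atTop (𝓝 0) := by
    have t3 := hof (hmR.const_div_atTop 2)
    have t4 : Tendsto (fun n => ENNReal.ofReal (12 * r n / (τ ^ 2 / 24))) atTop (𝓝 0) :=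
      hof (by simpa using (hr.const_mul 12).div_const (τ ^ 2 / 24))
    have u5 : Tendsto (fun n : ℕ => 144 * Λ ^ 2 / (τ ^ 4 / 16) * (1 / (n : ℝ) + 1 / m n))
        atTop (𝓝 0) := by
      simpa using ((hnR.const_div_atTop 1).add (hmR.const_div_atTop 1)).const_mul
        (144 * Λ ^ 2 / (τ ^ 4 / 16))
    have u6 : Tendsto (fun n : ℕ =>
        (K : ℝ) ^ 2 * (144 * Λ ^ 2 / (n * (cW / (2 * (K + 1))) ^ 2))) atTop (𝓝 0) := by
      simpa using (hinv (144 * Λ ^ 2) ((cW / (2 * ((K : ℝ) + 1))) ^ 2)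
        (by positivity)).const_mul ((K : ℝ) ^ 2)
    have u7 : Tendsto (fun n : ℕ => (K : ℝ) * (144 * Λ ^ 2 / (n * (τ / (K + 1)) ^ 2)))
        atTop (𝓝 0) := by
      simpa using (hinv (144 * Λ ^ 2) ((τ / ((K : ℝ) + 1)) ^ 2) (by positivity)).const_mul (K : ℝ)
    have t8 := hof (hinv (144 * Λ ^ 2) (τ ^ 2) (by positivity))
    have := (((((((h_lam2_exists.add h_rem).add t3).add t4).add t4).add (hof u5)).add (hof u6)).add
      (hof u7)).add t8
    simp only [add_zero] at this
    exact this
  refine tendsto_of_tendsto_of_tendsto_of_le_of_le' tendsto_const_nhds hbound0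
    (Eventually.of_forall fun _ => zero_le) ?_
  have hr873 : ∀ᶠ n in atTop, 873 * r n ≤ τ ^ 2 / 24 := by
    have h1 : Tendsto (fun n => 873 * r n) atTop (𝓝 0) := by simpa using hr.const_mul 873
    exact (h1.eventually_lt_const (by positivity)).mono fun n h => h.le
  filter_upwards [hr873, eventually_gt_atTop 0, eventually_ge_atTop K,
    hm.eventually_ge_atTop K] with n hrn hn hKn hKm
  have hsplit := (hP n).hasLaw_splitSample (hXW n) (hD_law n) (hD_indep n)
  have b3 := HiddenVar.Model.measure_noise_not_le hn (hP n) (h_err n) hsplit (h_lam2_meas n)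
  have b4 := HiddenVar.Model.measure_proj_noise_ge_le hn (hP n) (h_err n) hsplit (h_lam2_meas n)
    Finset.univ Finset.univ_nonempty (r := r n) (θ := τ ^ 2 / 24) (by positivity)
  have b5 := HiddenVar.Model.measure_proj_noise_ge_le hn (hP n) (h_err n) hsplit (h_lam2_meas n)
    {0} (Finset.singleton_nonempty 0) (r := r n) (θ := τ ^ 2 / 24) (by positivity)
  have b6 := HiddenVar.Model.measure_noise_gram_ge_le hn (hP n) (hXW n) (hD_law n) (hD_indep n)
    (h_err n) hΛ (hE n) (t := τ ^ 4 / 16) (by positivity)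
  have b7 := HiddenVar.Model.measure_factor_gram_not_ge_le hn (hP n) (hXW n) (hD_law n)
    (hD_indep n) (h_err n) hΛ (hW n) hcW (h_fac n).sigW_ge
  have b8 := HiddenVar.Model.measure_factor_noise_gt_le hn (hP n) (hXW n) (hD_law n)
    (hD_indep n) (h_err n) hΛ (hW n) (hE n) hτ
  have b9 := HiddenVar.Model.measure_noise_variance_ge_le hn (hP n) (hXW n) (hD_law n)
    (hD_indep n) (h_err n) hΛ (hE n) hτ
  -- Monotonicity and subadditivity hold for arbitrary sets, so no measurability of the estimators
  -- is required.
  refine le_trans (measure_mono_ae ?_) ((measure_union_le _ _).trans (add_le_add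
    ((measure_union_le _ _).trans (add_le_add ((measure_union_le _ _).trans (add_le_add
    ((measure_union_le _ _).trans (add_le_add ((measure_union_le _ _).trans (add_le_add
    ((measure_union_le _ _).trans (add_le_add ((measure_union_le _ _).trans (add_le_add
    (measure_union_le _ _) b3)) b4)) b5)) b6)) b7)) b8)) b9))
  filter_upwards [hF n, hBW n (le_min hKn hKm)] with ω hFω hBWω hω
  by_contra hcon
  replace hcon : ω ∉ (_ ∪ _ : Set (Ω n)) := hcon
  simp only [Set.mem_union, not_or, Set.mem_ofPred_eq, not_not] at hcon
  obtain ⟨⟨⟨⟨⟨⟨⟨⟨h1, h2⟩, h3⟩, h4⟩, h5⟩, h6⟩, h7⟩, h8⟩, h9⟩ := hcon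
  -- The projected noise events include a trace condition on the design; the remainder bound
  -- supplies it, so lying outside those events bounds the sums themselves.
  have htr := fun j => (P n).sigma_sq_trace_le hn (hr_pos n).le j (h2 j)
  have h4' := (not_le.1 fun h => h4 ⟨fun j _ => htr j, h⟩).le
  have h5' := (not_le.1 fun h => h5 ⟨fun j _ => htr j, h⟩).le
  rw [Finset.card_univ, Fintype.card_fin] at h4'
  rw [Finset.card_singleton, Finset.sum_singleton, Nat.cast_one, mul_one] at h5'
  have hfin := (P n).sigmaHatSq_sub_le_of_good (D n ω) hn (hΘ n) hcW hcB (h_fac n)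
    (fun j => h_lam2_nonneg n j _) (hr_pos n).le hτ hτ1 hτc hrn h1 h2 h3 h4' h5'
    (not_le.1 h6).le h7 h8 (not_le.1 h9).le hFω hBWω
  have hω' : η ≤ _ := hω
  exact absurd (hω'.trans hfin) (not_le.2 hτη)
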